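/- **Setting.** Consider an MDP with measurable state space $\mathcal S$, action space $\mathcal A$ carrying a finite reference measure $da$ of total mass $|\mathcal A|$, transition kernel $\mathbb P(\cdot|s,a)$, measurable reward $r:\mathcal S\times\mathcal A\to[-R_r,R_r]$ and discount factor $\gamma\in(0,1)$. For $v\in\mathbb R^{d_v}$ let $\pi_v(a|s)>0$ be a policy density with respect to $da$; values are approximated by $V_w(s)=\phi(s)^\top w$, $w\in\mathbb R^{d_w}$, with a measurable feature map satisfying $\|\phi(s)\|\le1$. Norms are Euclidean, and $\|\mu-\nu\|_{TV}=\int|d\mu-d\nu|$. *Assumption 1.* $v\mapsto\log\pi_v(a|s)$ is differentiable, and for all $s,a,v,v'$: $\|\nabla\log\pi_v(a|s)\|\le R_\pi$, $\|\nabla\log\pi_v(a|s)-\nabla\log\pi_{v'}(a|s)\|\le L_\pi'\|v-v'\|$, $|\pi_v(a|s)-\pi_{v'}(a|s)|\le L_\pi\|v-v'\|$. *Assumption 2.* For every $v$ the state chain induced by $\pi_v$ has a stationary distribution $\mu_v$, and for some $c_0>0$, $\rho\in(0,1)$ its $t$-step transition kernels satisfy $\|\mathcal P_v^t(\cdot|s)-\mu_v\|_{TV}\le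 c_0\rho^t$ for all $v,s,t$. Moreover the smallest eigenvalue of $\int\phi\phi^\top d\mu_v$ is at least $\lambda>0$ for every $v$. For a trajectory $O=(s_0,a_0,s_1,\dots,a_{T-1},s_T)$, $T\ge1$, let $$g(w;O)=\phi(s_0)\,[\phi(s_0)-\gamma^T\phi(s_T)]^\top w-\phi(s_0)\sum_{t<T}\gamma^t r(s_t,a_t),\qquad H(v,w;O)=(1-\gamma)\sum_{t<T}\gamma^t h(v,w;o_t),$$ where $o_t=(s_t,a_t,s_{t+1})$ and $h(v,w;(s,a,s'))=[r(s,a)+(\gamma\phi(s')-\phi(s))^\top w]\nabla\log\pi_v(a|s)$. Let $w^*_v$ be the solution of $E[g(w;\bar O)]=0$, $\bar O$ being the $T$-step trajectory of the stationary chain under $\pi_v$, and let $\nabla J(v)=E_{s\sim\mu_v}\big[(1-\gamma)\sum_{t\ge0}\gamma^tE[h(v,w^*_v;o_t)\mid s_0=s]\big]$ be the policy gradient. *Algorithm.* With $n_{-1}=0$, $v_0=0$, $\|w_0\|\le R_w$ ($R_w>0$), step sizes $\alpha,\beta>0$ and momentum factor $\eta_1\in(0,1]$, for $k\ge0$: given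 the past, $O_k$ is a $T$-step rollout of $\pi_{v_k}$ started at $s_{k,0}$, where $s_{k+1,0}=s_{k,T}$, and $$n_k=(1-\eta_1)n_{k-1}+\eta_1g(w_k;O_k),\quad w_{k+1}=\mathrm{Proj}_{\|w\|\le R_w}[w_k-\beta n_k],\quad v_{k+1}=v_k+\alpha H(v_k,w_k;O_k).$$ Put $\Delta_k=w_k-w^*_{v_k}$, $\sigma=(1-\gamma^T)\lambda$, $R_g=(1+\gamma^T)R_w+\frac{1-\gamma^T}{1-\gamma}R_r$, $R_h=R_\pi[R_r+(1+\gamma)R_w]$. **Theorem.** There are constants $c_2,L_*,G_*>0$, depending only on $\gamma,\lambda,R_r,R_w,R_\pi,L_\pi,L_\pi',c_0,\rho,|\mathcal A|$, such that whenever Assumptions 1 and 2 hold, $\|\mu_v-\mu_{v'}\|_{TV}\le c_2|\mathcal A|L_\pi\|v-v'\|$ for all $v,v'$, and for every $T\ge1$: $w^*_v$ exists and is unique, $\|w^*_v-w^*_{v'}\|\le L_*\|v-v'\|$, $v\mapsto w_v^*$ is differentiable with $\|\nabla w^*_v\|\le G_*$; and if moreover $\|w^*_v\|\le R_w$ for all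 $v$, $T\ge\max\{\frac{\log(c_0^{-1}\beta)}{\log\rho},\frac{\log\beta}{2\log\gamma}\}$ and the initial state satisfies $\|\mathrm{Law}(s_{0,0})-\mu_{v_0}\|_{TV}\le c_0\rho^T$, then for every $K\ge1$ $$\begin{aligned}&\frac1K\Big[\sigma\beta-[(1+\gamma)R_\pi G_*+2G_*^2]\alpha\Big]\sum_{k=0}^{K-1}E\|\Delta_k\|^2\\&\le\frac{\alpha}{4K}\sum_{k=0}^{K-1}E\|\nabla J(v_k)\|^2+\frac1{2K}\big[E\|\Delta_0\|^2-E\|\Delta_K\|^2\big]+L_*^2R_h^2\alpha^2+\Big[\frac{c_4}{\eta_1}+R_g^2\Big]\beta^2\\&\quad+\Big[\frac{c_3}{\eta_1}+2R_wG_*\Big]R_h\alpha\beta+\frac{2(1-\eta_1)\beta}{\eta_1K}R_wR_g,\end{aligned}$$ where $c_3=[(1+\eta_1)L_*+2\eta_1(c_2+2T)|\mathcal A|L_\pi R_w]R_g$ and $c_4=[2\eta_1(R_g+9R_w)+(1-\eta_1)R_g]R_g$. -/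

import Mathlib

open MeasureTheory ProbabilityTheory

universe u₁ u₂ u₃

noncomputable section

namespace HBA2C

/-- Parameter space `ℝ^d` with the Euclidean norm. -/
abbrev Vec (d : ℕ) := EuclideanSpace ℝ (Fin d)

/-- A one-step observation `o = (s, a, s')`. -/
abbrev Obs (S A : Type*) := S × A × S

/-- A `T`-step trajectory `O = [o_0, …, o_{T-1}]`. -/
abbrev Traj (S A : Type*) (T : ℕ) := Fin T → Obs S A

/-- Total variation norm `‖μ - ν‖ = ∫ |p - q|`, where `p`, `q` are the densities of `μ`, `ν` with
respect to the common dominating measure `μ + ν`. -/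
def tvNorm {X : Type*} [MeasurableSpace X] (μ ν : Measure X) : ℝ :=
  ∫ x, |(μ.rnDeriv (μ + ν) x).toReal - (ν.rnDeriv (μ + ν) x).toReal| ∂(μ + ν)

/-- Projection onto the closed ball `‖x‖ ≤ R`. -/
def projBall {d : ℕ} (R : ℝ) (x : Vec d) : Vec d :=
  if ‖x‖ ≤ R then x else (R / ‖x‖) • x

/-- A Markov decision process with a parametric policy and a linear value-function class.
The policy `π_v(a|s)` is a probability density with respect to a finite reference measure on the
action space, whose total mass is `|𝒜|`. -/
structure Model (S A : Type*) [MeasurableSpace S] [MeasurableSpace A] (dv dw : ℕ) where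
  /-- transition kernel `ℙ(· | s, a)` -/
  trans : Kernel (S × A) S
  markov_trans : IsMarkovKernel trans
  /-- reward `r(s, a)` -/
  reward : S → A → ℝ
  measurable_reward : Measurable (Function.uncurry reward)
  /-- reference measure `da` on the action space -/
  refA : Measure A
  finite_refA : IsFiniteMeasure refA
  /-- policy density `π_v(a | s)` -/
  pol : Vec dv → S → A → ℝ
  measurable_pol : ∀ v, Measurable (Function.uncurry (pol v))
  pol_pos : ∀ v s a, 0 < pol v s a
  pol_lintegral : ∀ v s, ∫⁻ a, ENNReal.ofReal (pol v s a) ∂refA = 1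
  /-- feature embedding `φ(s)` -/
  feat : S → Vec dw
  measurable_feat : Measurable feat
  norm_feat_le : ∀ s, ‖feat s‖ ≤ 1

attribute [instance] Model.markov_trans Model.finite_refA

namespace Model

variable {S A : Type*} [MeasurableSpace S] [MeasurableSpace A] {dv dw : ℕ}

/-- The policy `π_v(· | s)` as a kernel. -/
def polKernel (M : Model S A dv dw) (v : Vec dv) : Kernel S A :=
  Kernel.withDensity (Kernel.const S M.refA) (fun s a => ENNReal.ofReal (M.pol v s a))

/-- The law of an observation `(s, a, s')` given `s`, where `a ∼ π_v(·|s)`, `s' ∼ ℙ(·|s,a)`. -/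
def obsKernel (M : Model S A dv dw) (v : Vec dv) : Kernel S (Obs S A) :=
  Kernel.prod Kernel.id (Kernel.compProd (M.polKernel v) M.trans)

/-- The state transition kernel of the Markov chain induced by `π_v`; its `t`-th power is the
`t`-step transition kernel. -/
def stateKernel (M : Model S A dv dw) (v : Vec dv) : Kernel S S :=
  (Kernel.compProd (M.polKernel v) M.trans).snd

/-- The law of an `n`-step trajectory under `π_v` started at a given state. -/
def rollout (M : Model S A dv dw) (v : Vec dv) : (n : ℕ) → Kernel S (Traj S A n)
  | 0 => Kernel.const S (Measure.dirac Fin.elim0)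
  | n + 1 =>
      (Kernel.compProd (M.obsKernel v)
        ((M.rollout v n).comap (fun p : S × Obs S A => p.2.2.2) (by fun_prop))).map
        (fun p : Obs S A × Traj S A n => (Fin.cons p.1 p.2 : Traj S A (n + 1)))

/-- The score `∇_v log π_v(a|s)`. -/
def score (M : Model S A dv dw) (v : Vec dv) (s : S) (a : A) : Vec dv :=
  gradient (fun u => Real.log (M.pol u s a)) v

/-- Regularity of the policy class: bounded and Lipschitz score, Lipschitz density. -/
structure PolicyRegular (M : Model S A dv dw) (Rπ Lπ' Lπ : ℝ) : Prop where
  differentiable : ∀ s a, Differentiable ℝ (fun v => Real.log (M.pol v s a))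
  score_bound : ∀ v s a, ‖M.score v s a‖ ≤ Rπ
  score_lip : ∀ v v' s a, ‖M.score v s a - M.score v' s a‖ ≤ Lπ' * ‖v - v'‖
  pol_lip : ∀ v v' s a, |M.pol v s a - M.pol v' s a| ≤ Lπ * ‖v - v'‖

/-- `μ v` is a stationary distribution of the chain induced by `π_v`, and the chain converges to it
geometrically in total variation, uniformly in the starting state and in `v`. -/
structure GeomErgodic (M : Model S A dv dw) (μ : Vec dv → Measure S) (c₀ ρ : ℝ) : Prop where
  prob : ∀ v, IsProbabilityMeasure (μ v)
  invariant : ∀ v, Kernel.Invariant (M.stateKernel v) (μ v)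
  mixing : ∀ v s (t : ℕ), tvNorm ((M.stateKernel v ^ t) s) (μ v) ≤ c₀ * ρ ^ t

/-- The smallest eigenvalue of `∫ φ(s) φ(s)ᵀ dμ_v(s)` is at least `lam`, for every `v`. -/
def FeatureCov (M : Model S A dv dw) (μ : Vec dv → Measure S) (lam : ℝ) : Prop :=
  ∀ v (x : Vec dw), lam * ‖x‖ ^ 2 ≤ ∫ s, (inner ℝ (M.feat s) x) ^ 2 ∂(μ v)

/-- First state `s_0` of a trajectory. -/
def firstState {T : ℕ} [NeZero T] (O : Traj S A T) : S := (O 0).1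

/-- Last state `s_T` of a trajectory. -/
def lastState {T : ℕ} [NeZero T] (O : Traj S A T) : S :=
  (O ⟨T - 1, Nat.sub_lt (Nat.pos_of_neZero T) Nat.one_pos⟩).2.2

/-- Stochastic semi-gradient `g(w; O) = Φ w - b` with `Φ = φ_0 (φ_0 - γ^T φ_T)ᵀ` and
`b = φ_0 ∑_{t<T} γ^t r_t`. -/
def semiGrad (M : Model S A dv dw) (γ : ℝ) {T : ℕ} [NeZero T] (w : Vec dw) (O : Traj S A T) :
    Vec dw :=
  (inner ℝ (M.feat (firstState O) - γ ^ T • M.feat (lastState O)) w) • M.feat (firstState O)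
    - (∑ t : Fin T, γ ^ (t : ℕ) * M.reward (O t).1 (O t).2.1) • M.feat (firstState O)

/-- Full semi-gradient `E[g(w; Ō)]`, with `Ō` the `T`-step trajectory of the stationary chain
under `π_v`. -/
def fullSemiGrad (M : Model S A dv dw) (μ : Vec dv → Measure S) (γ : ℝ) (T : ℕ) [NeZero T]
    (v : Vec dv) (w : Vec dw) : Vec dw :=
  ∫ O, M.semiGrad γ w O ∂((μ v).bind (M.rollout v T))

/-- Optimal critic parameter `w*_v`: the solution of `E[g(w; Ō)] = 0`. -/
def optCritic (M : Model S A dv dw) (μ : Vec dv → Measure S) (γ : ℝ) (T : ℕ) [NeZero T]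
    (v : Vec dv) : Vec dw :=
  Classical.epsilon (fun w => M.fullSemiGrad μ γ T v w = 0)

/-- `h(v, w; o) = [r(s,a) + (γ φ(s') - φ(s))ᵀ w] ∇ log π_v(a|s)` for `o = (s, a, s')`. -/
def hfun (M : Model S A dv dw) (γ : ℝ) (v : Vec dv) (w : Vec dw) (o : Obs S A) : Vec dv :=
  (M.reward o.1 o.2.1 + inner ℝ (γ • M.feat o.2.2 - M.feat o.1) w) • M.score v o.1 o.2.1

/-- Stochastic policy gradient `H(v, w; O) = (1-γ) ∑_{t<T} γ^t h(v, w; o_t)`. -/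
def stochPolGrad (M : Model S A dv dw) (γ : ℝ) {T : ℕ} (v : Vec dv) (w : Vec dw)
    (O : Traj S A T) : Vec dv :=
  (1 - γ) • ∑ t : Fin T, γ ^ (t : ℕ) • M.hfun γ v w (O t)

/-- Policy gradient from the state `s`: `∇J(v, w; s) = (1-γ) ∑_{t≥0} γ^t E[h(v, w; o_t)]`, where
`o_t` is the `t`-th observation of the chain under `π_v` started at `s`. -/
def polGradFrom (M : Model S A dv dw) (γ : ℝ) (v : Vec dv) (w : Vec dw) (s : S) : Vec dv :=
  (1 - γ) • ∑' t : ℕ, γ ^ t •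
    ∫ o, M.hfun γ v w o ∂(Kernel.comp (M.obsKernel v) (M.stateKernel v ^ t) s)

/-- Policy gradient `∇J(v) = E_{s ∼ μ_v}[∇J(v, w*_v; s)]`. -/
def polGrad (M : Model S A dv dw) (μ : Vec dv → Measure S) (γ : ℝ) (T : ℕ) [NeZero T]
    (v : Vec dv) : Vec dv :=
  ∫ s, M.polGradFrom γ v (M.optCritic μ γ T v) s ∂(μ v)

/-- The iterates `(v_k, w_k, n_{k-1})` of the algorithm along the trajectories `O_0, O_1, …`:
`n_k = (1-η) n_{k-1} + η g(w_k; O_k)`, `w_{k+1} = Proj(w_k - β n_k)`,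
`v_{k+1} = v_k + α H(v_k, w_k; O_k)`, with `n_{-1} = 0`. -/
def iter (M : Model S A dv dw) (γ Rw α β η : ℝ) {T : ℕ} [NeZero T] (v₀ : Vec dv) (w₀ : Vec dw)
    (O : ℕ → Traj S A T) : ℕ → Vec dv × Vec dw × Vec dw
  | 0 => (v₀, w₀, 0)
  | k + 1 =>
      let p := M.iter γ Rw α β η v₀ w₀ O k
      let n := (1 - η) • p.2.2 + η • M.semiGrad γ p.2.1 (O k)
      (p.1 + α • M.stochPolGrad γ p.1 p.2.1 (O k), projBall Rw (p.2.1 - β • n), n)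

/-- Actor iterate `v_k`. -/
def actor (M : Model S A dv dw) (γ Rw α β η : ℝ) {T : ℕ} [NeZero T] (v₀ : Vec dv) (w₀ : Vec dw)
    (O : ℕ → Traj S A T) (k : ℕ) : Vec dv :=
  (M.iter γ Rw α β η v₀ w₀ O k).1

/-- Critic iterate `w_k`. -/
def critic (M : Model S A dv dw) (γ Rw α β η : ℝ) {T : ℕ} [NeZero T] (v₀ : Vec dv) (w₀ : Vec dw)
    (O : ℕ → Traj S A T) (k : ℕ) : Vec dw :=
  (M.iter γ Rw α β η v₀ w₀ O k).2.1

/-- The state `s_{k,0}` in which frame `k` starts: `s_{0,0}` for `k = 0`, and the last state of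
the previous frame afterwards. -/
def frameStart {T : ℕ} [NeZero T] (s₀ : S) (O : ℕ → Traj S A T) : ℕ → S
  | 0 => s₀
  | k + 1 => lastState (O k)

/-- The trajectories `O_k` are sampled by the algorithm along one Markovian trajectory of the MDP:
given the information `ℱ_k` available before frame `k`, the trajectory `O_k` has the law of a
`T`-step rollout of `π_{v_k}` from `s_{k,0}`. -/
structure Samples {Ω : Type*} {mΩ : MeasurableSpace Ω} (P : Measure Ω) (ℱ : Filtration ℕ mΩ)
    (M : Model S A dv dw) (γ Rw α β η : ℝ) {T : ℕ} [NeZero T] (v₀ : Vec dv) (w₀ : Vec dw)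
    (s₀ : Ω → S) (O : ℕ → Ω → Traj S A T) : Prop where
  measurable_start : Measurable[ℱ 0] s₀
  measurable_traj : ∀ k, Measurable[ℱ (k + 1)] (O k)
  law : ∀ k (B : Set (Traj S A T)), MeasurableSet B →
    P[(O k ⁻¹' B).indicator (fun _ => (1 : ℝ)) | ℱ k] =ᵐ[P] fun ω =>
      (M.rollout (M.actor γ Rw α β η v₀ w₀ (fun j => O j ω) k) T
        (frameStart (s₀ ω) (fun j => O j ω) k)).real B

/-- `E‖Δ_k‖²` with `Δ_k = w_k - w*_{v_k}`. -/
def criticErr {Ω : Type*} {mΩ : MeasurableSpace Ω} (P : Measure Ω)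
    (M : Model S A dv dw) (μ : Vec dv → Measure S) (γ Rw α β η : ℝ) {T : ℕ} [NeZero T]
    (v₀ : Vec dv) (w₀ : Vec dw) (O : ℕ → Ω → Traj S A T) (k : ℕ) : ℝ :=
  ∫ ω, ‖M.critic γ Rw α β η v₀ w₀ (fun j => O j ω) k
    - M.optCritic μ γ T (M.actor γ Rw α β η v₀ w₀ (fun j => O j ω) k)‖ ^ 2 ∂P

/-- `E‖∇J(v_k)‖²`. -/
def gradSq {Ω : Type*} {mΩ : MeasurableSpace Ω} (P : Measure Ω)
    (M : Model S A dv dw) (μ : Vec dv → Measure S) (γ Rw α β η : ℝ) {T : ℕ} [NeZero T]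
    (v₀ : Vec dv) (w₀ : Vec dw) (O : ℕ → Ω → Traj S A T) (k : ℕ) : ℝ :=
  ∫ ω, ‖M.polGrad μ γ T (M.actor γ Rw α β η v₀ w₀ (fun j => O j ω) k)‖ ^ 2 ∂P

end Model

/-- `σ = (1 - γ^T) λ`. -/
def sig (γ lam : ℝ) (T : ℕ) : ℝ := (1 - γ ^ T) * lam

/-- `R_g = (1 + γ^T) R_w + (1 - γ^T)/(1 - γ) R_r`. -/
def Rg (γ Rr Rw : ℝ) (T : ℕ) : ℝ := (1 + γ ^ T) * Rw + (1 - γ ^ T) / (1 - γ) * Rr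

/-- `R_h = R_π [R_r + (1 + γ) R_w]`. -/
def Rh (γ Rr Rw Rπ : ℝ) : ℝ := Rπ * (Rr + (1 + γ) * Rw)

/-- `c₃ = [(1 + η₁) L_* + 2 η₁ (c₂ + 2T) |𝒜| L_π R_w] R_g`. -/
def c3 (γ Rr Rw Lπ volA c₂ Ls η : ℝ) (T : ℕ) : ℝ :=
  ((1 + η) * Ls + 2 * η * (c₂ + 2 * T) * volA * Lπ * Rw) * Rg γ Rr Rw T

/-- `c₄ = [2 η₁ (R_g + 9 R_w) + (1 - η₁) R_g] R_g`. -/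
def c4 (γ Rr Rw η : ℝ) (T : ℕ) : ℝ :=
  (2 * η * (Rg γ Rr Rw T + 9 * Rw) + (1 - η) * Rg γ Rr Rw T) * Rg γ Rr Rw T

end HBA2C

end

/-! The critic error is controlled by a Lyapunov argument for `‖Δ_k‖²`. By nonexpansiveness of the
projection, half its increment is at most `-β⟨Δ_k, n_k⟩` plus the drift term `⟨Δ_k, w*_{v_k} -
w*_{v_{k+1}}⟩` plus errors of order `β²` and `α²`. Two facts are then needed in mean: the momentum
direction is a descent direction, and the drift of the target costs only `α/4 ‖∇J‖²` and a multiple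
of `α‖Δ_k‖²`.

Descent. The full semi-gradient is affine, `Φ_v w - b_v`, and stationarity together with `2ab ≤ a² +
b²` makes `Φ_v` coercive with constant `σ` (`coercive`). Hence `w*_v` is unique, `E[g(w)] = Φ_v (w -
w*_v)`, and testing with `Δ` gives `σ‖Δ‖²`. Momentum is unrolled through its recursion; the delay
costs the factor `(1 - η)/η` (`momentum_succ`, `sum_le_of_momentum`).

Drift. A second-order expansion of `v ↦ w*_v` turns the drift into `-α⟨Δ, Dw*_v H⟩ + O(α²)`. Under
stationarity the mean of `H` is `1 - γ^T` times a one-step mean, whose value at `w = w*_v` is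
`∇J(v)` (`polGrad_eq`), and Young's inequality concludes (`integral_driftForm_ge`). The expansion
needs `w*_v` differentiable with Lipschitz derivative, although only first-order regularity of the
score is assumed. This is handled through bounded second differences (`IsC11`, `MeasC11`), which
survive composition of kernels, integration and the solution of linear systems, and which imply
differentiability in finite dimensions. For the stationary law they come from an approximate Poisson
equation (`exists_poisson`, `stationary`), which also gives `c₂ = c₀/(1 - ρ)`.

Bias. Frames do not start in the stationary law. Both means above are therefore off by functions of
`(v_k, w_k, s_{k,0})` that integrate to zero under `μ_{v_k}`. Freezing the iterates one frame
earlier and letting the chain mix for `T` steps, with `c₀ρ^T ≤ β`, bounds their expectation by `O(α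
+ β)` (`abs_integral_state_le`). Summing over `k` and choosing `L_*`, `G_*` large enough to absorb
all constants gives the theorem. -/

namespace HBA2C

/-! ### Functions with bounded first and second differences -/

/-- `f` is bounded by `B`, Lipschitz with constant `L`, and its second differences satisfy
`‖f (x + h + k) - f (x + h) - f (x + k) + f x‖ ≤ C ‖h‖ ‖k‖`. -/
structure IsC11 {V E : Type*} [NormedAddCommGroup V] [NormedAddCommGroup E] (B L C : ℝ)
    (f : V → E) : Prop where
  bound : ∀ x, ‖f x‖ ≤ B
  lip : ∀ x y, ‖f x - f y‖ ≤ L * ‖x - y‖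
  second : ∀ x h k, ‖f (x + h + k) - f (x + h) - f (x + k) + f x‖ ≤ C * ‖h‖ * ‖k‖

namespace IsC11

section Algebra

variable {V E : Type*} [NormedAddCommGroup V] [NormedAddCommGroup E]
  {B L C B' L' C' : ℝ} {f g : V → E}

theorem mono (hf : IsC11 B L C f) (hB : B ≤ B') (hL : L ≤ L') (hC : C ≤ C') :
    IsC11 B' L' C' f where
  bound x := (hf.bound x).trans hB
  lip x y := (hf.lip x y).trans (by gcongr)
  second x h k := (hf.second x h k).trans (by gcongr)

theorem const (c : E) (hB : ‖c‖ ≤ B) : IsC11 (V := V) B 0 0 (fun _ => c) where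
  bound _ := hB
  lip _ _ := by simp
  second _ _ _ := by simp

theorem add (hf : IsC11 B L C f) (hg : IsC11 B' L' C' g) :
    IsC11 (B + B') (L + L') (C + C') (fun x => f x + g x) where
  bound x := (norm_add_le _ _).trans (add_le_add (hf.bound x) (hg.bound x))
  lip x y := by
    calc _ = ‖(f x - f y) + (g x - g y)‖ := by congr 1; abel
      _ ≤ _ := norm_add_le _ _
      _ ≤ L * ‖x - y‖ + L' * ‖x - y‖ := add_le_add (hf.lip x y) (hg.lip x y)
      _ = _ := by ring
  second x h k := by
    calc _ = ‖(f (x + h + k) - f (x + h) - f (x + k) + f x)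
          + (g (x + h + k) - g (x + h) - g (x + k) + g x)‖ := by congr 1; abel
      _ ≤ _ := norm_add_le _ _
      _ ≤ C * ‖h‖ * ‖k‖ + C' * ‖h‖ * ‖k‖ := add_le_add (hf.second x h k) (hg.second x h k)
      _ = _ := by ring

theorem clm_comp {F : Type*} [NormedAddCommGroup F] [NormedSpace ℝ E] [NormedSpace ℝ F]
    (hf : IsC11 B L C f) (A : E →L[ℝ] F) {a : ℝ} (ha : ‖A‖ ≤ a) :
    IsC11 (a * B) (a * L) (a * C) (fun x => A (f x)) := by
  have key : ∀ y : E, ∀ r : ℝ, ‖y‖ ≤ r → ‖A y‖ ≤ a * r := fun y r hr =>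
    (A.le_opNorm y).trans (mul_le_mul ha hr (norm_nonneg _) ((norm_nonneg _).trans ha))
  refine ⟨fun x => key _ _ (hf.bound x), fun x y => ?_, fun x h k => ?_⟩
  · rw [← map_sub, mul_assoc]; exact key _ _ (hf.lip x y)
  · rw [← map_sub, ← map_sub, ← map_add, mul_assoc, mul_assoc]
    exact key _ _ (by simpa [mul_assoc] using hf.second x h k)

theorem const_smul [NormedSpace ℝ E] (hf : IsC11 B L C f) {c : ℝ} (hc : 0 ≤ c) :
    IsC11 (c * B) (c * L) (c * C) (fun x => c • f x) :=
  hf.clm_comp (c • ContinuousLinearMap.id ℝ E) (by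
    refine ContinuousLinearMap.opNorm_le_bound _ hc fun y => ?_
    simp [norm_smul, abs_of_nonneg hc])

theorem sum {ι : Type*} (s : Finset ι) {f : ι → V → E} {B L C : ι → ℝ}
    (h : ∀ i ∈ s, IsC11 (B i) (L i) (C i) (f i)) :
    IsC11 (∑ i ∈ s, B i) (∑ i ∈ s, L i) (∑ i ∈ s, C i) (fun x => ∑ i ∈ s, f i x) := by
  classical
  induction s using Finset.induction_on with
  | empty => simpa using IsC11.const (V := V) (0 : E) (by simp)
  | insert a s ha ih =>
    simp only [Finset.sum_insert ha]
    exact (h a (by simp)).add (ih fun i hi => h i (by simp [hi]))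

theorem lipschitzWith (hf : IsC11 B L C f) : LipschitzWith L.toNNReal f :=
  LipschitzWith.of_dist_le_mul fun z z' => by
    rw [dist_eq_norm, dist_eq_norm]
    exact (hf.lip z z').trans (by gcongr; exact Real.le_coe_toNNReal L)

end Algebra

/-! ### From bounded second differences to a Lipschitz derivative -/

section Differentiability

variable {V E : Type*} [NormedAddCommGroup V] [NormedSpace ℝ V]
  [NormedAddCommGroup E] [NormedSpace ℝ E] {B L C : ℝ} {f : V → E}

/-- The increment `z ↦ f (z + (x - y)) - f z` is Lipschitz with constant `C ‖x - y‖` by the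
second-difference bound, and its derivative at `y` is the difference of the two derivatives. -/
theorem norm_fderiv_sub_le (hf : IsC11 B L C f) (hC : 0 ≤ C) {x y : V}
    (hx : DifferentiableAt ℝ f x) (hy : DifferentiableAt ℝ f y) :
    ‖fderiv ℝ f x - fderiv ℝ f y‖ ≤ C * ‖x - y‖ := by
  have hx' : HasFDerivAt (fun z => f (z + (x - y))) (fderiv ℝ f x) y := by
    rw [hasFDerivAt_comp_add_right]
    simpa using hx.hasFDerivAt
  have h := hx'.sub hy.hasFDerivAt
  rw [← h.fderiv]
  have hc : 0 ≤ C * ‖x - y‖ := by positivity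
  obtain ⟨c, hce⟩ : ∃ c : NNReal, (c : ℝ) = C * ‖x - y‖ := ⟨⟨_, hc⟩, rfl⟩
  rw [← hce]
  refine norm_fderiv_le_of_lipschitz ℝ (LipschitzWith.of_dist_le_mul fun z z' => ?_)
  rw [dist_eq_norm, dist_eq_norm, hce]
  have := hf.second z' (x - y) (z - z')
  have e1 : z' + (x - y) + (z - z') = z + (x - y) := by abel
  have e2 : z' + (z - z') = z := by abel
  rw [e1, e2] at this
  refine le_of_eq_of_le (congrArg _ ?_) this
  simp only [Pi.sub_apply]
  abel

/-- By Rademacher's theorem the points of differentiability are dense. Along a sequence of them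
tending to `x` the derivatives are Cauchy by `norm_fderiv_sub_le`. Their limit is the derivative at
`x`, because the increments of `f` at `x` and at a nearby point differ by a second difference, which
is uniformly small relative to `‖d‖`. -/
theorem differentiable [FiniteDimensional ℝ V] [FiniteDimensional ℝ E]
    (hf : IsC11 B L C f) (hC : 0 ≤ C) : Differentiable ℝ f := by
  intro x
  have hE : CompleteSpace E := FiniteDimensional.complete ℝ E
  borelize V
  have hae : ∀ᵐ y ∂(Measure.addHaar : Measure V), DifferentiableAt ℝ f y :=
    hf.lipschitzWith.ae_differentiableAt
  have hdense : Dense {y | DifferentiableAt ℝ f y} := Measure.dense_of_ae hae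
  have hex : ∀ n : ℕ, ∃ y, DifferentiableAt ℝ f y ∧ ‖y - x‖ < 1 / ((n : ℝ) + 1) := fun n => by
    obtain ⟨y, hy, hy'⟩ := hdense.exists_dist_lt x (Nat.one_div_pos_of_nat (α := ℝ) (n := n))
    exact ⟨y, hy, by rwa [dist_comm, dist_eq_norm] at hy'⟩
  choose y hy hyx using hex
  have hlim : Filter.Tendsto (fun n : ℕ => 1 / ((n : ℝ) + 1)) Filter.atTop (nhds 0) :=
    tendsto_one_div_add_atTop_nhds_zero_nat
  have hcau : CauchySeq (fun n => fderiv ℝ f (y n)) := by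
    refine cauchySeq_of_le_tendsto_0 (fun n : ℕ => C * (2 * (1 / ((n : ℝ) + 1)))) ?_ ?_
    · intro n m N hn hm
      rw [dist_eq_norm]
      refine (hf.norm_fderiv_sub_le hC (hy n) (hy m)).trans ?_
      gcongr
      have h1 := (hyx n).le.trans (Nat.one_div_le_one_div (α := ℝ) hn)
      have h2 := (hyx m).le.trans (Nat.one_div_le_one_div (α := ℝ) hm)
      calc ‖y n - y m‖ = ‖(y n - x) - (y m - x)‖ := by congr 1; abel
        _ ≤ _ := norm_sub_le _ _
        _ ≤ _ := by linarith
    · simpa using (hlim.const_mul 2).const_mul C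
  obtain ⟨A, hA⟩ := cauchySeq_tendsto_of_complete hcau
  refine HasFDerivAt.differentiableAt (f' := A) ?_
  rw [hasFDerivAt_iff_isLittleO_nhds_zero, Asymptotics.isLittleO_iff]
  intro c hc
  have h1 : ∀ᶠ n : ℕ in Filter.atTop, C * (1 / ((n : ℝ) + 1)) < c / 3 := by
    have := hlim.const_mul C
    rw [mul_zero] at this
    exact this.eventually_lt_const (by positivity)
  have h2 : ∀ᶠ n : ℕ in Filter.atTop, ‖fderiv ℝ f (y n) - A‖ < c / 3 := by
    have := tendsto_iff_norm_sub_tendsto_zero.1 hA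
    exact this.eventually_lt_const (by positivity)
  obtain ⟨n, hn1, hn2⟩ := (h1.and h2).exists
  have h3 := Asymptotics.isLittleO_iff.1
    (hasFDerivAt_iff_isLittleO_nhds_zero.1 (hy n).hasFDerivAt) (show 0 < c / 3 by positivity)
  filter_upwards [h3] with d hd
  have h4 := hf.second x (y n - x) d
  have e1 : x + (y n - x) = y n := by abel
  rw [e1] at h4
  have h5 : ‖(fderiv ℝ f (y n) - A) d‖ ≤ c / 3 * ‖d‖ :=
    (ContinuousLinearMap.le_opNorm _ _).trans (by gcongr)
  have h6 : C * ‖y n - x‖ * ‖d‖ ≤ c / 3 * ‖d‖ := by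
    have : C * ‖y n - x‖ ≤ C * (1 / ((n : ℝ) + 1)) := by gcongr; exact (hyx n).le
    gcongr; linarith
  calc ‖f (x + d) - f x - A d‖
      = ‖(f (y n + d) - f (y n) - (fderiv ℝ f (y n)) d) + (fderiv ℝ f (y n) - A) d
          - (f (y n + d) - f (y n) - f (x + d) + f x)‖ := by
        congr 1; rw [sub_apply]; abel
    _ ≤ _ := norm_sub_le _ _
    _ ≤ _ := add_le_add (norm_add_le _ _) le_rfl
    _ ≤ c / 3 * ‖d‖ + c / 3 * ‖d‖ + c / 3 * ‖d‖ :=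
        add_le_add (add_le_add hd h5) (h4.trans h6)
    _ = c * ‖d‖ := by ring

theorem norm_fderiv_le (hf : IsC11 B L C f) (hL : 0 ≤ L) (x : V) : ‖fderiv ℝ f x‖ ≤ L := by
  have := norm_fderiv_le_of_lipschitz (x₀ := x) ℝ hf.lipschitzWith
  rwa [Real.coe_toNNReal L hL] at this

/-- The mean value inequality on the segment, applied to `f` minus its linearisation at `x`. The
factor `1/2` of Taylor's formula is not needed. -/
theorem norm_sub_fderiv_le [FiniteDimensional ℝ V] [FiniteDimensional ℝ E]
    (hf : IsC11 B L C f) (hC : 0 ≤ C) (x y : V) :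
    ‖f y - f x - fderiv ℝ f x (y - x)‖ ≤ C * ‖y - x‖ ^ 2 := by
  have hd := hf.differentiable hC
  have key := (convex_segment (𝕜 := ℝ) x y).norm_image_sub_le_of_norm_hasFDerivWithin_le
    (f := fun z => f z - fderiv ℝ f x z) (f' := fun z => fderiv ℝ f z - fderiv ℝ f x)
    (C := C * ‖y - x‖)
    (fun z _ => ((hd z).hasFDerivAt.sub (fderiv ℝ f x).hasFDerivAt).hasFDerivWithinAt)
    (fun z hz => (hf.norm_fderiv_sub_le hC (hd z) (hd x)).trans (by
      gcongr
      exact norm_sub_le_of_mem_segment hz))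
    (left_mem_segment ℝ x y) (right_mem_segment ℝ x y)
  calc _ = ‖f y - fderiv ℝ f x y - (f x - fderiv ℝ f x x)‖ := by
        congr 1; rw [map_sub]; abel
    _ ≤ C * ‖y - x‖ * ‖y - x‖ := key
    _ = _ := by ring

end Differentiability

end IsC11

/-! ### Total variation -/

/-- Both integrals are written with densities with respect to `μ + ν`, and `f` is estimated
pointwise by `B`. -/
theorem abs_integral_sub_le_tvNorm {X : Type*} [MeasurableSpace X] (μ ν : Measure X)
    [IsFiniteMeasure μ] [IsFiniteMeasure ν] {f : X → ℝ} (hf : Measurable f) {B : ℝ}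
    (hB : ∀ x, |f x| ≤ B) : |∫ x, f x ∂μ - ∫ x, f x ∂ν| ≤ B * tvNorm μ ν := by
  have hμ : μ ≪ μ + ν := Measure.AbsolutelyContinuous.rfl.add_right ν
  have hν : ν ≪ μ + ν := by
    rw [add_comm]; exact Measure.AbsolutelyContinuous.rfl.add_right μ
  have hi : ∀ κ : Measure X, [IsFiniteMeasure κ] →
      Integrable (fun x => (κ.rnDeriv (μ + ν) x).toReal) (μ + ν) :=
    fun κ _ => Measure.integrable_toReal_rnDeriv
  have hif : ∀ κ : Measure X, [IsFiniteMeasure κ] →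
      Integrable (fun x => (κ.rnDeriv (μ + ν) x).toReal * f x) (μ + ν) := fun κ _ =>
    (hi κ).mul_bdd (c := B) hf.aestronglyMeasurable (ae_of_all _ hB)
  have e1 : ∫ x, f x ∂μ = ∫ x, (μ.rnDeriv (μ + ν) x).toReal * f x ∂(μ + ν) :=
    (integral_rnDeriv_smul hμ (f := f)).symm
  have e2 : ∫ x, f x ∂ν = ∫ x, (ν.rnDeriv (μ + ν) x).toReal * f x ∂(μ + ν) :=
    (integral_rnDeriv_smul hν (f := f)).symm
  rw [e1, e2, ← integral_sub (hif μ) (hif ν), tvNorm, ← integral_const_mul]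
  refine (abs_integral_le_integral_abs).trans (integral_mono ?_ ?_ fun x => ?_)
  · exact ((hif μ).sub (hif ν)).abs
  · exact (((hi μ).sub (hi ν)).abs).const_mul B
  · simp only
    rw [← sub_mul, abs_mul, mul_comm]
    exact mul_le_mul_of_nonneg_right (hB x) (abs_nonneg _)

/-- The supremum over test functions is attained at the sign of the difference of the densities,
equal to `1` on `s` and `-1` off it, so testing this one function recovers the whole norm. -/
theorem tvNorm_le {X : Type*} [MeasurableSpace X] (μ ν : Measure X)
    [IsFiniteMeasure μ] [IsFiniteMeasure ν] {K : ℝ}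
    (h : ∀ f : X → ℝ, Measurable f → (∀ x, |f x| ≤ 1) → |∫ x, f x ∂μ - ∫ x, f x ∂ν| ≤ K) :
    tvNorm μ ν ≤ K := by
  have hμ : μ ≪ μ + ν := Measure.AbsolutelyContinuous.rfl.add_right ν
  have hν : ν ≪ μ + ν := by
    rw [add_comm]; exact Measure.AbsolutelyContinuous.rfl.add_right μ
  have hi : ∀ κ : Measure X, [IsFiniteMeasure κ] →
      Integrable (fun x => (κ.rnDeriv (μ + ν) x).toReal) (μ + ν) :=
    fun κ _ => Measure.integrable_toReal_rnDeriv
  let s : Set X := {x | (ν.rnDeriv (μ + ν) x).toReal ≤ (μ.rnDeriv (μ + ν) x).toReal}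
  have hs : MeasurableSet s := measurableSet_le
    (Measure.measurable_rnDeriv _ _).ennreal_toReal (Measure.measurable_rnDeriv _ _).ennreal_toReal
  classical
  let f : X → ℝ := s.piecewise (fun _ => 1) (fun _ => -1)
  have hf : Measurable f := Measurable.piecewise hs measurable_const measurable_const
  have hB : ∀ x, |f x| ≤ 1 := fun x => by
    by_cases hx : x ∈ s <;> simp [f, hx]
  have hif : ∀ κ : Measure X, [IsFiniteMeasure κ] →
      Integrable (fun x => (κ.rnDeriv (μ + ν) x).toReal * f x) (μ + ν) := fun κ _ =>
    (hi κ).mul_bdd (c := 1) hf.aestronglyMeasurable (ae_of_all _ hB)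
  have e1 : ∫ x, f x ∂μ = ∫ x, (μ.rnDeriv (μ + ν) x).toReal * f x ∂(μ + ν) :=
    (integral_rnDeriv_smul hμ (f := f)).symm
  have e2 : ∫ x, f x ∂ν = ∫ x, (ν.rnDeriv (μ + ν) x).toReal * f x ∂(μ + ν) :=
    (integral_rnDeriv_smul hν (f := f)).symm
  refine le_trans (le_of_eq ?_) ((le_abs_self _).trans (h f hf hB))
  rw [e1, e2, ← integral_sub (hif μ) (hif ν), tvNorm]
  congr 1 with x
  by_cases hx : x ∈ s
  · have : (ν.rnDeriv (μ + ν) x).toReal ≤ (μ.rnDeriv (μ + ν) x).toReal := hx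
    simp only [f, Set.piecewise_eq_of_mem _ _ _ hx, mul_one]
    exact abs_of_nonneg (by linarith)
  · have : ¬ (ν.rnDeriv (μ + ν) x).toReal ≤ (μ.rnDeriv (μ + ν) x).toReal := hx
    simp only [f, Set.piecewise_eq_of_notMem _ _ _ hx]
    rw [abs_of_neg (by linarith)]
    ring

/-! ### Families of probability measures with bounded first and second differences -/

/-- First and second differences of `v ↦ κ v` are bounded as functionals on bounded measurable
functions. -/
structure MeasC11 {V X : Type*} [NormedAddCommGroup V] [MeasurableSpace X] (L C : ℝ)
    (κ : V → Measure X) : Prop where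
  prob : ∀ v, IsProbabilityMeasure (κ v)
  lip : ∀ (B : ℝ) (f : X → ℝ), Measurable f → (∀ x, |f x| ≤ B) → ∀ v v',
    |∫ x, f x ∂(κ v) - ∫ x, f x ∂(κ v')| ≤ L * B * ‖v - v'‖
  second : ∀ (B : ℝ) (f : X → ℝ), Measurable f → (∀ x, |f x| ≤ B) → ∀ v h k,
    |∫ x, f x ∂(κ (v + h + k)) - ∫ x, f x ∂(κ (v + h)) - ∫ x, f x ∂(κ (v + k)) + ∫ x, f x ∂(κ v)|
      ≤ C * B * ‖h‖ * ‖k‖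

theorem integrable_of_bound {X E : Type*} [MeasurableSpace X] [NormedAddCommGroup E]
    [SecondCountableTopology E] [MeasurableSpace E] [BorelSpace E]
    (μ : Measure X) [IsFiniteMeasure μ] {f : X → E} (hf : Measurable f) {B : ℝ}
    (hB : ∀ x, ‖f x‖ ≤ B) : Integrable f μ :=
  Integrable.of_bound hf.aestronglyMeasurable B (ae_of_all _ hB)

theorem norm_integral_le_of_bound {X E : Type*} [MeasurableSpace X] [NormedAddCommGroup E]
    [NormedSpace ℝ E] (μ : Measure X) [IsProbabilityMeasure μ] {f : X → E} {B : ℝ}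
    (hB : ∀ x, ‖f x‖ ≤ B) : ‖∫ x, f x ∂μ‖ ≤ B := by
  simpa using norm_integral_le_of_norm_le_const (μ := μ) (ae_of_all _ hB)

theorem abs_integral_le_of_bound {X : Type*} [MeasurableSpace X] (μ : Measure X)
    [IsProbabilityMeasure μ] {f : X → ℝ} {B : ℝ} (hB : ∀ x, |f x| ≤ B) : |∫ x, f x ∂μ| ≤ B :=
  norm_integral_le_of_bound (E := ℝ) μ hB

theorem integral_bind {X Y E : Type*} [MeasurableSpace X] [MeasurableSpace Y]
    [NormedAddCommGroup E] [NormedSpace ℝ E] (μ : Measure X) [IsProbabilityMeasure μ]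
    (η : Kernel X Y) [IsMarkovKernel η] {f : Y → E} (hf : Integrable f (μ.bind η)) :
    ∫ y, f y ∂(μ.bind η) = ∫ x, ∫ y, f y ∂(η x) ∂μ := by
  have h := Kernel.integral_comp (κ := Kernel.const Unit μ) (η := η) (a := ()) (f := f)
  simp only [Kernel.comp_apply, Kernel.const_apply] at h
  exact h hf

/-- Testing a vector against itself lifts bounds for real test functions to vector-valued ones
without a constant depending on the dimension. -/
theorem norm_le_of_inner_self_le {E : Type*} [NormedAddCommGroup E] [InnerProductSpace ℝ E]
    {y : E} {K : ℝ} (hK : 0 ≤ K) (h : inner ℝ y y ≤ K * ‖y‖) : ‖y‖ ≤ K := by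
  rcases eq_or_ne y 0 with rfl | hy
  · simpa using hK
  · have hy' : 0 < ‖y‖ := norm_pos_iff.2 hy
    rw [real_inner_self_eq_norm_sq] at h
    nlinarith

namespace MeasC11

variable {V X : Type*} [NormedAddCommGroup V] [MeasurableSpace X] {L C : ℝ} {κ : V → Measure X}

section Vector

variable {E : Type*} [NormedAddCommGroup E] [InnerProductSpace ℝ E] [CompleteSpace E]
  [SecondCountableTopology E] [MeasurableSpace E] [BorelSpace E]

theorem norm_lip (hκ : MeasC11 L C κ) (hL : 0 ≤ L) {B : ℝ} {f : X → E} (hf : Measurable f)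
    (hB0 : 0 ≤ B) (hB : ∀ x, ‖f x‖ ≤ B) (v v' : V) :
    ‖∫ x, f x ∂(κ v) - ∫ x, f x ∂(κ v')‖ ≤ L * B * ‖v - v'‖ := by
  have := hκ.prob
  have hi := fun v => integrable_of_bound (κ v) hf hB
  set y := ∫ x, f x ∂(κ v) - ∫ x, f x ∂(κ v') with hy
  refine norm_le_of_inner_self_le (by positivity) ?_
  have h := hκ.lip (‖y‖ * B) (fun x => inner ℝ y (f x)) (by fun_prop)
    (fun x => (abs_real_inner_le_norm _ _).trans (by gcongr; exact hB x)) v v'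
  rw [integral_inner (hi v), integral_inner (hi v'), ← inner_sub_right, ← hy] at h
  exact (le_abs_self _).trans (h.trans_eq (by ring))

theorem norm_second (hκ : MeasC11 L C κ) (hC : 0 ≤ C) {B : ℝ} {f : X → E} (hf : Measurable f)
    (hB0 : 0 ≤ B) (hB : ∀ x, ‖f x‖ ≤ B) (v h k : V) :
    ‖∫ x, f x ∂(κ (v + h + k)) - ∫ x, f x ∂(κ (v + h)) - ∫ x, f x ∂(κ (v + k))
      + ∫ x, f x ∂(κ v)‖ ≤ C * B * ‖h‖ * ‖k‖ := by
  have := hκ.prob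
  have hi := fun v => integrable_of_bound (κ v) hf hB
  set y := ∫ x, f x ∂(κ (v + h + k)) - ∫ x, f x ∂(κ (v + h)) - ∫ x, f x ∂(κ (v + k))
      + ∫ x, f x ∂(κ v) with hy
  refine norm_le_of_inner_self_le (by positivity) ?_
  have h := hκ.second (‖y‖ * B) (fun x => inner ℝ y (f x)) (by fun_prop)
    (fun x => (abs_real_inner_le_norm _ _).trans (by gcongr; exact hB x)) v h k
  rw [integral_inner (hi _), integral_inner (hi _), integral_inner (hi _), integral_inner (hi _),
    ← inner_sub_right, ← inner_sub_right, ← inner_add_right, ← hy] at h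
  exact (le_abs_self _).trans (h.trans_eq (by ring))

/-- Lipschitz bound for the integral of a parameter-dependent function. -/
theorem norm_integral_sub_le (hκ : MeasC11 L C κ) (hL : 0 ≤ L) {B D : ℝ} (hB0 : 0 ≤ B)
    {f g : X → E} (hf : Measurable f) (hg : Measurable g)
    (hB : ∀ x, ‖f x‖ ≤ B) (hD : ∀ x, ‖f x - g x‖ ≤ D) (v v' : V) :
    ‖∫ x, f x ∂(κ v) - ∫ x, g x ∂(κ v')‖ ≤ D + L * B * ‖v - v'‖ := by
  have := hκ.prob
  have hig : Integrable g (κ v') :=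
    integrable_of_bound (κ v') hg (B := B + D) fun x => by
      calc ‖g x‖ = ‖f x - (f x - g x)‖ := by congr 1; abel
        _ ≤ _ := norm_sub_le _ _
        _ ≤ _ := add_le_add (hB x) (hD x)
  calc _ = ‖∫ x, (f x - g x) ∂(κ v') + (∫ x, f x ∂(κ v) - ∫ x, f x ∂(κ v'))‖ := by
        rw [integral_sub (integrable_of_bound _ hf hB) hig]; congr 1; abel
    _ ≤ _ := norm_add_le _ _
    _ ≤ _ := add_le_add (norm_integral_le_of_bound _ hD) (hκ.norm_lip hL hf hB0 hB v v')

/-- A Leibniz rule: the pairing of `κ v` with `f v` is bilinear, so its second difference splits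
into a second difference of the measure, two mixed terms (a first difference of each factor) and a
second difference of the function. The mixed terms give `2 * L * L'`. -/
theorem integral (hκ : MeasC11 L C κ) (hL : 0 ≤ L) (hC : 0 ≤ C) {B L' C' : ℝ} (hB : 0 ≤ B)
    (hL' : 0 ≤ L') {f : V → X → E} (hf : ∀ v, Measurable (f v))
    (h11 : ∀ x, IsC11 B L' C' (fun v => f v x)) :
    IsC11 B (L' + L * B) (C' + 2 * L * L' + C * B) (fun v => ∫ x, f v x ∂(κ v)) := by
  have := hκ.prob
  have hi := fun v v' => integrable_of_bound (κ v) (hf v') (fun x => (h11 x).bound v')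
  refine ⟨fun v => norm_integral_le_of_bound _ fun x => (h11 x).bound v, fun v v' => ?_,
    fun v h k => ?_⟩
  · refine (hκ.norm_integral_sub_le hL hB (hf v) (hf v') (fun x => (h11 x).bound v)
      (fun x => (h11 x).lip v v') v v').trans_eq (by ring)
  · have i2 : ∀ u a b c d, ∫ x, (f a x - f b x - f c x + f d x) ∂(κ u)
        = ∫ x, f a x ∂(κ u) - ∫ x, f b x ∂(κ u) - ∫ x, f c x ∂(κ u) + ∫ x, f d x ∂(κ u) := by
      intro u a b c d
      have j1 : Integrable (fun x => f a x - f b x) (κ u) := (hi u a).sub (hi u b)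
      have j2 : Integrable (fun x => f a x - f b x - f c x) (κ u) := j1.sub (hi u c)
      rw [integral_add j2 (hi u d), integral_sub j1 (hi u c), integral_sub (hi u a) (hi u b)]
    have i1 : ∀ u a b, ∫ x, (f a x - f b x) ∂(κ u)
        = ∫ x, f a x ∂(κ u) - ∫ x, f b x ∂(κ u) := fun u a b => integral_sub (hi u a) (hi u b)
    have t1 := hκ.norm_second hC (hf (v + h + k)) hB (fun x => (h11 x).bound _) v h k
    have t2 := hκ.norm_lip hL ((hf (v + h + k)).sub (hf (v + h)))
      (B := L' * ‖k‖) (by positivity)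
      (fun x => by simpa using (h11 x).lip (v + h + k) (v + h)) (v + h) v
    have t3 := hκ.norm_lip hL ((hf (v + h + k)).sub (hf (v + k)))
      (B := L' * ‖h‖) (by positivity)
      (fun x => by
        have := (h11 x).lip (v + h + k) (v + k)
        rwa [show v + h + k - (v + k) = h by abel] at this) (v + k) v
    have t4 := norm_integral_le_of_bound (κ v) (f := fun x => f (v + h + k) x - f (v + h) x
      - f (v + k) x + f v x) (fun x => (h11 x).second v h k)
    simp only [Pi.sub_apply] at t2 t3
    rw [i1, i1] at t2 t3
    rw [i2] at t4
    rw [add_sub_cancel_left] at t2 t3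
    set I := fun a b => ∫ x, f b x ∂(κ a)
    calc _ = ‖(I (v + h + k) (v + h + k) - I (v + h) (v + h + k) - I (v + k) (v + h + k)
              + I v (v + h + k))
            + (I (v + h) (v + h + k) - I (v + h) (v + h) - (I v (v + h + k) - I v (v + h)))
            + (I (v + k) (v + h + k) - I (v + k) (v + k) - (I v (v + h + k) - I v (v + k)))
            + (I v (v + h + k) - I v (v + h) - I v (v + k) + I v v)‖ := by congr 1; abel
      _ ≤ _ := norm_add₄_le
      _ ≤ C * B * ‖h‖ * ‖k‖ + L * (L' * ‖k‖) * ‖h‖ + L * (L' * ‖h‖) * ‖k‖ + C' * ‖h‖ * ‖k‖ :=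
        add_le_add (add_le_add (add_le_add t1 t2) t3) t4
      _ = _ := by ring

end Vector

/-- Only `0 ≤ B` has to be treated: a space carrying a probability measure has a point, so any bound
of `|f|` is nonnegative. -/
theorem of_integral (hp : ∀ v, IsProbabilityMeasure (κ v))
    (h : ∀ (B : ℝ) (f : X → ℝ), Measurable f → 0 ≤ B → (∀ x, |f x| ≤ B) →
      IsC11 B (L * B) (C * B) (fun v => ∫ x, f x ∂(κ v))) : MeasC11 L C κ := by
  have hB0 : ∀ (v : V) (B : ℝ) (f : X → ℝ), (∀ x, |f x| ≤ B) → 0 ≤ B := fun v B f hB => by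
    have := hp v
    obtain ⟨x⟩ := (κ v).nonempty_of_neZero
    exact (abs_nonneg _).trans (hB x)
  exact ⟨hp, fun B f hf hB v v' => (h B f hf (hB0 v B f hB) hB).lip v v',
    fun B f hf hB v p k => (h B f hf (hB0 v B f hB) hB).second v p k⟩

theorem integral_const (hκ : MeasC11 L C κ) {B : ℝ} {f : X → ℝ} (hf : Measurable f)
    (hB : ∀ x, |f x| ≤ B) : IsC11 B (L * B) (C * B) (fun v => ∫ x, f x ∂(κ v)) := by
  have := hκ.prob
  exact ⟨fun v => norm_integral_le_of_bound _ hB, hκ.lip B f hf hB, hκ.second B f hf hB⟩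

/-- Integrating out the second kernel first leaves a parameter-dependent function of the first
variable, to which the Leibniz rule `MeasC11.integral` applies. -/
theorem bind {Y : Type*} [MeasurableSpace Y] {L' C' : ℝ} {η : V → Kernel X Y}
    (hκ : MeasC11 L C κ) (hL : 0 ≤ L) (hC : 0 ≤ C) (hL' : 0 ≤ L')
    (hη : ∀ x, MeasC11 L' C' (fun v => η v x)) :
    MeasC11 (L + L') (C + 2 * L * L' + C') (fun v => (κ v).bind (η v)) := by
  have := hκ.prob
  have hm : ∀ v, IsMarkovKernel (η v) := fun v => ⟨fun x => (hη x).prob v⟩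
  refine of_integral (fun v => inferInstance) fun B f hf hB0 hB => ?_
  have e : ∀ v, ∫ y, f y ∂((κ v).bind (η v)) = ∫ x, ∫ y, f y ∂(η v x) ∂(κ v) := fun v =>
    integral_bind _ _ (integrable_of_bound _ hf hB)
  simp only [e]
  have := hκ.integral hL hC hB0 (mul_nonneg hL' hB0) (f := fun v x => ∫ y, f y ∂(η v x))
    (fun v => (hf.stronglyMeasurable.integral_kernel).measurable)
    (fun x => (hη x).integral_const hf hB)
  exact this.mono le_rfl (by linarith) (by linarith)

end MeasC11

namespace Model

variable {S A : Type*} [MeasurableSpace S] [MeasurableSpace A] {dv dw : ℕ}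

/-! ### The kernels of the model -/

theorem polKernel_apply (M : Model S A dv dw) (v : Vec dv) (s : S) :
    M.polKernel v s = M.refA.withDensity (fun a => ENNReal.ofReal (M.pol v s a)) := by
  rw [polKernel, Kernel.withDensity_apply _ (by
    exact (M.measurable_pol v).ennreal_ofReal), Kernel.const_apply]

instance (M : Model S A dv dw) (v : Vec dv) : IsMarkovKernel (M.polKernel v) :=
  ⟨fun s => ⟨by rw [polKernel_apply, withDensity_apply _ MeasurableSet.univ,
    setLIntegral_univ, M.pol_lintegral]⟩⟩

theorem measurable_pol_right (M : Model S A dv dw) (v : Vec dv) (s : S) :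
    Measurable (M.pol v s) := (M.measurable_pol v).comp measurable_prodMk_left

theorem integral_polKernel {E : Type*} [NormedAddCommGroup E] [NormedSpace ℝ E]
    (M : Model S A dv dw) (v : Vec dv) (s : S) (f : A → E) :
    ∫ a, f a ∂(M.polKernel v s) = ∫ a, M.pol v s a • f a ∂M.refA := by
  rw [polKernel_apply, integral_withDensity_eq_integral_toReal_smul
    (M.measurable_pol_right v s).ennreal_ofReal (ae_of_all _ fun _ => ENNReal.ofReal_lt_top)]
  simp only [ENNReal.toReal_ofReal (M.pol_pos v s _).le]

theorem integrable_pol (M : Model S A dv dw) (v : Vec dv) (s : S) :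
    Integrable (M.pol v s) M.refA := by
  refine ⟨(M.measurable_pol_right v s).aestronglyMeasurable, ?_⟩
  rw [hasFiniteIntegral_iff_ofReal (ae_of_all _ fun a => (M.pol_pos v s a).le), M.pol_lintegral]
  exact ENNReal.one_lt_top

theorem integral_pol (M : Model S A dv dw) (v : Vec dv) (s : S) :
    ∫ a, M.pol v s a ∂M.refA = 1 := by
  simpa using (M.integral_polKernel v s (fun _ => (1 : ℝ))).symm

instance (M : Model S A dv dw) (v : Vec dv) : IsMarkovKernel (M.obsKernel v) := by
  unfold obsKernel; infer_instance

instance (M : Model S A dv dw) (v : Vec dv) : IsMarkovKernel (M.stateKernel v) := by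
  unfold stateKernel; infer_instance

instance (M : Model S A dv dw) (v : Vec dv) (t : ℕ) : IsMarkovKernel (M.stateKernel v ^ t) := by
  induction t with
  | zero => rw [pow_zero]; change IsMarkovKernel Kernel.id; infer_instance
  | succ n ih => rw [pow_succ]; change IsMarkovKernel (_ ∘ₖ _); infer_instance

theorem measurable_cons (n : ℕ) : Measurable
    (fun p : Obs S A × Traj S A n => (Fin.cons p.1 p.2 : Traj S A (n + 1))) := by
  refine measurable_pi_lambda _ fun i => ?_
  refine Fin.cases ?_ (fun j => ?_) i
  · exact measurable_fst
  · exact (measurable_pi_apply j).comp measurable_snd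

instance (M : Model S A dv dw) (v : Vec dv) (n : ℕ) : IsMarkovKernel (M.rollout v n) := by
  induction n with
  | zero => rw [rollout]; infer_instance
  | succ n ih =>
    rw [rollout]
    exact Kernel.IsMarkovKernel.map _ (measurable_cons n)

theorem obsKernel_apply (M : Model S A dv dw) (v : Vec dv) (s : S) :
    M.obsKernel v s = (((M.polKernel v) ⊗ₖ M.trans) s).map (Prod.mk s) := by
  rw [obsKernel, Kernel.prod_apply, Kernel.id_apply, Measure.dirac_prod]

theorem obsKernel_map_last (M : Model S A dv dw) (v : Vec dv) (s : S) :
    (M.obsKernel v s).map (fun o => o.2.2) = M.stateKernel v s := by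
  rw [obsKernel_apply, Measure.map_map (by fun_prop) (by fun_prop), stateKernel,
    Kernel.snd_apply]
  rfl

section Integral

variable {E : Type*} [NormedAddCommGroup E] [NormedSpace ℝ E]
  [SecondCountableTopology E] [MeasurableSpace E] [BorelSpace E]

theorem integral_obsKernel (M : Model S A dv dw) (v : Vec dv) (s : S) {f : Obs S A → E}
    (hf : Measurable f) {B : ℝ} (hB : ∀ o, ‖f o‖ ≤ B) :
    ∫ o, f o ∂(M.obsKernel v s)
      = ∫ a, M.pol v s a • ∫ s', f (s, a, s') ∂(M.trans (s, a)) ∂M.refA := by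
  rw [obsKernel_apply, integral_map (by fun_prop) hf.aestronglyMeasurable,
    integral_compProd (integrable_of_bound _ (by fun_prop) (fun p => hB (s, p))),
    integral_polKernel]

theorem integral_stateKernel (M : Model S A dv dw) (v : Vec dv) (s : S) {f : S → E}
    (hf : Measurable f) :
    ∫ x, f x ∂(M.stateKernel v s) = ∫ o, f o.2.2 ∂(M.obsKernel v s) := by
  rw [← obsKernel_map_last, integral_map (by fun_prop) hf.aestronglyMeasurable]

theorem integral_rollout_succ (M : Model S A dv dw) (v : Vec dv) (n : ℕ) (s : S)
    {f : Traj S A (n + 1) → E} (hf : Measurable f) {B : ℝ} (hB : ∀ o, ‖f o‖ ≤ B) :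
    ∫ O, f O ∂(M.rollout v (n + 1) s)
      = ∫ o, ∫ O, f (Fin.cons o O : Traj S A (n + 1)) ∂(M.rollout v n o.2.2)
          ∂(M.obsKernel v s) := by
  rw [rollout, Kernel.map_apply _ (measurable_cons n), integral_map
    (measurable_cons n).aemeasurable hf.aestronglyMeasurable,
    integral_compProd (f := fun p : Obs S A × Traj S A n => f (Fin.cons p.1 p.2))
      (integrable_of_bound _ (hf.comp (measurable_cons n)) (fun p => hB _))]
  rfl

theorem integral_pow_succ (M : Model S A dv dw) (v : Vec dv) (n : ℕ) (s : S) {f : S → E}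
    (hf : Measurable f) {B : ℝ} (hB : ∀ o, ‖f o‖ ≤ B) :
    ∫ x, f x ∂((M.stateKernel v ^ (n + 1)) s)
      = ∫ y, ∫ x, f x ∂((M.stateKernel v ^ n) y) ∂(M.stateKernel v s) := by
  have : (M.stateKernel v ^ (n + 1)) s = (M.stateKernel v s).bind (M.stateKernel v ^ n) := by
    rw [pow_succ, ← Kernel.comp_apply]; rfl
  rw [this, integral_bind _ _ (integrable_of_bound _ hf hB)]

theorem integral_pow_succ_last (M : Model S A dv dw) (v : Vec dv) (n : ℕ) (s : S) {f : S → E}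
    (hf : Measurable f) {B : ℝ} (hB : ∀ o, ‖f o‖ ≤ B) :
    ∫ x, f x ∂((M.stateKernel v ^ (n + 1)) s)
      = ∫ y, ∫ x, f x ∂(M.stateKernel v y) ∂((M.stateKernel v ^ n) s) := by
  have : (M.stateKernel v ^ (n + 1)) s = ((M.stateKernel v ^ n) s).bind (M.stateKernel v) := by
    rw [pow_succ', ← Kernel.comp_apply]; rfl
  rw [this, integral_bind _ _ (integrable_of_bound _ hf hB)]

end Integral

/-! ### Regularity of the policy and of the kernels in the parameter -/

variable {M : Model S A dv dw} {Rπ Lπ' Lπ volA : ℝ}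

namespace PolicyRegular

/-- The score-function identity `∇π = π ∇ log π`, from differentiating `exp (log π)`. -/
theorem hasGradientAt_pol (h : M.PolicyRegular Rπ Lπ' Lπ) (v : Vec dv) (s : S) (a : A) :
    HasFDerivAt (fun u => M.pol u s a)
      (M.pol v s a • (InnerProductSpace.toDual ℝ (Vec dv) (M.score v s a))) v := by
  have h1 : HasFDerivAt (fun u => Real.log (M.pol u s a))
      (InnerProductSpace.toDual ℝ (Vec dv) (M.score v s a)) v :=
    (h.differentiable s a v).hasGradientAt
  have h2 := h1.exp
  simpa only [Real.exp_log (M.pol_pos _ s a)] using h2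

/-- The density has no uniform upper bound, so `π_v(a|s)` is kept on the right; it later integrates
to one. For `‖k‖ ≤ 1` the function `u ↦ π_{u+p} - π_u` is differentiated along the segment from `v`
to `v + k`, where the density exceeds `π_v` by at most `Lπ`. For `‖k‖ ≥ 1` two first differences
suffice, since `‖p‖ ≤ ‖p‖ ‖k‖`. -/
theorem abs_second_pol_le (h : M.PolicyRegular Rπ Lπ' Lπ) (hRπ : 0 ≤ Rπ) (hLπ : 0 ≤ Lπ)
    (hLπ' : 0 ≤ Lπ') (v p k : Vec dv) (s : S) (a : A) :
    |M.pol (v + p + k) s a - M.pol (v + p) s a - M.pol (v + k) s a + M.pol v s a|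
      ≤ (Lπ * Rπ + Lπ' * (M.pol v s a + Lπ) + 2 * Lπ) * ‖p‖ * ‖k‖ := by
  have hp0 := (M.pol_pos v s a).le
  rcases le_total ‖k‖ 1 with hk | hk
  · have hderiv : ∀ z : Vec dv, HasFDerivAt (fun u => M.pol (u + p) s a - M.pol u s a)
        (M.pol (z + p) s a • (InnerProductSpace.toDual ℝ (Vec dv) (M.score (z + p) s a))
          - M.pol z s a • (InnerProductSpace.toDual ℝ (Vec dv) (M.score z s a))) z := fun z => by
      refine HasFDerivAt.sub ?_ (h.hasGradientAt_pol z s a)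
      exact (hasFDerivAt_comp_add_right (f := fun u => M.pol u s a) p).2
        (h.hasGradientAt_pol (z + p) s a)
    have key := (convex_segment (𝕜 := ℝ) v (v + k)).norm_image_sub_le_of_norm_hasFDerivWithin_le
      (C := (Lπ * Rπ + Lπ' * (M.pol v s a + Lπ)) * ‖p‖)
      (fun z _ => (hderiv z).hasFDerivWithinAt) (fun z hz => ?_)
      (left_mem_segment ℝ v (v + k)) (right_mem_segment ℝ v (v + k))
    · simp only [add_sub_cancel_left, Real.norm_eq_abs] at key
      calc _ = |M.pol (v + k + p) s a - M.pol (v + k) s a - (M.pol (v + p) s a - M.pol v s a)| := by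
            rw [add_right_comm v p k]; congr 1; ring
        _ ≤ _ := key
        _ ≤ _ := by gcongr ?_ * _ * _; linarith
    · have hz' : ‖z - v‖ ≤ 1 := by
        refine (norm_sub_le_of_mem_segment hz).trans ?_
        simpa using hk
      have hpz : M.pol z s a ≤ M.pol v s a + Lπ := by
        have := (le_abs_self _).trans (h.pol_lip z v s a)
        nlinarith
      rw [← map_smul, ← map_smul, ← map_sub, LinearIsometryEquiv.norm_map]
      calc ‖M.pol (z + p) s a • M.score (z + p) s a - M.pol z s a • M.score z s a‖
          = ‖(M.pol (z + p) s a - M.pol z s a) • M.score (z + p) s a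
              + M.pol z s a • (M.score (z + p) s a - M.score z s a)‖ := by
            congr 1; rw [sub_smul, smul_sub]; abel
        _ ≤ |M.pol (z + p) s a - M.pol z s a| * ‖M.score (z + p) s a‖
              + M.pol z s a * ‖M.score (z + p) s a - M.score z s a‖ := by
            refine (norm_add_le _ _).trans_eq ?_
            rw [norm_smul, norm_smul, Real.norm_eq_abs, Real.norm_of_nonneg (M.pol_pos z s a).le]
        _ ≤ (Lπ * ‖p‖) * Rπ + (M.pol v s a + Lπ) * (Lπ' * ‖p‖) := by
            have h1 := h.pol_lip (z + p) z s a
            have h2 := h.score_lip (z + p) z s a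
            rw [add_sub_cancel_left] at h1 h2
            gcongr
            exact h.score_bound _ s a
        _ = _ := by ring
  · have h1 := h.pol_lip (v + p + k) (v + k) s a
    have h2 := h.pol_lip (v + p) v s a
    rw [show v + p + k - (v + k) = p by abel] at h1
    rw [add_sub_cancel_left] at h2
    calc _ = |(M.pol (v + p + k) s a - M.pol (v + k) s a) - (M.pol (v + p) s a - M.pol v s a)| := by
          congr 1; ring
      _ ≤ _ := abs_sub _ _
      _ ≤ Lπ * ‖p‖ + Lπ * ‖p‖ := add_le_add h1 h2
      _ = 2 * Lπ * ‖p‖ * 1 := by ring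
      _ ≤ _ := by
        gcongr
        nlinarith [mul_nonneg hLπ hRπ, mul_nonneg hLπ' (add_nonneg hp0 hLπ)]

/-- Bound for the second difference of `v ↦ π_v(·|s)` in `L¹(da)`. -/
noncomputable def _root_.HBA2C.polSecond (Rπ Lπ' Lπ volA : ℝ) : ℝ :=
  volA * Lπ * Rπ + Lπ' * (1 + volA * Lπ) + 2 * (volA * Lπ)

theorem _root_.HBA2C.polSecond_nonneg (hRπ : 0 ≤ Rπ) (hLπ : 0 ≤ Lπ)
    (hLπ' : 0 ≤ Lπ') (hvol : 0 ≤ volA) : 0 ≤ polSecond Rπ Lπ' Lπ volA := by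
  unfold polSecond; positivity

/-- Only the action density depends on `v`: once the next state is integrated out, the differences
of the kernel are integrals of differences of `π_v` against a fixed bounded function `F`. -/
theorem measC11_obsKernel (h : M.PolicyRegular Rπ Lπ' Lπ) (hRπ : 0 ≤ Rπ) (hLπ : 0 ≤ Lπ)
    (hLπ' : 0 ≤ Lπ') (hvol : M.refA.real Set.univ = volA) (s : S) :
    MeasC11 (volA * Lπ) (polSecond Rπ Lπ' Lπ volA) (fun v => M.obsKernel v s) := by
  refine MeasC11.of_integral (fun v => inferInstance) fun B f hf hB0 hB => ?_
  simp only [fun v => M.integral_obsKernel v s hf hB, smul_eq_mul]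
  set F : A → ℝ := fun a => ∫ s', f (s, a, s') ∂(M.trans (s, a)) with hF
  have hFm : Measurable F := by
    have h1 : Measurable (fun p : S × A => ∫ s', f (p.1, p.2, s') ∂(M.trans p)) := by
      have : StronglyMeasurable (Function.uncurry fun (p : S × A) (s' : S) => f (p.1, p.2, s')) :=
        Measurable.stronglyMeasurable (by unfold Function.uncurry; fun_prop)
      exact (this.integral_kernel_prod_right).measurable
    exact h1.comp measurable_prodMk_left
  have hFB : ∀ a, |F a| ≤ B := fun a =>
    abs_integral_le_of_bound (M.trans (s, a)) fun s' => hB (s, a, s')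
  have hi : ∀ v, Integrable (fun a => M.pol v s a * F a) M.refA := fun v =>
    (M.integrable_pol v s).mul_bdd (c := B) hFm.aestronglyMeasurable (ae_of_all _ hFB)
  refine ⟨fun v => ?_, fun v v' => ?_, fun v p k => ?_⟩
  · have e := M.integral_polKernel v s F
    simp only [smul_eq_mul] at e
    rw [← e]
    exact norm_integral_le_of_bound _ hFB
  · rw [← integral_sub (hi v) (hi v')]
    refine (norm_integral_le_of_norm_le_const (C := Lπ * ‖v - v'‖ * B) (ae_of_all _ fun a => ?_)).trans_eq ?_
    · rw [← sub_mul, norm_mul]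
      exact mul_le_mul (h.pol_lip v v' s a) (hFB a) (abs_nonneg _) (by positivity)
    · rw [hvol]; ring
  · have j1 : Integrable (fun a => M.pol (v + p + k) s a * F a - M.pol (v + p) s a * F a) M.refA :=
      (hi _).sub (hi _)
    have j2 : Integrable (fun a => M.pol (v + p + k) s a * F a - M.pol (v + p) s a * F a
        - M.pol (v + k) s a * F a) M.refA := j1.sub (hi _)
    rw [← integral_sub (hi _) (hi _), ← integral_sub j1 (hi _), ← integral_add j2 (hi _)]
    have hb : Integrable (fun a => (Lπ * Rπ + Lπ' * (M.pol v s a + Lπ) + 2 * Lπ)) M.refA :=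
      ((integrable_const _).add (((M.integrable_pol v s).add (integrable_const _)).const_mul _)).add
        (integrable_const _)
    have hb' : ∫ a, (Lπ * Rπ + Lπ' * (M.pol v s a + Lπ) + 2 * Lπ) ∂M.refA
        = polSecond Rπ Lπ' Lπ volA := by
      have hc : Integrable (fun a => Lπ' * M.pol v s a) M.refA := (M.integrable_pol v s).const_mul _
      calc _ = ∫ a, (Lπ' * M.pol v s a + (Lπ * Rπ + Lπ' * Lπ + 2 * Lπ)) ∂M.refA := by
            congr 1 with a; ring
        _ = _ := by
            rw [integral_add hc (integrable_const _), integral_const_mul, integral_pol,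
              MeasureTheory.integral_const, hvol, smul_eq_mul, polSecond]
            ring
    refine (norm_integral_le_of_norm_le (hb.mul_const (‖p‖ * ‖k‖ * B))
      (ae_of_all _ fun a => ?_)).trans_eq ?_
    · have := h.abs_second_pol_le hRπ hLπ hLπ' v p k s a
      calc _ = |M.pol (v + p + k) s a - M.pol (v + p) s a - M.pol (v + k) s a + M.pol v s a|
            * |F a| := by rw [← abs_mul, Real.norm_eq_abs]; congr 1; ring
        _ ≤ ((Lπ * Rπ + Lπ' * (M.pol v s a + Lπ) + 2 * Lπ) * ‖p‖ * ‖k‖) * B :=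
            mul_le_mul this (hFB a) (abs_nonneg _) ((abs_nonneg _).trans this)
        _ = _ := by ring
    · rw [integral_mul_const, hb']; ring

end PolicyRegular

end Model

/-! ### Constants and regularity of the multi-step kernels -/

/-- The numerical parameters on which the constants depend. -/
structure Params where
  (γ lam Rr Rw Rπ Lπ Lπ' c₀ ρ volA : ℝ)

namespace Params

/-- Lipschitz constant of `v ↦ π_v(·|s)` in `L¹(da)`. -/
noncomputable def ell (p : Params) : ℝ := p.volA * p.Lπ

/-- Bound for the second difference of the one-step kernel. -/
noncomputable def stepSecond (p : Params) : ℝ := polSecond p.Rπ p.Lπ' p.Lπ p.volA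

/-- Bound for the second difference of the `n`-step kernels. -/
noncomputable def chainSecond (p : Params) (n : ℕ) : ℝ := n * p.stepSecond + n ^ 2 * p.ell ^ 2

/-- The mixing constant `c₀ / (1 - ρ)`. -/
noncomputable def mix (p : Params) : ℝ := p.c₀ / (1 - p.ρ)

/-- Lipschitz constant of the stationary distribution. -/
noncomputable def statLip (p : Params) : ℝ := p.mix * p.ell

/-- Bound for the second difference of the stationary distribution. -/
noncomputable def statSecond (p : Params) : ℝ :=
  p.mix * (p.stepSecond + 2 * p.mix * p.ell ^ 2)

/-- Sign conditions on the parameters. -/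
structure Admissible (p : Params) : Prop where
  γ_pos : 0 < p.γ
  γ_lt : p.γ < 1
  lam_pos : 0 < p.lam
  Rr_nonneg : 0 ≤ p.Rr
  Rw_pos : 0 < p.Rw
  Rπ_nonneg : 0 ≤ p.Rπ
  Lπ_nonneg : 0 ≤ p.Lπ
  Lπ'_nonneg : 0 ≤ p.Lπ'
  c₀_pos : 0 < p.c₀
  ρ_pos : 0 < p.ρ
  ρ_lt : p.ρ < 1
  volA_nonneg : 0 ≤ p.volA

namespace Admissible

variable {p : Params}

theorem ell_nonneg (h : p.Admissible) : 0 ≤ p.ell := mul_nonneg h.volA_nonneg h.Lπ_nonneg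

theorem stepSecond_nonneg (h : p.Admissible) : 0 ≤ p.stepSecond :=
  polSecond_nonneg h.Rπ_nonneg h.Lπ_nonneg h.Lπ'_nonneg h.volA_nonneg

theorem chainSecond_nonneg (h : p.Admissible) (n : ℕ) : 0 ≤ p.chainSecond n := by
  have := h.stepSecond_nonneg
  unfold chainSecond; positivity

theorem mix_pos (h : p.Admissible) : 0 < p.mix := div_pos h.c₀_pos (by linarith [h.ρ_lt])

theorem statLip_nonneg (h : p.Admissible) : 0 ≤ p.statLip := mul_nonneg h.mix_pos.le h.ell_nonneg

theorem statSecond_nonneg (h : p.Admissible) : 0 ≤ p.statSecond := by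
  have h1 := h.mix_pos.le
  have h2 := h.stepSecond_nonneg
  unfold statSecond; positivity

end Admissible

end Params

namespace Model

variable {S A : Type*} [MeasurableSpace S] [MeasurableSpace A] {dv dw : ℕ}

/-- The standing assumptions on the model. -/
structure Standing (M : Model S A dv dw) (μ : Vec dv → Measure S) (p : Params) : Prop where
  adm : p.Admissible
  vol : M.refA.real Set.univ = p.volA
  reward_le : ∀ s a, |M.reward s a| ≤ p.Rr
  policy : M.PolicyRegular p.Rπ p.Lπ' p.Lπ
  ergodic : M.GeomErgodic μ p.c₀ p.ρ
  cov : M.FeatureCov μ p.lam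

namespace Standing

variable {M : Model S A dv dw} {μ : Vec dv → Measure S} {p : Params}

theorem obs (h : M.Standing μ p) (s : S) :
    MeasC11 p.ell p.stepSecond (fun v => M.obsKernel v s) :=
  h.policy.measC11_obsKernel h.adm.Rπ_nonneg h.adm.Lπ_nonneg h.adm.Lπ'_nonneg h.vol s

theorem state (h : M.Standing μ p) (s : S) :
    MeasC11 p.ell p.stepSecond (fun v => M.stateKernel v s) := by
  refine MeasC11.of_integral (fun v => inferInstance) fun B f hf hB0 hB => ?_
  simp only [fun v => M.integral_stateKernel v s hf]
  exact (h.obs s).integral_const (f := fun o : Obs S A => f o.2.2) (by fun_prop) (fun o => hB _)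

/-- Composing one step with `n` further steps adds `2 n ell²` of mixed terms to the second
difference; summing these produces the quadratic growth in `chainSecond`. -/
theorem pow (h : M.Standing μ p) (n : ℕ) (s : S) :
    MeasC11 (n * p.ell) (p.chainSecond n) (fun v => (M.stateKernel v ^ n) s) := by
  have hl := h.adm.ell_nonneg
  induction n generalizing s with
  | zero =>
    refine MeasC11.of_integral (fun v => inferInstance) fun B f hf hB0 hB => ?_
    have e : ∀ v, ∫ x, f x ∂((M.stateKernel v ^ 0) s) = f s := fun v => by
      rw [pow_zero]
      change ∫ x, f x ∂(Kernel.id s) = _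
      rw [Kernel.id_apply, integral_dirac' _ _ hf.stronglyMeasurable]
    simp only [e]
    simpa [Params.chainSecond] using IsC11.const (V := Vec dv) (f s) (hB s)
  | succ n ih =>
    have hb := (h.state s).bind h.adm.ell_nonneg h.adm.stepSecond_nonneg (by positivity) ih
    have e : ∀ v, (M.stateKernel v s).bind (M.stateKernel v ^ n) = (M.stateKernel v ^ (n + 1)) s :=
      fun v => by rw [pow_succ, ← Kernel.comp_apply]; rfl
    simp only [e] at hb
    refine MeasC11.of_integral (fun v => inferInstance) fun B f hf hB0 hB => ?_
    refine (hb.integral_const hf hB).mono le_rfl ?_ ?_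
    · push_cast; nlinarith
    · refine mul_le_mul_of_nonneg_right ?_ hB0
      unfold Params.chainSecond
      push_cast
      nlinarith [sq_nonneg p.ell]

theorem obs_pow (h : M.Standing μ p) (n : ℕ) (s : S) :
    MeasC11 ((n + 1) * p.ell) (p.chainSecond (n + 1))
      (fun v => (M.obsKernel v ∘ₖ (M.stateKernel v ^ n)) s) := by
  have hl := h.adm.ell_nonneg
  have hb := (h.pow n s).bind (by positivity) (h.adm.chainSecond_nonneg n) hl
    (fun x => h.obs x)
  simp only [← Kernel.comp_apply] at hb
  refine MeasC11.of_integral (fun v => inferInstance) fun B f hf hB0 hB => ?_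
  refine (hb.integral_const hf hB).mono le_rfl ?_ ?_
  · nlinarith
  · refine mul_le_mul_of_nonneg_right ?_ hB0
    unfold Params.chainSecond
    push_cast
    nlinarith [sq_nonneg p.ell]

theorem rollout (h : M.Standing μ p) (n : ℕ) (s : S) :
    MeasC11 (n * p.ell) (p.chainSecond n) (fun v => M.rollout v n s) := by
  have hl := h.adm.ell_nonneg
  induction n generalizing s with
  | zero =>
    refine MeasC11.of_integral (fun v => inferInstance) fun B f hf hB0 hB => ?_
    simp only [Model.rollout, Kernel.const_apply, integral_dirac' _ _ hf.stronglyMeasurable]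
    simpa [Params.chainSecond] using IsC11.const (V := Vec dv) (f Fin.elim0) (hB _)
  | succ n ih =>
    refine MeasC11.of_integral (fun v => inferInstance) fun B f hf hB0 hB => ?_
    simp only [fun v => M.integral_rollout_succ v n s hf hB]
    have hm : Measurable (Function.uncurry fun (o : Obs S A) (O : Traj S A n) =>
      f (Fin.cons o O : Traj S A (n + 1))) := hf.comp (measurable_cons n)
    refine ((h.obs s).integral hl h.adm.stepSecond_nonneg hB0
      (L' := n * p.ell * B) (C' := p.chainSecond n * B) (by positivity)
      (f := fun v o => ∫ O, f (Fin.cons o O : Traj S A (n + 1)) ∂(M.rollout v n o.2.2))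
      (fun v => ?_) (fun o => ?_)).mono le_rfl ?_ ?_
    · have := hm.stronglyMeasurable.integral_kernel_prod_right
        (κ := (M.rollout v n).comap (fun o : Obs S A => o.2.2) (by fun_prop))
      exact this.measurable
    · exact (ih o.2.2).integral_const (hm.comp measurable_prodMk_left) (fun O => hB _)
    · push_cast; nlinarith
    · unfold Params.chainSecond
      push_cast
      nlinarith [mul_nonneg (sq_nonneg p.ell) hB0]

end Standing

/-! ### Marginals of a rollout -/

/-- Reduces discounted sums along a rollout to powers of the state kernel. The induction peels off
the first observation and shifts the index of the remaining ones. -/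
theorem rollout_map_apply (M : Model S A dv dw) (v : Vec dv) (n : ℕ) (t : Fin n) (s : S) :
    (M.rollout v n s).map (fun O => O t) = (M.obsKernel v ∘ₖ (M.stateKernel v ^ (t : ℕ))) s := by
  have key : ∀ (n : ℕ) (t : Fin n) (s : S) (B : Set (Obs S A)), MeasurableSet B →
      ∫ O, B.indicator (fun _ => (1 : ℝ)) (O t) ∂(M.rollout v n s)
        = ∫ o, B.indicator (fun _ => (1 : ℝ)) o ∂((M.obsKernel v ∘ₖ (M.stateKernel v ^ (t : ℕ))) s) := by
    intro n
    induction n with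
    | zero => intro t; exact t.elim0
    | succ n ih =>
      intro t s B hB
      set f : Obs S A → ℝ := B.indicator (fun _ => (1 : ℝ)) with hf
      have hfm : Measurable f := measurable_const.indicator hB
      have hfb : ∀ o, ‖f o‖ ≤ 1 := fun o => by
        by_cases ho : o ∈ B <;> simp [hf, ho]
      rw [M.integral_rollout_succ v n s (f := fun O => f (O t))
        (hfm.comp (measurable_pi_apply t)) (fun O => hfb _)]
      refine Fin.cases ?_ (fun j => ?_) t
      · simp only [Fin.cons_zero, MeasureTheory.integral_const, probReal_univ, one_smul,
          Fin.val_zero, pow_zero]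
        change _ = ∫ o, f o ∂((M.obsKernel v ∘ₖ Kernel.id) s)
        rw [Kernel.comp_id]
      · have ihj : ∀ x, ∫ O, f (O j) ∂(M.rollout v n x)
            = ∫ o, f o ∂((M.obsKernel v ∘ₖ (M.stateKernel v ^ (j : ℕ))) x) := fun x => ih j x B hB
        simp only [Fin.cons_succ, ihj]
        have e1 : (M.obsKernel v ∘ₖ (M.stateKernel v ^ ((j.succ : Fin (n + 1)) : ℕ))) s
            = (M.stateKernel v s).bind (M.obsKernel v ∘ₖ (M.stateKernel v ^ (j : ℕ))) := by
          rw [← Kernel.comp_apply, Kernel.comp_assoc, Fin.val_succ, pow_succ]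
          rfl
        rw [e1, integral_bind _ _ (integrable_of_bound _ hfm hfb), M.integral_stateKernel]
        exact (hfm.stronglyMeasurable.integral_kernel).measurable
  have : IsProbabilityMeasure ((M.rollout v n s).map (fun O => O t)) :=
    Measure.isProbabilityMeasure_map (measurable_pi_apply t).aemeasurable
  refine Measure.ext fun B hB => ?_
  have h := key n t s B hB
  rw [← integral_map (measurable_pi_apply t).aemeasurable
    (measurable_const.indicator hB).aestronglyMeasurable,
    integral_indicator_const _ hB, integral_indicator_const _ hB] at h
  simpa [measureReal_def, ENNReal.toReal_eq_toReal_iff'] using h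

section Integral

variable {E : Type*} [NormedAddCommGroup E] [NormedSpace ℝ E]
  [SecondCountableTopology E] [MeasurableSpace E] [BorelSpace E]

theorem integral_rollout_apply (M : Model S A dv dw) (v : Vec dv) (n : ℕ) (t : Fin n) (s : S)
    {f : Obs S A → E} (hf : Measurable f) :
    ∫ O, f (O t) ∂(M.rollout v n s)
      = ∫ o, f o ∂((M.obsKernel v ∘ₖ (M.stateKernel v ^ (t : ℕ))) s) := by
  rw [← rollout_map_apply, integral_map (measurable_pi_apply t).aemeasurable
    hf.aestronglyMeasurable]

theorem measurable_firstState {T : ℕ} [NeZero T] :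
    Measurable (firstState : Traj S A T → S) := by unfold firstState; fun_prop

theorem measurable_lastState {T : ℕ} [NeZero T] :
    Measurable (lastState : Traj S A T → S) := by unfold lastState; fun_prop

theorem integral_rollout_lastState (M : Model S A dv dw) (v : Vec dv) (T : ℕ) [NeZero T] (s : S)
    {f : S → E} (hf : Measurable f) {B : ℝ} (hB : ∀ x, ‖f x‖ ≤ B) :
    ∫ O : Traj S A T, f (lastState O) ∂(M.rollout v T s)
      = ∫ x, f x ∂((M.stateKernel v ^ T) s) := by
  obtain ⟨n, rfl⟩ : ∃ n, T = n + 1 := ⟨T - 1, (Nat.succ_pred_eq_of_ne_zero (NeZero.ne T)).symm⟩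
  unfold lastState
  rw [M.integral_rollout_apply v (n + 1) _ s (f := fun o => f o.2.2) (by fun_prop)]
  simp only [Nat.add_sub_cancel]
  rw [Kernel.comp_apply, integral_bind _ _ (integrable_of_bound _ (by fun_prop) (fun o => hB _)),
    M.integral_pow_succ_last v n s hf hB]
  simp only [M.integral_stateKernel v _ hf]

/-- The first coordinate of a rollout from `s` is `s`. This is phrased through integrals because
points of `S` are not assumed measurable. -/
theorem integral_rollout_firstState (M : Model S A dv dw) (v : Vec dv) (T : ℕ)
    [NeZero T] (s : S) {F : S → Traj S A T → E} (hF : Measurable (Function.uncurry F))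
    {B : ℝ} (hB : ∀ x O, ‖F x O‖ ≤ B) :
    ∫ O : Traj S A T, F (firstState O) O ∂(M.rollout v T s)
      = ∫ O : Traj S A T, F s O ∂(M.rollout v T s) := by
  obtain ⟨n, rfl⟩ : ∃ n, T = n + 1 := ⟨T - 1, (Nat.succ_pred_eq_of_ne_zero (NeZero.ne T)).symm⟩
  have hm1 : Measurable (fun O : Traj S A (n + 1) => F (firstState O) O) :=
    hF.comp (measurable_firstState.prodMk measurable_id)
  have hm2 : Measurable (fun O : Traj S A (n + 1) => F s O) := hF.comp measurable_prodMk_left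
  have hk : ∀ {g : Traj S A (n + 1) → E}, Measurable g → StronglyMeasurable (fun o : Obs S A =>
      ∫ O, g (Fin.cons o O : Traj S A (n + 1)) ∂(M.rollout v n o.2.2)) := fun {g} hg => by
    have : Measurable (Function.uncurry fun (o : Obs S A) (O : Traj S A n) =>
      g (Fin.cons o O : Traj S A (n + 1))) := hg.comp (measurable_cons n)
    exact this.stronglyMeasurable.integral_kernel_prod_right
        (κ := (M.rollout v n).comap (fun o : Obs S A => o.2.2) (by fun_prop))
  rw [M.integral_rollout_succ v n s hm1 (fun O => hB _ _),
    M.integral_rollout_succ v n s hm2 (fun O => hB _ _), obsKernel_apply,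
    integral_map (by fun_prop) (hk hm1).aestronglyMeasurable,
    integral_map (by fun_prop) (hk hm2).aestronglyMeasurable]
  rfl

end Integral

end Model

namespace Model

namespace Standing

variable {S A : Type*} [MeasurableSpace S] [MeasurableSpace A] {dv dw : ℕ}
  {M : Model S A dv dw} {μ : Vec dv → Measure S} {p : Params}

/-! ### Regularity of the stationary distribution -/

theorem abs_integral_pow_sub_le (h : M.Standing μ p) (v : Vec dv) (t : ℕ) (s : S) {f : S → ℝ}
    (hf : Measurable f) {B : ℝ} (hB : ∀ x, |f x| ≤ B) :
    |∫ x, f x ∂((M.stateKernel v ^ t) s) - ∫ x, f x ∂(μ v)| ≤ B * (p.c₀ * p.ρ ^ t) := by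
  have := h.ergodic.prob v
  refine (abs_integral_sub_le_tvNorm _ _ hf hB).trans ?_
  have hB0 : 0 ≤ B := (abs_nonneg _).trans (hB s)
  exact mul_le_mul_of_nonneg_left (h.ergodic.mixing v s t) hB0

theorem integral_invariant (h : M.Standing μ p) (v : Vec dv)
    {E : Type*} [NormedAddCommGroup E] [NormedSpace ℝ E]
    [SecondCountableTopology E] [MeasurableSpace E] [BorelSpace E] {f : S → E}
    (hf : Measurable f) {B : ℝ} (hB : ∀ x, ‖f x‖ ≤ B) :
    ∫ s, ∫ x, f x ∂(M.stateKernel v s) ∂(μ v) = ∫ s, f s ∂(μ v) := by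
  have := h.ergodic.prob v
  rw [← integral_bind _ _ (integrable_of_bound _ hf hB), (h.ergodic.invariant v).def]

/-- `F` is a truncated Neumann series `∑_{t<n} (P^t f - μ f)`. Applying `1 - P` telescopes it to `f
- μ f` minus a remainder that decays geometrically, while the geometric series bounds `F` by `mix *
B` for every `n`. An approximate solution is enough, since `ε` is sent to zero afterwards. -/
theorem exists_poisson (h : M.Standing μ p) (v : Vec dv) {f : S → ℝ}
    (hf : Measurable f) {B : ℝ} (hB0 : 0 ≤ B) (hB : ∀ x, |f x| ≤ B) {ε : ℝ} (hε : 0 < ε) :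
    ∃ F : S → ℝ, Measurable F ∧ (∀ s, |F s| ≤ p.mix * B) ∧
      ∀ s, |F s - ∫ x, F x ∂(M.stateKernel v s) - (f s - ∫ x, f x ∂(μ v))| ≤ ε := by
  have hprob := h.ergodic.prob v
  have hρ0 := h.adm.ρ_pos.le
  have hρ1 := h.adm.ρ_lt
  have hc := h.adm.c₀_pos.le
  set m := ∫ x, f x ∂(μ v) with hm
  set g : ℕ → S → ℝ := fun t s => ∫ x, f x ∂((M.stateKernel v ^ t) s) - m with hg
  have hgm : ∀ t, Measurable (g t) := fun t =>
    (hf.stronglyMeasurable.integral_kernel).measurable.sub_const m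
  have hgb : ∀ t s, |g t s| ≤ B * (p.c₀ * p.ρ ^ t) := fun t s =>
    h.abs_integral_pow_sub_le v t s hf hB
  have hgi : ∀ t s, Integrable (g t) (M.stateKernel v s) := fun t s =>
    integrable_of_bound _ (hgm t) (hgb t)
  have hstep : ∀ t s, ∫ x, g t x ∂(M.stateKernel v s) = g (t + 1) s := fun t s => by
    have hi : Integrable (fun x => ∫ y, f y ∂((M.stateKernel v ^ t) x)) (M.stateKernel v s) :=
      integrable_of_bound _ (hf.stronglyMeasurable.integral_kernel).measurable
        (fun x => norm_integral_le_of_bound _ hB)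
    simp only [hg]
    rw [integral_sub hi (integrable_const m), M.integral_pow_succ v t s hf hB]
    simp
  have hlim : Filter.Tendsto (fun n : ℕ => B * (p.c₀ * p.ρ ^ n)) Filter.atTop (nhds 0) := by
    have := ((tendsto_pow_atTop_nhds_zero_of_lt_one hρ0 hρ1).const_mul p.c₀).const_mul B
    simpa using this
  obtain ⟨n, hn⟩ := (hlim.eventually_lt_const hε).exists
  refine ⟨fun s => ∑ t ∈ Finset.range n, g t s, Finset.measurable_sum _ fun t _ => hgm t,
    fun s => ?_, fun s => ?_⟩
  · refine (Finset.abs_sum_le_sum_abs _ _).trans ((Finset.sum_le_sum fun t _ => hgb t s).trans ?_)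
    rw [← Finset.mul_sum, ← Finset.mul_sum, mul_comm]
    refine mul_le_mul_of_nonneg_right ?_ hB0
    rw [Params.mix, div_eq_mul_inv, ← tsum_geometric_of_lt_one hρ0 hρ1]
    exact mul_le_mul_of_nonneg_left ((summable_geometric_of_lt_one hρ0 hρ1).sum_le_tsum _
      (fun i _ => by positivity)) hc
  · rw [integral_finsetSum _ (fun t _ => hgi t s)]
    simp only [hstep]
    rw [← Finset.sum_sub_distrib, Finset.sum_range_sub']
    have h0 : g 0 s = f s - m := by
      simp only [hg, pow_zero]
      change ∫ x, f x ∂(Kernel.id s) - m = _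
      rw [Kernel.id_apply, integral_dirac' _ _ hf.stronglyMeasurable]
    rw [h0, sub_sub_cancel_left, abs_neg]
    exact (hgb n s).trans hn.le

/-- Integrating the Poisson equation of `P_v` against `μ_y` and using `μ_y P_y = μ_y` gives the
perturbation formula `μ_y f - μ_v f ≈ μ_y (P_y - P_v) F`. The same `F` serves all `y`, which makes
second differences accessible. -/
theorem exists_stationary_diff (h : M.Standing μ p) (v : Vec dv) {f : S → ℝ}
    (hf : Measurable f) {B : ℝ} (hB0 : 0 ≤ B) (hB : ∀ x, |f x| ≤ B) {ε : ℝ} (hε : 0 < ε) :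
    ∃ F : S → ℝ, Measurable F ∧ (∀ s, |F s| ≤ p.mix * B) ∧
      ∀ y, |∫ x, f x ∂(μ y) - ∫ x, f x ∂(μ v)
        - ∫ s, (∫ x, F x ∂(M.stateKernel y s) - ∫ x, F x ∂(M.stateKernel v s)) ∂(μ y)| ≤ ε := by
  obtain ⟨F, hFm, hFb, hF⟩ := h.exists_poisson v hf hB0 hB hε
  refine ⟨F, hFm, hFb, fun y => ?_⟩
  have := h.ergodic.prob y
  have hPm : ∀ u, Measurable (fun s => ∫ x, F x ∂(M.stateKernel u s)) := fun u =>
    (hFm.stronglyMeasurable.integral_kernel).measurable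
  have hPi : ∀ u, Integrable (fun s => ∫ x, F x ∂(M.stateKernel u s)) (μ y) := fun u =>
    integrable_of_bound _ (hPm u) (fun x => norm_integral_le_of_bound _ hFb)
  have hFi : Integrable F (μ y) := integrable_of_bound _ hFm hFb
  have hfi : Integrable f (μ y) := integrable_of_bound _ hf hB
  rw [integral_sub (hPi y) (hPi v), h.integral_invariant y hFm hFb]
  have e : ∫ s, (F s - ∫ x, F x ∂(M.stateKernel v s) - (f s - ∫ x, f x ∂(μ v))) ∂(μ y)
      = (∫ s, F s ∂(μ y) - ∫ s, ∫ x, F x ∂(M.stateKernel v s) ∂(μ y))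
        - (∫ s, f s ∂(μ y) - ∫ x, f x ∂(μ v)) := by
    have j1 : Integrable (fun s => F s - ∫ x, F x ∂(M.stateKernel v s)) (μ y) := hFi.sub (hPi v)
    have j2 : Integrable (fun s => f s - ∫ x, f x ∂(μ v)) (μ y) := hfi.sub (integrable_const _)
    rw [integral_sub j1 j2, integral_sub hFi (hPi v), integral_sub hfi (integrable_const _)]
    simp
  rw [abs_sub_comm, ← e]
  exact abs_integral_le_of_bound _ hF

/-- The perturbation formula transfers the regularity of the one-step kernel to the stationary law.
A Lipschitz bound comes first, and is then used again for the mixed terms of the second difference.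
-/
theorem stationary (h : M.Standing μ p) : MeasC11 p.statLip p.statSecond μ := by
  have hprob := h.ergodic.prob
  have hl := h.adm.ell_nonneg
  have hmix := h.adm.mix_pos.le
  have hPlip : ∀ (D : ℝ) (F : S → ℝ), Measurable F → (∀ s, |F s| ≤ D) → ∀ u u' s,
      |∫ x, F x ∂(M.stateKernel u s) - ∫ x, F x ∂(M.stateKernel u' s)| ≤ p.ell * D * ‖u - u'‖ :=
    fun D F hF hD u u' s => (h.state s).lip D F hF hD u u'
  have lip : ∀ (B : ℝ) (f : S → ℝ), Measurable f → 0 ≤ B → (∀ x, |f x| ≤ B) → ∀ v v',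
      |∫ x, f x ∂(μ v) - ∫ x, f x ∂(μ v')| ≤ p.statLip * B * ‖v - v'‖ := by
    intro B f hf hB0 hB v v'
    refine le_of_forall_pos_le_add fun ε hε => ?_
    obtain ⟨F, hFm, hFb, hF⟩ := h.exists_stationary_diff v' hf hB0 hB hε
    have h1 := hF v
    have h2 : |∫ s, (∫ x, F x ∂(M.stateKernel v s) - ∫ x, F x ∂(M.stateKernel v' s)) ∂(μ v)|
        ≤ p.ell * (p.mix * B) * ‖v - v'‖ :=
      abs_integral_le_of_bound _ fun s => hPlip _ F hFm hFb v v' s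
    have h3 : p.statLip * B * ‖v - v'‖ = p.ell * (p.mix * B) * ‖v - v'‖ := by
      unfold Params.statLip; ring
    rw [h3]
    have h4 := abs_sub_abs_le_abs_sub (∫ x, f x ∂(μ v) - ∫ x, f x ∂(μ v'))
      (∫ s, (∫ x, F x ∂(M.stateKernel v s) - ∫ x, F x ∂(M.stateKernel v' s)) ∂(μ v))
    linarith
  refine MeasC11.of_integral hprob fun B f hf hB0 hB =>
    ⟨fun v => norm_integral_le_of_bound _ hB, lip B f hf hB0 hB, fun v d k => ?_⟩
  refine le_of_forall_pos_le_add fun ε hε => ?_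
  obtain ⟨F, hFm, hFb, hF⟩ := h.exists_stationary_diff v hf hB0 hB (show 0 < ε / 3 by positivity)
  have hPm : ∀ u, Measurable (fun s => ∫ x, F x ∂(M.stateKernel u s)) := fun u =>
    (hFm.stronglyMeasurable.integral_kernel).measurable
  have hPi : ∀ u y, Integrable (fun s => ∫ x, F x ∂(M.stateKernel u s)) (μ y) := fun u y =>
    integrable_of_bound _ (hPm u) (fun x => norm_integral_le_of_bound _ hFb)
  -- With `F` based at `v`, and indices marking the corners of the parallelogram, the second
  -- difference of `μ f` equals, up to `ε`, `μ₁₁(P₁₁ - P₁₀ - P₀₁ + P₀₀)F + (μ₁₁ - μ₁₀)(P₁₀ - P₀₀)F +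
  -- (μ₁₁ - μ₀₁)(P₀₁ - P₀₀)F`. The three parts are `t1`, `t2`, `t3`.
  have f11 := hF (v + d + k)
  have f10 := hF (v + d)
  have f01 := hF (v + k)
  have t1 : |∫ s, (∫ x, F x ∂(M.stateKernel (v + d + k) s) - ∫ x, F x ∂(M.stateKernel (v + d) s)
      - ∫ x, F x ∂(M.stateKernel (v + k) s) + ∫ x, F x ∂(M.stateKernel v s)) ∂(μ (v + d + k))|
      ≤ p.stepSecond * (p.mix * B) * ‖d‖ * ‖k‖ :=
    abs_integral_le_of_bound _ fun s => (h.state s).second _ F hFm hFb v d k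
  have hD : 0 ≤ p.ell * (p.mix * B) := by positivity
  have t2 := lip (p.ell * (p.mix * B) * ‖d‖) (fun s => ∫ x, F x ∂(M.stateKernel (v + d) s)
    - ∫ x, F x ∂(M.stateKernel v s)) ((hPm _).sub (hPm _)) (by positivity)
    (fun s => by simpa using hPlip _ F hFm hFb (v + d) v s) (v + d + k) (v + d)
  have t3 := lip (p.ell * (p.mix * B) * ‖k‖) (fun s => ∫ x, F x ∂(M.stateKernel (v + k) s)
    - ∫ x, F x ∂(M.stateKernel v s)) ((hPm _).sub (hPm _)) (by positivity)
    (fun s => by simpa using hPlip _ F hFm hFb (v + k) v s) (v + d + k) (v + k)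
  rw [show v + d + k - (v + d) = k by abel] at t2
  rw [show v + d + k - (v + k) = d by abel] at t3
  have i1 : ∀ u u' y, ∫ s, (∫ x, F x ∂(M.stateKernel u s) - ∫ x, F x ∂(M.stateKernel u' s)) ∂(μ y)
      = ∫ s, ∫ x, F x ∂(M.stateKernel u s) ∂(μ y)
        - ∫ s, ∫ x, F x ∂(M.stateKernel u' s) ∂(μ y) := fun u u' y =>
    integral_sub (hPi u y) (hPi u' y)
  have i2 : ∀ a b c e y, ∫ s, (∫ x, F x ∂(M.stateKernel a s) - ∫ x, F x ∂(M.stateKernel b s)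
      - ∫ x, F x ∂(M.stateKernel c s) + ∫ x, F x ∂(M.stateKernel e s)) ∂(μ y)
      = ∫ s, ∫ x, F x ∂(M.stateKernel a s) ∂(μ y) - ∫ s, ∫ x, F x ∂(M.stateKernel b s) ∂(μ y)
        - ∫ s, ∫ x, F x ∂(M.stateKernel c s) ∂(μ y)
        + ∫ s, ∫ x, F x ∂(M.stateKernel e s) ∂(μ y) := fun a b c e y => by
    have j1 : Integrable (fun s => ∫ x, F x ∂(M.stateKernel a s)
      - ∫ x, F x ∂(M.stateKernel b s)) (μ y) := (hPi a y).sub (hPi b y)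
    have j2 : Integrable (fun s => ∫ x, F x ∂(M.stateKernel a s)
      - ∫ x, F x ∂(M.stateKernel b s) - ∫ x, F x ∂(M.stateKernel c s)) (μ y) := j1.sub (hPi c y)
    rw [integral_add j2 (hPi e y), integral_sub j1 (hPi c y), i1]
  rw [i2] at t1
  rw [i1] at f11 f10 f01
  rw [i1, i1] at t2 t3
  have hs : p.statSecond * B * ‖d‖ * ‖k‖ = p.stepSecond * (p.mix * B) * ‖d‖ * ‖k‖
      + p.statLip * (p.ell * (p.mix * B) * ‖d‖) * ‖k‖
      + p.statLip * (p.ell * (p.mix * B) * ‖k‖) * ‖d‖ := by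
    unfold Params.statSecond Params.statLip; ring
  rw [hs, Real.norm_eq_abs, abs_le]
  rw [abs_le] at f11 f10 f01 t1 t2 t3
  constructor <;> linarith [f11.1, f11.2, f10.1, f10.2, f01.1, f01.2, t1.1, t1.2, t2.1, t2.2,
    t3.1, t3.2]

end Standing

end Model

/-- Solutions of a uniformly invertible linear system inherit the regularity of the data. -/
theorem IsC11.solve {V W : Type*} [NormedAddCommGroup V] [NormedAddCommGroup W] [NormedSpace ℝ W]
    {Φ : V → W →ₗ[ℝ] W} {b w : V → W} {κ BΦ LΦ CΦ Bb Lb Cb : ℝ} (hκ : 0 ≤ κ) (hLΦ : 0 ≤ LΦ)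
    (hCΦ : 0 ≤ CΦ) (hcoer : ∀ v x, ‖x‖ ≤ κ * ‖Φ v x‖)
    (hΦ : ∀ x, IsC11 (BΦ * ‖x‖) (LΦ * ‖x‖) (CΦ * ‖x‖) (fun v => Φ v x))
    (hb : IsC11 Bb Lb Cb b) (hw : ∀ v, Φ v (w v) = b v) :
    IsC11 (κ * Bb) (κ * (Lb + LΦ * (κ * Bb)))
      (κ * (Cb + 2 * LΦ * (κ * (Lb + LΦ * (κ * Bb))) + CΦ * (κ * Bb))) w := by
  have hB : ∀ v, ‖w v‖ ≤ κ * Bb := fun v => by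
    refine (hcoer v (w v)).trans (mul_le_mul_of_nonneg_left ?_ hκ)
    rw [hw]; exact hb.bound v
  have hL : ∀ v v', ‖w v - w v'‖ ≤ κ * (Lb + LΦ * (κ * Bb)) * ‖v - v'‖ := fun v v' => by
    refine (hcoer v _).trans ?_
    rw [mul_assoc]
    refine mul_le_mul_of_nonneg_left ?_ hκ
    calc ‖Φ v (w v - w v')‖ = ‖(b v - b v') - (Φ v (w v') - Φ v' (w v'))‖ := by
          rw [map_sub, hw, hw]; congr 1; abel
      _ ≤ _ := norm_sub_le _ _
      _ ≤ Lb * ‖v - v'‖ + LΦ * ‖w v'‖ * ‖v - v'‖ :=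
          add_le_add (hb.lip v v') ((hΦ _).lip v v')
      _ ≤ Lb * ‖v - v'‖ + LΦ * (κ * Bb) * ‖v - v'‖ := by gcongr; exact hB v'
      _ = _ := by ring
  refine ⟨hB, hL, fun v h k => ?_⟩
  set Lw := κ * (Lb + LΦ * (κ * Bb))
  refine (hcoer (v + h + k) _).trans ?_
  rw [mul_assoc, mul_assoc]
  refine mul_le_mul_of_nonneg_left ?_ hκ
  have e1 := hL (v + h) v
  have e2 := hL (v + k) v
  have d1 := (hΦ (w (v + h) - w v)).lip (v + h + k) (v + h)
  have d2 := (hΦ (w (v + k) - w v)).lip (v + h + k) (v + k)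
  have d3 := (hΦ (w v)).second v h k
  rw [add_sub_cancel_left] at e1 e2 d1
  rw [show v + h + k - (v + k) = h by abel] at d2
  -- The operator at the far corner is applied to the second difference of `w`. Replacing it by the
  -- operator belonging to each corner turns the values into `b`, and the corrections are first
  -- differences of `Φ` on first differences of `w` and one second difference of `Φ` on `w v`.
  calc ‖Φ (v + h + k) (w (v + h + k) - w (v + h) - w (v + k) + w v)‖
      = ‖(b (v + h + k) - b (v + h) - b (v + k) + b v)
          - (Φ (v + h + k) (w (v + h) - w v) - Φ (v + h) (w (v + h) - w v))
          - (Φ (v + h + k) (w (v + k) - w v) - Φ (v + k) (w (v + k) - w v))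
          - (Φ (v + h + k) (w v) - Φ (v + h) (w v) - Φ (v + k) (w v) + Φ v (w v))‖ := by
        simp only [map_add, map_sub, hw]; congr 1; abel
    _ ≤ ‖b (v + h + k) - b (v + h) - b (v + k) + b v‖
          + ‖Φ (v + h + k) (w (v + h) - w v) - Φ (v + h) (w (v + h) - w v)‖
          + ‖Φ (v + h + k) (w (v + k) - w v) - Φ (v + k) (w (v + k) - w v)‖
          + ‖Φ (v + h + k) (w v) - Φ (v + h) (w v) - Φ (v + k) (w v) + Φ v (w v)‖ := by
        refine (norm_sub_le _ _).trans (add_le_add ?_ le_rfl)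
        refine (norm_sub_le _ _).trans (add_le_add ?_ le_rfl)
        exact norm_sub_le _ _
    _ ≤ Cb * ‖h‖ * ‖k‖ + LΦ * (Lw * ‖h‖) * ‖k‖ + LΦ * (Lw * ‖k‖) * ‖h‖
          + CΦ * (κ * Bb) * ‖h‖ * ‖k‖ := by
        refine add_le_add (add_le_add (add_le_add (hb.second v h k) (d1.trans ?_))
          (d2.trans ?_)) (d3.trans ?_)
        · gcongr
        · gcongr
        · gcongr; exact hB v
    _ = _ := by ring

/-! ### Constants for the optimal critic, uniform in `T` -/

namespace Params

/-- The constant `∑ (t + 1)² γ^t`. -/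
noncomputable def geo (p : Params) : ℝ := ∑' t : ℕ, ((t : ℝ) + 1) ^ 2 * p.γ ^ t

variable {p : Params}

theorem Admissible.summable_geo (h : p.Admissible) :
    Summable (fun t : ℕ => ((t : ℝ) + 1) ^ 2 * p.γ ^ t) := by
  have hn : ‖p.γ‖ < 1 := by rw [Real.norm_of_nonneg h.γ_pos.le]; exact h.γ_lt
  have h2 := summable_pow_mul_geometric_of_norm_lt_one 2 hn
  have h1 := summable_pow_mul_geometric_of_norm_lt_one 1 hn
  have h0 := summable_pow_mul_geometric_of_norm_lt_one 0 hn
  refine ((h2.add (h1.mul_left 2)).add h0).congr fun t => ?_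
  ring

/-- The `n`-step kernels have Lipschitz constants of order `n` and second differences of order `n²`.
The discount absorbs both, which keeps `L_*` and `G_*` independent of `T`. -/
theorem Admissible.pow_mul_le_geo (h : p.Admissible) (T : ℕ) :
    p.γ ^ T * ((T : ℝ) + 1) ^ 2 ≤ p.geo := by
  have hγ := h.γ_pos
  rw [mul_comm]
  exact h.summable_geo.le_tsum T (fun j _ => by positivity)

theorem Admissible.sum_le_geo (h : p.Admissible) (T : ℕ) :
    ∑ t : Fin T, p.γ ^ (t : ℕ) * (((t : ℕ) : ℝ) + 1) ^ 2 ≤ p.geo := by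
  have hγ := h.γ_pos
  rw [Fin.sum_univ_eq_sum_range (fun t : ℕ => p.γ ^ t * ((t : ℝ) + 1) ^ 2) T]
  simp only [mul_comm (p.γ ^ _)]
  exact h.summable_geo.sum_le_tsum _ (fun j _ => by positivity)

theorem Admissible.one_le_geo (h : p.Admissible) : 1 ≤ p.geo := by
  simpa using h.pow_mul_le_geo 0

theorem Admissible.chainSecond_le (h : p.Admissible) (n : ℕ) :
    p.chainSecond n ≤ (n : ℝ) ^ 2 * (p.stepSecond + p.ell ^ 2) := by
  have h1 := h.stepSecond_nonneg
  have h2 : (n : ℝ) ≤ (n : ℝ) ^ 2 := by exact_mod_cast Nat.le_self_pow two_ne_zero n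
  unfold chainSecond
  nlinarith

/-- Lipschitz constant of the matrix `Φ_v` in the system `Φ_v w = b_v` for the optimal critic. -/
noncomputable def matLip (p : Params) : ℝ := p.geo * p.ell + 2 * p.statLip

/-- Second-difference bound for `Φ_v`. -/
noncomputable def matSecond (p : Params) : ℝ :=
  p.geo * (p.stepSecond + p.ell ^ 2) + 2 * p.statLip * (p.geo * p.ell) + 2 * p.statSecond

/-- Bound for `b_v`. -/
noncomputable def vecBound (p : Params) : ℝ := p.geo * p.Rr

/-- Lipschitz constant of `b_v`. -/
noncomputable def vecLip (p : Params) : ℝ := p.geo * p.ell * p.Rr + p.statLip * (p.geo * p.Rr)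

/-- Second-difference bound for `b_v`. -/
noncomputable def vecSecond (p : Params) : ℝ :=
  p.geo * (p.stepSecond + p.ell ^ 2) * p.Rr + 2 * p.statLip * (p.geo * p.ell * p.Rr)
    + p.statSecond * (p.geo * p.Rr)

/-- Bound for the inverse of `Φ_v`. -/
noncomputable def invBound (p : Params) : ℝ := ((1 - p.γ) * p.lam)⁻¹

/-- Bound for the optimal critic. -/
noncomputable def critBound (p : Params) : ℝ := p.invBound * p.vecBound

/-- Lipschitz constant of the optimal critic. -/
noncomputable def critLip (p : Params) : ℝ := p.invBound * (p.vecLip + p.matLip * p.critBound)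

/-- Second-difference bound for the optimal critic. -/
noncomputable def critSecond (p : Params) : ℝ :=
  p.invBound * (p.vecSecond + 2 * p.matLip * p.critLip + p.matSecond * p.critBound)

theorem Admissible.matLip_nonneg (h : p.Admissible) : 0 ≤ p.matLip := by
  have := h.one_le_geo; have := h.ell_nonneg; have := h.statLip_nonneg
  unfold matLip; positivity

theorem Admissible.matSecond_nonneg (h : p.Admissible) : 0 ≤ p.matSecond := by
  have := h.one_le_geo; have := h.ell_nonneg; have := h.statLip_nonneg
  have := h.stepSecond_nonneg; have := h.statSecond_nonneg
  unfold matSecond; positivity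

theorem Admissible.invBound_pos (h : p.Admissible) : 0 < p.invBound :=
  inv_pos.2 (mul_pos (by linarith [h.γ_lt]) h.lam_pos)

theorem Admissible.critBound_nonneg (h : p.Admissible) : 0 ≤ p.critBound := by
  have := h.one_le_geo; have := h.Rr_nonneg; have := h.invBound_pos
  unfold critBound vecBound; positivity

theorem Admissible.critLip_nonneg (h : p.Admissible) : 0 ≤ p.critLip := by
  have := h.one_le_geo; have := h.Rr_nonneg; have := h.invBound_pos; have := h.ell_nonneg
  have := h.matLip_nonneg; have := h.critBound_nonneg; have := h.statLip_nonneg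
  unfold critLip vecLip; positivity

theorem Admissible.critSecond_nonneg (h : p.Admissible) : 0 ≤ p.critSecond := by
  have := h.one_le_geo; have := h.Rr_nonneg; have := h.invBound_pos; have := h.ell_nonneg
  have := h.matLip_nonneg; have := h.critBound_nonneg; have := h.statLip_nonneg
  have := h.critLip_nonneg; have := h.matSecond_nonneg; have := h.stepSecond_nonneg
  have := h.statSecond_nonneg
  unfold critSecond vecSecond; positivity

theorem Admissible.pow_le_one (h : p.Admissible) (T : ℕ) : p.γ ^ T ≤ 1 :=
  pow_le_one₀ h.γ_pos.le h.γ_lt.le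

end Params

/-! ### The linear system for the optimal critic -/

namespace Model

variable {S A : Type*} [MeasurableSpace S] [MeasurableSpace A] {dv dw : ℕ}
  {M : Model S A dv dw} {μ : Vec dv → Measure S} {p : Params}

attribute [fun_prop] measurable_firstState measurable_lastState

theorem abs_inner_feat_le (M : Model S A dv dw) (s : S) (w : Vec dw) :
    |inner ℝ (M.feat s) w| ≤ ‖w‖ :=
  (abs_real_inner_le_norm _ _).trans
    (mul_le_of_le_one_left (norm_nonneg _) (M.norm_feat_le s))

theorem measurable_inner_feat (M : Model S A dv dw) (w : Vec dw) :
    Measurable (fun s => inner ℝ (M.feat s) w) := by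
  have := M.measurable_feat
  fun_prop

/-- The coefficient of `φ(s)` in the mean linear part of the semi-gradient from `s`. -/
noncomputable def matCoeff (M : Model S A dv dw) (γ : ℝ) (T : ℕ) (v : Vec dv) (w : Vec dw) (s : S) :
    ℝ :=
  inner ℝ (M.feat s) w - γ ^ T * ∫ x, inner ℝ (M.feat x) w ∂((M.stateKernel v ^ T) s)

/-- The expected discounted `T`-step reward from `s`. -/
noncomputable def rewardFrom (M : Model S A dv dw) (γ : ℝ) (T : ℕ) (v : Vec dv) (s : S) : ℝ :=
  ∑ t : Fin T, γ ^ (t : ℕ) *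
    ∫ o, M.reward o.1 o.2.1 ∂((M.obsKernel v ∘ₖ (M.stateKernel v ^ (t : ℕ))) s)

theorem measurable_matCoeff (M : Model S A dv dw) (γ : ℝ) (T : ℕ) (v : Vec dv) (w : Vec dw) :
    Measurable (M.matCoeff γ T v w) :=
  (M.measurable_inner_feat w).sub
    (((M.measurable_inner_feat w).stronglyMeasurable.integral_kernel).measurable.const_mul _)

theorem measurable_reward_obs (M : Model S A dv dw) :
    Measurable (fun o : Obs S A => M.reward o.1 o.2.1) :=
  M.measurable_reward.comp (measurable_fst.prodMk (measurable_fst.comp measurable_snd))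

theorem measurable_rewardFrom (M : Model S A dv dw) (γ : ℝ) (T : ℕ) (v : Vec dv) :
    Measurable (M.rewardFrom γ T v) :=
  Finset.measurable_sum _ fun _ _ =>
    ((M.measurable_reward_obs.stronglyMeasurable.integral_kernel).measurable.const_mul _)

theorem matCoeff_add (M : Model S A dv dw) (γ : ℝ) (T : ℕ) (v : Vec dv) (w w' : Vec dw) (s : S) :
    M.matCoeff γ T v (w + w') s = M.matCoeff γ T v w s + M.matCoeff γ T v w' s := by
  have hi := fun w => integrable_of_bound ((M.stateKernel v ^ T) s) (M.measurable_inner_feat w)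
    (fun x => M.abs_inner_feat_le x w)
  simp only [matCoeff, inner_add_right]
  rw [integral_add (hi w) (hi w')]
  ring

theorem matCoeff_smul (M : Model S A dv dw) (γ : ℝ) (T : ℕ) (v : Vec dv) (c : ℝ) (w : Vec dw)
    (s : S) : M.matCoeff γ T v (c • w) s = c * M.matCoeff γ T v w s := by
  simp only [matCoeff, real_inner_smul_right]
  rw [integral_const_mul]
  ring

theorem integrable_matCoeff_smul (M : Model S A dv dw) (γ : ℝ) (T : ℕ) (v : Vec dv) (w : Vec dw)
    (ν : Measure S) [IsProbabilityMeasure ν] :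
    Integrable (fun s => M.matCoeff γ T v w s • M.feat s) ν := by
  refine integrable_of_bound ν ((M.measurable_matCoeff γ T v w).smul M.measurable_feat)
    (B := ‖w‖ + |γ ^ T| * ‖w‖) fun s => ?_
  rw [norm_smul]
  refine (mul_le_of_le_one_right (norm_nonneg _) (M.norm_feat_le s)).trans ?_
  refine (abs_sub _ _).trans (add_le_add (M.abs_inner_feat_le s w) ?_)
  rw [abs_mul]
  gcongr
  exact abs_integral_le_of_bound _ fun x => M.abs_inner_feat_le x w

/-- The linear part `w ↦ E[φ_0 (φ_0 - γ^T φ_T)ᵀ] w` of the full semi-gradient. -/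
noncomputable def critMat (M : Model S A dv dw) (μ : Vec dv → Measure S) (hμ : ∀ v, IsProbabilityMeasure (μ v))
    (γ : ℝ) (T : ℕ) (v : Vec dv) : Vec dw →ₗ[ℝ] Vec dw where
  toFun w := ∫ s, M.matCoeff γ T v w s • M.feat s ∂(μ v)
  map_add' w w' := by
    have := hμ v
    simp only [matCoeff_add, add_smul]
    exact integral_add (M.integrable_matCoeff_smul γ T v w _)
      (M.integrable_matCoeff_smul γ T v w' _)
  map_smul' c w := by
    simp only [matCoeff_smul, mul_smul, RingHom.id_apply]
    exact integral_smul c _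

/-- The constant part `E[φ_0 ∑ γ^t r_t]` of the full semi-gradient. -/
noncomputable def critVec (M : Model S A dv dw) (μ : Vec dv → Measure S) (γ : ℝ) (T : ℕ)
    (v : Vec dv) : Vec dw :=
  ∫ s, M.rewardFrom γ T v s • M.feat s ∂(μ v)

theorem measurable_semiGrad_right (M : Model S A dv dw) (γ : ℝ) {T : ℕ} [NeZero T] (w : Vec dw) :
    Measurable (fun O : Traj S A T => M.semiGrad γ w O) := by
  have h1 := M.measurable_feat
  have h2 : Measurable (fun O : Traj S A T =>
      ∑ t : Fin T, γ ^ (t : ℕ) * M.reward (O t).1 (O t).2.1) :=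
    Finset.measurable_sum _ fun t _ =>
      ((M.measurable_reward_obs.comp (measurable_pi_apply t)).const_mul _)
  unfold semiGrad
  fun_prop

theorem norm_feat_smul_le (M : Model S A dv dw) (s : S) (c : ℝ) : ‖c • M.feat s‖ ≤ |c| := by
  rw [norm_smul]
  exact mul_le_of_le_one_right (norm_nonneg _) (M.norm_feat_le s)

theorem abs_inner_feat_sub_le (M : Model S A dv dw) {γ : ℝ} (hγ : 0 ≤ γ) (T : ℕ) (s s' : S)
    (w : Vec dw) : |inner ℝ (M.feat s - γ ^ T • M.feat s') w| ≤ (1 + γ ^ T) * ‖w‖ := by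
  refine (abs_real_inner_le_norm _ _).trans (mul_le_mul_of_nonneg_right ?_ (norm_nonneg _))
  refine (norm_sub_le _ _).trans (add_le_add (M.norm_feat_le s) ?_)
  rw [norm_smul, Real.norm_of_nonneg (by positivity)]
  exact mul_le_of_le_one_right (by positivity) (M.norm_feat_le s')

namespace Standing

theorem abs_sum_reward_le (h : M.Standing μ p) {T : ℕ} (O : Traj S A T) :
    |∑ t : Fin T, p.γ ^ (t : ℕ) * M.reward (O t).1 (O t).2.1|
      ≤ (1 - p.γ ^ T) / (1 - p.γ) * p.Rr := by
  have hγ := h.adm.γ_pos.le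
  refine (Finset.abs_sum_le_sum_abs _ _).trans ((Finset.sum_le_sum
    (g := fun t : Fin T => p.γ ^ (t : ℕ) * p.Rr) fun t _ => ?_).trans_eq ?_)
  · rw [abs_mul, abs_of_nonneg (by positivity)]
    gcongr
    exact h.reward_le _ _
  · rw [← Finset.sum_mul, Fin.sum_univ_eq_sum_range (fun t => p.γ ^ t) T,
      geom_sum_eq h.adm.γ_lt.ne, ← neg_div_neg_eq, neg_sub, neg_sub]

theorem norm_semiGrad_le (h : M.Standing μ p) {T : ℕ} [NeZero T] (w : Vec dw) (O : Traj S A T) :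
    ‖M.semiGrad p.γ w O‖ ≤ (1 + p.γ ^ T) * ‖w‖ + (1 - p.γ ^ T) / (1 - p.γ) * p.Rr := by
  refine (norm_sub_le _ _).trans (add_le_add ?_ ?_)
  · exact (M.norm_feat_smul_le _ _).trans (M.abs_inner_feat_sub_le h.adm.γ_pos.le T _ _ w)
  · exact (M.norm_feat_smul_le _ _).trans (h.abs_sum_reward_le O)

/-- As the rollout starts at `s`, the vector `φ(s)` leaves the integral, and the remaining scalar
involves only marginals: the law of the last state and those of the single observations. -/
theorem integral_semiGrad_rollout (h : M.Standing μ p) (T : ℕ) [NeZero T] (v : Vec dv)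
    (w : Vec dw) (s : S) :
    ∫ O, M.semiGrad p.γ w O ∂(M.rollout v T s)
      = M.matCoeff p.γ T v w s • M.feat s - M.rewardFrom p.γ T v s • M.feat s := by
  have hγ := h.adm.γ_pos.le
  have hfm := M.measurable_feat
  set a : S → Traj S A T → ℝ := fun x O =>
    inner ℝ (M.feat x - p.γ ^ T • M.feat (lastState O)) w
      - ∑ t : Fin T, p.γ ^ (t : ℕ) * M.reward (O t).1 (O t).2.1 with ha
  have hsum : Measurable (fun O : Traj S A T =>
      ∑ t : Fin T, p.γ ^ (t : ℕ) * M.reward (O t).1 (O t).2.1) :=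
    Finset.measurable_sum _ fun t _ =>
      ((M.measurable_reward_obs.comp (measurable_pi_apply t)).const_mul _)
  have ham : Measurable (Function.uncurry a) := by
    unfold Function.uncurry
    simp only [ha]
    exact Measurable.sub (by fun_prop) (hsum.comp measurable_snd)
  have hab : ∀ x O, |a x O| ≤ (1 + p.γ ^ T) * ‖w‖ + (1 - p.γ ^ T) / (1 - p.γ) * p.Rr :=
    fun x O => (abs_sub _ _).trans (add_le_add (M.abs_inner_feat_sub_le hγ T _ _ w)
      (h.abs_sum_reward_le O))
  have e1 : ∀ O : Traj S A T, M.semiGrad p.γ w O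
      = a (firstState O) O • M.feat (firstState O) := fun O => by
    simp only [ha, semiGrad, sub_smul]
  simp only [e1]
  rw [M.integral_rollout_firstState v T s (F := fun x O => a x O • M.feat x)
    (ham.smul (hfm.comp measurable_fst))
    (fun x O => (M.norm_feat_smul_le x _).trans (hab x O)), integral_smul_const, ← sub_smul]
  congr 1
  have hlast : Integrable (fun O : Traj S A T => inner ℝ (M.feat (lastState O)) w)
      (M.rollout v T s) :=
    integrable_of_bound _ (by fun_prop) (fun O => M.abs_inner_feat_le _ w)
  have hr : ∀ t : Fin T, Integrable (fun O : Traj S A T => M.reward (O t).1 (O t).2.1)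
      (M.rollout v T s) := fun t => integrable_of_bound _
    (M.measurable_reward_obs.comp (measurable_pi_apply t)) (fun O => h.reward_le _ _)
  simp only [ha, inner_sub_left, real_inner_smul_left]
  have j1 : Integrable (fun O : Traj S A T => inner ℝ (M.feat s) w
      - p.γ ^ T * inner ℝ (M.feat (lastState O)) w) (M.rollout v T s) :=
    (integrable_const _).sub (hlast.const_mul _)
  rw [integral_sub j1 (integrable_finsetSum _ fun t _ => (hr t).const_mul _),
    integral_sub (integrable_const _) (hlast.const_mul _), integral_const_mul,
    integral_finsetSum _ fun t _ => (hr t).const_mul _,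
    M.integral_rollout_lastState v T s (M.measurable_inner_feat w)
      (fun x => M.abs_inner_feat_le x w)]
  simp only [integral_const_mul, fun t : Fin T => M.integral_rollout_apply v T t s
    M.measurable_reward_obs, MeasureTheory.integral_const, probReal_univ, one_smul]
  rfl

theorem fullSemiGrad_eq_integral (h : M.Standing μ p) (T : ℕ) [NeZero T] (v : Vec dv)
    (w : Vec dw) : M.fullSemiGrad μ p.γ T v w
      = ∫ s, ∫ O, M.semiGrad p.γ w O ∂(M.rollout v T s) ∂(μ v) := by
  have := h.ergodic.prob v
  exact integral_bind _ _ (integrable_of_bound _ (M.measurable_semiGrad_right p.γ w)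
    (h.norm_semiGrad_le w))

theorem isC11_rewardFrom (h : M.Standing μ p) (T : ℕ) (s : S) :
    IsC11 (p.geo * p.Rr) (p.geo * p.ell * p.Rr)
      (p.geo * (p.stepSecond + p.ell ^ 2) * p.Rr) (fun v => M.rewardFrom p.γ T v s) := by
  have hγ := h.adm.γ_pos.le
  have hR := h.adm.Rr_nonneg
  have hl := h.adm.ell_nonneg
  have hs := h.adm.stepSecond_nonneg
  have h1 := IsC11.sum (Finset.univ : Finset (Fin T)) (fun t _ =>
    ((h.obs_pow (t : ℕ) s).integral_const M.measurable_reward_obs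
      (fun o => h.reward_le _ _)).const_smul (pow_nonneg hγ (t : ℕ)))
  have hgeo := h.adm.sum_le_geo T
  refine IsC11.mono h1 ?_ ?_ ?_
  · calc _ ≤ ∑ t : Fin T, p.γ ^ (t : ℕ) * (((t : ℕ) : ℝ) + 1) ^ 2 * p.Rr := by
          refine Finset.sum_le_sum fun t _ => ?_
          gcongr
          refine le_mul_of_one_le_right (by positivity) (one_le_pow₀ ?_)
          linarith [Nat.cast_nonneg (α := ℝ) (t : ℕ)]
      _ ≤ _ := by rw [← Finset.sum_mul]; gcongr
  · calc _ ≤ ∑ t : Fin T, p.γ ^ (t : ℕ) * (((t : ℕ) : ℝ) + 1) ^ 2 * (p.ell * p.Rr) := by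
          refine Finset.sum_le_sum fun t _ => ?_
          have : (((t : ℕ) : ℝ) + 1) ≤ (((t : ℕ) : ℝ) + 1) ^ 2 :=
            le_self_pow₀ (by linarith [Nat.cast_nonneg (α := ℝ) (t : ℕ)]) two_ne_zero
          calc _ = p.γ ^ (t : ℕ) * (((t : ℕ) : ℝ) + 1) * (p.ell * p.Rr) := by ring
            _ ≤ _ := by gcongr
      _ ≤ p.geo * (p.ell * p.Rr) := by rw [← Finset.sum_mul]; gcongr
      _ = _ := by ring
  · calc _ ≤ ∑ t : Fin T, p.γ ^ (t : ℕ) * (((t : ℕ) : ℝ) + 1) ^ 2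
            * ((p.stepSecond + p.ell ^ 2) * p.Rr) := by
          refine Finset.sum_le_sum fun t _ => ?_
          have := h.adm.chainSecond_le ((t : ℕ) + 1)
          push_cast at this
          calc _ ≤ p.γ ^ (t : ℕ) * (((((t : ℕ) : ℝ) + 1) ^ 2 * (p.stepSecond + p.ell ^ 2)) * p.Rr) := by
                gcongr
            _ = _ := by ring
      _ ≤ p.geo * ((p.stepSecond + p.ell ^ 2) * p.Rr) := by
          rw [← Finset.sum_mul]; gcongr
      _ = _ := by ring

theorem isC11_smul_feat (s : S) {B L C : ℝ} {y : Vec dv → ℝ} (hy : IsC11 B L C y) :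
    IsC11 B L C (fun v => y v • M.feat s) := by
  have := hy.clm_comp ((ContinuousLinearMap.id ℝ ℝ).smulRight (M.feat s)) (a := 1) (by
    refine ContinuousLinearMap.opNorm_le_bound _ zero_le_one fun c => ?_
    simpa using M.norm_feat_smul_le s c)
  simpa using this

theorem isC11_matCoeff (h : M.Standing μ p) (T : ℕ) (w : Vec dw) (s : S) :
    IsC11 (2 * ‖w‖) (p.geo * p.ell * ‖w‖)
      (p.geo * (p.stepSecond + p.ell ^ 2) * ‖w‖) (fun v => M.matCoeff p.γ T v w s) := by
  have hγ := h.adm.γ_pos.le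
  have hl := h.adm.ell_nonneg
  have hs := h.adm.stepSecond_nonneg
  have hgeo := h.adm.pow_mul_le_geo T
  have hT : p.γ ^ T * (T : ℝ) ^ 2 ≤ p.geo := by
    refine le_trans ?_ hgeo
    gcongr
    linarith
  have hT' : p.γ ^ T * (T : ℝ) ≤ p.geo := by
    refine le_trans ?_ hT
    gcongr
    exact_mod_cast Nat.le_self_pow two_ne_zero T
  have h1 := ((h.pow T s).integral_const (M.measurable_inner_feat w)
    (fun x => M.abs_inner_feat_le x w)).clm_comp
      (-(p.γ ^ T) • ContinuousLinearMap.id ℝ ℝ) (a := p.γ ^ T) (by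
        refine ContinuousLinearMap.opNorm_le_bound _ (by positivity) fun c => ?_
        simp [abs_of_nonneg hγ])
  have h2 := (IsC11.const (V := Vec dv) (inner ℝ (M.feat s) w) (M.abs_inner_feat_le s w)).add h1
  have e : (fun v : Vec dv => M.matCoeff p.γ T v w s) = fun v => inner ℝ (M.feat s) w
      + (-(p.γ ^ T) • ContinuousLinearMap.id ℝ ℝ)
        (∫ x, inner ℝ (M.feat x) w ∂((M.stateKernel v ^ T) s)) := by
    funext v
    simp [matCoeff, sub_eq_add_neg]
  rw [e]
  refine h2.mono ?_ ?_ ?_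
  · nlinarith [mul_le_mul_of_nonneg_right (h.adm.pow_le_one T) (norm_nonneg w)]
  · calc _ = p.γ ^ T * T * p.ell * ‖w‖ := by ring
      _ ≤ _ := by gcongr
  · calc _ ≤ 0 + p.γ ^ T * (((T : ℝ) ^ 2 * (p.stepSecond + p.ell ^ 2)) * ‖w‖) := by
          gcongr; exact h.adm.chainSecond_le T
      _ = p.γ ^ T * (T : ℝ) ^ 2 * (p.stepSecond + p.ell ^ 2) * ‖w‖ := by ring
      _ ≤ _ := by gcongr

theorem isC11_critMat (h : M.Standing μ p) (T : ℕ) (w : Vec dw) :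
    IsC11 (2 * ‖w‖) (p.matLip * ‖w‖) (p.matSecond * ‖w‖)
      (fun v => M.critMat μ h.ergodic.prob p.γ T v w) := by
  have hl := h.adm.ell_nonneg
  have hg := h.adm.one_le_geo
  refine (h.stationary.integral h.adm.statLip_nonneg h.adm.statSecond_nonneg (by positivity)
    (by positivity) (f := fun v s => M.matCoeff p.γ T v w s • M.feat s)
    (fun v => (M.measurable_matCoeff p.γ T v w).smul M.measurable_feat)
    (fun s => isC11_smul_feat s (h.isC11_matCoeff T w s))).mono le_rfl ?_ ?_
  · unfold Params.matLip; exact le_of_eq (by ring)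
  · unfold Params.matSecond; exact le_of_eq (by ring)

theorem isC11_critVec (h : M.Standing μ p) (T : ℕ) :
    IsC11 p.vecBound p.vecLip p.vecSecond (fun v => M.critVec μ p.γ T v) := by
  have hl := h.adm.ell_nonneg
  have hg := h.adm.one_le_geo
  have hR := h.adm.Rr_nonneg
  exact h.stationary.integral h.adm.statLip_nonneg h.adm.statSecond_nonneg
    (B := p.geo * p.Rr) (L' := p.geo * p.ell * p.Rr) (by positivity) (by positivity) (f := fun v s => M.rewardFrom p.γ T v s • M.feat s)
    (fun v => (M.measurable_rewardFrom p.γ T v).smul M.measurable_feat)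
    (fun s => isC11_smul_feat s (h.isC11_rewardFrom T s))

/-- The defining equation of `w*_v` becomes the linear system `Φ_v w = b_v`, with `critMat` as `Φ_v`
and `critVec` as `b_v`. -/
theorem fullSemiGrad_eq (h : M.Standing μ p) (T : ℕ) [NeZero T] (v : Vec dv)
    (w : Vec dw) : M.fullSemiGrad μ p.γ T v w
      = M.critMat μ h.ergodic.prob p.γ T v w - M.critVec μ p.γ T v := by
  have := h.ergodic.prob v
  rw [h.fullSemiGrad_eq_integral]
  simp only [h.integral_semiGrad_rollout]
  rw [integral_sub (M.integrable_matCoeff_smul p.γ T v w _)]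
  · rfl
  · exact integrable_of_bound _ ((M.measurable_rewardFrom p.γ T v).smul M.measurable_feat)
      (fun s => (isC11_smul_feat s (h.isC11_rewardFrom T s)).bound v)

theorem integral_pow_invariant (h : M.Standing μ p) (v : Vec dv) (n : ℕ)
    {E : Type*} [NormedAddCommGroup E] [NormedSpace ℝ E]
    [SecondCountableTopology E] [MeasurableSpace E] [BorelSpace E] {f : S → E}
    (hf : Measurable f) {B : ℝ} (hB : ∀ x, ‖f x‖ ≤ B) :
    ∫ s, ∫ x, f x ∂((M.stateKernel v ^ n) s) ∂(μ v) = ∫ s, f s ∂(μ v) := by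
  have := h.ergodic.prob v
  have hinv : (μ v).bind (M.stateKernel v ^ n) = μ v := by
    induction n with
    | zero =>
      rw [pow_zero]
      change (μ v).bind (Kernel.id : Kernel S S) = μ v
      exact Measure.id_comp
    | succ n ih =>
      have e : (μ v).bind (M.stateKernel v ^ (n + 1))
          = ((μ v).bind (M.stateKernel v)).bind (M.stateKernel v ^ n) := by
        rw [pow_succ]
        exact Measure.comp_assoc.symm
      rw [e, (h.ergodic.invariant v).def, ih]
  rw [← integral_bind _ _ (integrable_of_bound _ hf hB), hinv]

/-- With `a(s) = ⟨φ(s), x⟩`, the cross term `γ^T a · P^T a` is at most `γ^T (a² + P^T a²) / 2`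
pointwise. By stationarity `P^T a²` and `a²` have the same integral, so `(1 - γ^T) ∫ a²` survives,
and the feature covariance bounds it below. -/
theorem coercive (h : M.Standing μ p) (T : ℕ) (v : Vec dv) (x : Vec dw) :
    sig p.γ p.lam T * ‖x‖ ^ 2 ≤ inner ℝ x (M.critMat μ h.ergodic.prob p.γ T v x) := by
  have := h.ergodic.prob v
  have hγT := h.adm.pow_le_one T
  have hγT0 : 0 ≤ p.γ ^ T := pow_nonneg h.adm.γ_pos.le T
  have hm := M.measurable_inner_feat x
  have hb : ∀ s, ‖(inner ℝ (M.feat s) x : ℝ) ^ 2‖ ≤ ‖x‖ ^ 2 := fun s => by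
    rw [norm_pow]
    exact pow_le_pow_left₀ (norm_nonneg _) (M.abs_inner_feat_le s x) 2
  have hPm : Measurable (fun s => ∫ y, (inner ℝ (M.feat y) x : ℝ) ^ 2 ∂((M.stateKernel v ^ T) s)) :=
    ((hm.pow_const 2).stronglyMeasurable.integral_kernel).measurable
  have hPi : Integrable (fun s => ∫ y, (inner ℝ (M.feat y) x : ℝ) ^ 2 ∂((M.stateKernel v ^ T) s))
      (μ v) := integrable_of_bound _ hPm (fun s => norm_integral_le_of_bound _ hb)
  have hi : Integrable (fun s => (inner ℝ (M.feat s) x : ℝ) ^ 2) (μ v) :=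
    integrable_of_bound _ (hm.pow_const 2) hb
  have e1 : inner ℝ x (M.critMat μ h.ergodic.prob p.γ T v x)
      = ∫ s, M.matCoeff p.γ T v x s * inner ℝ (M.feat s) x ∂(μ v) := by
    change inner ℝ x (∫ s, M.matCoeff p.γ T v x s • M.feat s ∂(μ v)) = _
    rw [← integral_inner (M.integrable_matCoeff_smul p.γ T v x _)]
    simp only [real_inner_smul_right, real_inner_comm]
  have hgi : Integrable (fun s => M.matCoeff p.γ T v x s * inner ℝ (M.feat s) x) (μ v) := by
    have := (M.integrable_matCoeff_smul p.γ T v x (μ v)).const_inner (𝕜 := ℝ) x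
    simpa only [real_inner_smul_right, real_inner_comm] using this
  have hpt : ∀ s, (1 - p.γ ^ T / 2) * (inner ℝ (M.feat s) x : ℝ) ^ 2
      - p.γ ^ T / 2 * ∫ y, (inner ℝ (M.feat y) x : ℝ) ^ 2 ∂((M.stateKernel v ^ T) s)
      ≤ M.matCoeff p.γ T v x s * inner ℝ (M.feat s) x := fun s => by
    set a : ℝ := inner ℝ (M.feat s) x
    set m : ℝ := ∫ y, inner ℝ (M.feat y) x ∂((M.stateKernel v ^ T) s) with hmdef
    set q : ℝ := ∫ y, (inner ℝ (M.feat y) x : ℝ) ^ 2 ∂((M.stateKernel v ^ T) s) with hq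
    have hi1 : Integrable (fun y => (inner ℝ (M.feat y) x : ℝ)) ((M.stateKernel v ^ T) s) :=
      integrable_of_bound _ hm (fun y => M.abs_inner_feat_le y x)
    have hi2 : Integrable (fun y => (inner ℝ (M.feat y) x : ℝ) ^ 2) ((M.stateKernel v ^ T) s) :=
      integrable_of_bound _ (hm.pow_const 2) hb
    -- Jensen's and Young's inequalities at once, by expanding the integral of the square `(⟨φ(y),
    -- x⟩ - a)²`.
    have hjen : 2 * a * m ≤ a ^ 2 + q := by
      have : 0 ≤ ∫ y, ((inner ℝ (M.feat y) x : ℝ) - a) ^ 2 ∂((M.stateKernel v ^ T) s) :=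
        integral_nonneg fun y => sq_nonneg _
      have e : ∫ y, ((inner ℝ (M.feat y) x : ℝ) - a) ^ 2 ∂((M.stateKernel v ^ T) s)
          = q - 2 * a * m + a ^ 2 := by
        have e0 : ∀ y, ((inner ℝ (M.feat y) x : ℝ) - a) ^ 2
            = (inner ℝ (M.feat y) x : ℝ) ^ 2 - 2 * a * inner ℝ (M.feat y) x + a ^ 2 :=
          fun y => by ring
        simp only [e0]
        have j1 : Integrable (fun y => (inner ℝ (M.feat y) x : ℝ) ^ 2
            - 2 * a * inner ℝ (M.feat y) x) ((M.stateKernel v ^ T) s) :=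
          hi2.sub (hi1.const_mul _)
        rw [integral_add j1 (integrable_const _),
          integral_sub hi2 (hi1.const_mul _), integral_const_mul]
        simp [hq, hmdef]
      linarith
    change _ ≤ (a - p.γ ^ T * m) * a
    nlinarith [mul_le_mul_of_nonneg_left hjen hγT0]
  rw [e1]
  have hmono := integral_mono ((hi.const_mul (1 - p.γ ^ T / 2)).sub (hPi.const_mul (p.γ ^ T / 2)))
    hgi hpt
  simp only [Pi.sub_apply] at hmono
  rw [integral_sub (hi.const_mul _) (hPi.const_mul _), integral_const_mul, integral_const_mul,
    h.integral_pow_invariant v T (hm.pow_const 2) hb] at hmono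
  have hcov := h.cov v x
  unfold sig
  nlinarith [mul_le_mul_of_nonneg_left hcov (sub_nonneg.2 hγT)]

/-- Here `T ≥ 1` enters: `γ^T ≤ γ` gives `σ ≥ (1 - γ) λ`, hence an inverse bound free of `T`. -/
theorem norm_le_critMat (h : M.Standing μ p) (T : ℕ) [NeZero T] (v : Vec dv) (x : Vec dw) :
    ‖x‖ ≤ p.invBound * ‖M.critMat μ h.ergodic.prob p.γ T v x‖ := by
  have h1 := h.coercive T v x
  have h2 : p.γ ^ T ≤ p.γ := pow_le_of_le_one h.adm.γ_pos.le h.adm.γ_lt.le (NeZero.ne T)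
  have h3 : 0 < (1 - p.γ) * p.lam := mul_pos (by linarith [h.adm.γ_lt]) h.adm.lam_pos
  have h4 : (1 - p.γ) * p.lam ≤ sig p.γ p.lam T :=
    mul_le_mul_of_nonneg_right (by linarith) h.adm.lam_pos.le
  rw [Params.invBound, inv_mul_eq_div, le_div_iff₀ h3]
  rcases eq_or_ne x 0 with rfl | hx
  · simp
  have hx' : 0 < ‖x‖ := norm_pos_iff.2 hx
  have h5 := h1.trans (real_inner_le_norm _ _)
  have h6 : ((1 - p.γ) * p.lam) * ‖x‖ ^ 2 ≤ ‖x‖ * ‖M.critMat μ h.ergodic.prob p.γ T v x‖ :=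
    (mul_le_mul_of_nonneg_right h4 (by positivity)).trans h5
  nlinarith

/-- Coercivity makes `Φ_v` injective, hence surjective in finite dimension. A solution therefore
exists, and the choice in the definition of `optCritic` is one. -/
theorem critMat_optCritic (h : M.Standing μ p) (T : ℕ) [NeZero T] (v : Vec dv) :
    M.critMat μ h.ergodic.prob p.γ T v (M.optCritic μ p.γ T v) = M.critVec μ p.γ T v := by
  have hinj : Function.Injective (M.critMat μ h.ergodic.prob p.γ T v) := by
    refine (injective_iff_map_eq_zero _).2 fun x hx => ?_
    have := h.norm_le_critMat T v x
    rw [hx, norm_zero, mul_zero] at this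
    exact norm_le_zero_iff.1 this
  obtain ⟨w, hw⟩ := LinearMap.surjective_of_injective hinj (M.critVec μ p.γ T v)
  have hex : ∃ w, M.fullSemiGrad μ p.γ T v w = 0 :=
    ⟨w, by rw [h.fullSemiGrad_eq, hw, sub_self]⟩
  have := Classical.epsilon_spec hex
  rw [h.fullSemiGrad_eq, sub_eq_zero] at this
  exact this

theorem fullSemiGrad_eq_zero_iff (h : M.Standing μ p) (T : ℕ) [NeZero T] (v : Vec dv)
    (w : Vec dw) : M.fullSemiGrad μ p.γ T v w = 0 ↔ w = M.optCritic μ p.γ T v := by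
  rw [h.fullSemiGrad_eq, sub_eq_zero]
  constructor
  · intro hw
    have := h.norm_le_critMat T v (w - M.optCritic μ p.γ T v)
    rw [map_sub, hw, h.critMat_optCritic, sub_self, norm_zero, mul_zero] at this
    exact sub_eq_zero.1 (norm_le_zero_iff.1 this)
  · rintro rfl
    exact h.critMat_optCritic T v

/-- The source of all that is used about `v ↦ w*_v`: Lipschitz continuity, differentiability and a
Lipschitz derivative, with constants that do not involve `T`. -/
theorem isC11_optCritic (h : M.Standing μ p) (T : ℕ) [NeZero T] :
    IsC11 p.critBound p.critLip p.critSecond (M.optCritic μ p.γ T) :=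
  IsC11.solve h.adm.invBound_pos.le h.adm.matLip_nonneg h.adm.matSecond_nonneg
    (fun v x => h.norm_le_critMat T v x) (fun x => h.isC11_critMat T x) (h.isC11_critVec T)
    (fun v => h.critMat_optCritic T v)

end Standing

end Model

/-! ### The stochastic policy gradient and its means -/

theorem one_sub_mul_sum_pow (γ : ℝ) (T : ℕ) :
    (1 - γ) * ∑ t : Fin T, γ ^ (t : ℕ) = 1 - γ ^ T := by
  rw [Fin.sum_univ_eq_sum_range (fun t => γ ^ t) T, mul_neg_geom_sum]

namespace Params

/-- Bound for the temporal difference `r(s,a) + (γ φ(s') - φ(s))ᵀ w`. -/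
noncomputable def tdBound (p : Params) : ℝ := p.Rr + (1 + p.γ) * p.Rw

/-- Bound for the stochastic policy gradient. -/
noncomputable def gradBound (p : Params) : ℝ := Rh p.γ p.Rr p.Rw p.Rπ

/-- Lipschitz constant of the mean stochastic policy gradient from a given state. -/
noncomputable def gradFromLip (p : Params) : ℝ :=
  p.geo * (p.tdBound * p.Lπ' + p.ell * p.gradBound)

/-- Lipschitz constant of the stationary policy gradient. -/
noncomputable def meanGradLip (p : Params) : ℝ :=
  p.tdBound * p.Lπ' + p.ell * p.gradBound + p.statLip * p.gradBound

variable {p : Params}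

theorem Admissible.tdBound_nonneg (h : p.Admissible) : 0 ≤ p.tdBound := by
  have := h.γ_pos; have := h.Rw_pos; have := h.Rr_nonneg
  unfold tdBound; positivity

theorem Admissible.gradBound_nonneg (h : p.Admissible) : 0 ≤ p.gradBound :=
  mul_nonneg h.Rπ_nonneg h.tdBound_nonneg

end Params

namespace Model

variable {S A : Type*} [MeasurableSpace S] [MeasurableSpace A] {dv dw : ℕ}
  {M : Model S A dv dw} {μ : Vec dv → Measure S} {p : Params}

/-- The mean of `h(v, w; o)` for the first observation from `s`. -/
noncomputable def hFrom (M : Model S A dv dw) (γ : ℝ) (v : Vec dv) (w : Vec dw) (s : S) : Vec dv :=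
  ∫ o, M.hfun γ v w o ∂(M.obsKernel v s)

/-- The mean of `h(v, w; o)` for a stationary observation. -/
noncomputable def meanGrad (M : Model S A dv dw) (μ : Vec dv → Measure S) (γ : ℝ) (v : Vec dv)
    (w : Vec dw) : Vec dv :=
  ∫ s, M.hFrom γ v w s ∂(μ v)

/-- The mean of the stochastic policy gradient from `s`. -/
noncomputable def gradFrom (M : Model S A dv dw) (γ : ℝ) (T : ℕ) (v : Vec dv) (w : Vec dw) (s : S) :
    Vec dv :=
  ∫ O : Traj S A T, M.stochPolGrad γ v w O ∂(M.rollout v T s)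

namespace PolicyRegular

variable {Rπ Lπ' Lπ : ℝ}

/-- Directional derivatives are pointwise limits of difference quotients of `log π`, which are
measurable in `(s, a)`; the score is assembled from its coordinates. -/
theorem measurable_score (h : M.PolicyRegular Rπ Lπ' Lπ) (v : Vec dv) :
    Measurable (Function.uncurry (M.score v)) := by
  have key : ∀ e : Vec dv, Measurable (fun q : S × A => inner ℝ e (M.score v q.1 q.2)) := by
    intro e
    refine measurable_of_tendsto_metrizable (f := fun (n : ℕ) (q : S × A) =>
      (n : ℝ) • (Real.log (M.pol (v + (n : ℝ)⁻¹ • e) q.1 q.2) - Real.log (M.pol v q.1 q.2)))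
      (fun n => ?_) (tendsto_pi_nhds.2 fun q => ?_)
    · have h1 := (M.measurable_pol (v + (n : ℝ)⁻¹ • e)).log
      have h2 := (M.measurable_pol v).log
      exact (h1.sub h2).const_smul (n : ℝ)
    · have h1 : HasFDerivAt (fun u => Real.log (M.pol u q.1 q.2))
          (InnerProductSpace.toDual ℝ (Vec dv) (M.score v q.1 q.2)) v :=
        (h.differentiable q.1 q.2 v).hasGradientAt
      have h2 := (h1.lim_real e).comp tendsto_natCast_atTop_atTop
      rw [InnerProductSpace.toDual_apply_apply, real_inner_comm] at h2
      exact h2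
  have e : Function.uncurry (M.score v) = fun q : S × A =>
      ∑ i, inner ℝ (EuclideanSpace.basisFun (Fin dv) ℝ i) (M.score v q.1 q.2)
        • EuclideanSpace.basisFun (Fin dv) ℝ i := by
    funext q
    exact ((EuclideanSpace.basisFun (Fin dv) ℝ).sum_repr' _).symm
  rw [e]
  exact Finset.measurable_sum _ fun i _ => (key _).smul_const _

/-- A Carathéodory argument: the score is continuous in `v`, being Lipschitz, and measurable in `(s,
a)`. -/
theorem measurable_score_joint (h : M.PolicyRegular Rπ Lπ' Lπ) :
    Measurable (fun q : Vec dv × S × A => M.score q.1 q.2.1 q.2.2) := by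
  refine measurable_uncurry_of_continuous_of_measurable
    (u := fun (v : Vec dv) (q : S × A) => M.score v q.1 q.2) (fun q => ?_)
    (fun v => h.measurable_score v)
  refine (LipschitzWith.of_dist_le_mul (K := Lπ'.toNNReal) fun v v' => ?_).continuous
  rw [dist_eq_norm, dist_eq_norm]
  exact (h.score_lip v v' q.1 q.2).trans (by gcongr; exact Real.le_coe_toNNReal _)

theorem measurable_hfun_joint (h : M.PolicyRegular Rπ Lπ' Lπ) (γ : ℝ) :
    Measurable (fun q : (Vec dv × Vec dw) × Obs S A => M.hfun γ q.1.1 q.1.2 q.2) := by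
  have h1 : Measurable (fun q : (Vec dv × Vec dw) × Obs S A =>
      M.score q.1.1 q.2.1 q.2.2.1) := h.measurable_score_joint.comp
    ((measurable_fst.comp measurable_fst).prodMk
      ((measurable_fst.comp measurable_snd).prodMk
        (measurable_fst.comp (measurable_snd.comp measurable_snd))))
  have h2 : Measurable (fun q : (Vec dv × Vec dw) × Obs S A => M.reward q.2.1 q.2.2.1) :=
    M.measurable_reward_obs.comp measurable_snd
  have h3 := M.measurable_feat
  have h4 : Measurable (fun q : (Vec dv × Vec dw) × Obs S A => M.reward q.2.1 q.2.2.1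
      + inner ℝ (γ • M.feat q.2.2.2 - M.feat q.2.1) q.1.2) := h2.add (by fun_prop)
  exact h4.smul h1

theorem measurable_hfun (h : M.PolicyRegular Rπ Lπ' Lπ) (γ : ℝ) (v : Vec dv) (w : Vec dw) :
    Measurable (M.hfun γ v w) := by
  have hp : Measurable (fun o : Obs S A => ((v, w), o)) := measurable_prodMk_left
  exact (h.measurable_hfun_joint γ).comp hp

theorem measurable_stochPolGrad_joint (h : M.PolicyRegular Rπ Lπ' Lπ) (γ : ℝ) (T : ℕ) :
    Measurable (fun q : (Vec dv × Vec dw) × Traj S A T => M.stochPolGrad γ q.1.1 q.1.2 q.2) := by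
  have h1 : ∀ t : Fin T, Measurable (fun q : (Vec dv × Vec dw) × Traj S A T =>
      γ ^ (t : ℕ) • M.hfun γ q.1.1 q.1.2 (q.2 t)) := fun t => by
    have hp : Measurable (fun q : (Vec dv × Vec dw) × Traj S A T => (q.1, q.2 t)) := by fun_prop
    exact ((h.measurable_hfun_joint γ).comp hp).const_smul (γ ^ (t : ℕ))
  exact (Finset.measurable_sum Finset.univ fun t _ => h1 t).const_smul (1 - γ)

theorem measurable_stochPolGrad (h : M.PolicyRegular Rπ Lπ' Lπ) (γ : ℝ) (T : ℕ) (v : Vec dv)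
    (w : Vec dw) : Measurable (fun O : Traj S A T => M.stochPolGrad γ v w O) := by
  have h1 : ∀ t : Fin T, Measurable (fun O : Traj S A T => γ ^ (t : ℕ) • M.hfun γ v w (O t)) :=
    fun t => ((h.measurable_hfun γ v w).comp (measurable_pi_apply t)).const_smul (γ ^ (t : ℕ))
  exact (Finset.measurable_sum Finset.univ fun t _ => h1 t).const_smul (1 - γ)

end PolicyRegular

theorem measurable_semiGrad_joint (M : Model S A dv dw) (γ : ℝ) {T : ℕ} [NeZero T] :
    Measurable (fun q : Vec dw × Traj S A T => M.semiGrad γ q.1 q.2) := by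
  have h1 := M.measurable_feat
  have h2 : Measurable (fun O : Traj S A T =>
      ∑ t : Fin T, γ ^ (t : ℕ) * M.reward (O t).1 (O t).2.1) :=
    Finset.measurable_sum _ fun t _ =>
      ((M.measurable_reward_obs.comp (measurable_pi_apply t)).const_mul _)
  have h3 : Measurable (fun q : Vec dw × Traj S A T =>
      (∑ t : Fin T, γ ^ (t : ℕ) * M.reward (q.2 t).1 (q.2 t).2.1) • M.feat (firstState q.2)) :=
    (h2.comp measurable_snd).smul (by fun_prop)
  have h4 : Measurable (fun q : Vec dw × Traj S A T =>
      (inner ℝ (M.feat (firstState q.2) - γ ^ T • M.feat (lastState q.2)) q.1)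
        • M.feat (firstState q.2)) := by fun_prop
  exact h4.sub h3

namespace Standing

theorem abs_td_le (h : M.Standing μ p) (w : Vec dw) (o : Obs S A) :
    |inner ℝ (p.γ • M.feat o.2.2 - M.feat o.1) w| ≤ (1 + p.γ) * ‖w‖ := by
  have := M.abs_inner_feat_sub_le h.adm.γ_pos.le 1 o.1 o.2.2 w
  rw [pow_one, ← neg_sub, inner_neg_left, abs_neg] at this
  exact this

theorem norm_hfun_le (h : M.Standing μ p) (v : Vec dv) {w : Vec dw} (hw : ‖w‖ ≤ p.Rw)
    (o : Obs S A) : ‖M.hfun p.γ v w o‖ ≤ p.gradBound := by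
  have hγ := h.adm.γ_pos
  rw [hfun, norm_smul, mul_comm]
  refine mul_le_mul (h.policy.score_bound _ _ _) ?_ (norm_nonneg _) h.adm.Rπ_nonneg
  refine (abs_add_le _ _).trans (add_le_add (h.reward_le _ _) ((h.abs_td_le w o).trans ?_))
  gcongr

theorem norm_hfun_sub_le (h : M.Standing μ p) (v v' : Vec dv) {w : Vec dw} (hw : ‖w‖ ≤ p.Rw)
    (o : Obs S A) : ‖M.hfun p.γ v w o - M.hfun p.γ v' w o‖ ≤ p.tdBound * p.Lπ' * ‖v - v'‖ := by
  have hγ := h.adm.γ_pos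
  rw [hfun, hfun, ← smul_sub, norm_smul, mul_assoc]
  refine mul_le_mul ?_ (h.policy.score_lip _ _ _ _) (norm_nonneg _) h.adm.tdBound_nonneg
  refine (abs_add_le _ _).trans (add_le_add (h.reward_le _ _) ((h.abs_td_le w o).trans ?_))
  gcongr

theorem norm_hfun_sub_le' (h : M.Standing μ p) (v : Vec dv) (w w' : Vec dw) (o : Obs S A) :
    ‖M.hfun p.γ v w o - M.hfun p.γ v w' o‖ ≤ (1 + p.γ) * p.Rπ * ‖w - w'‖ := by
  have hγ := h.adm.γ_pos
  rw [hfun, hfun, ← sub_smul, norm_smul, add_sub_add_left_eq_sub, ← inner_sub_right]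
  calc _ ≤ ((1 + p.γ) * ‖w - w'‖) * p.Rπ :=
        mul_le_mul (h.abs_td_le _ o) (h.policy.score_bound _ _ _) (norm_nonneg _) (by positivity)
    _ = _ := by ring

theorem norm_stochPolGrad_le (h : M.Standing μ p) {T : ℕ} (v : Vec dv) {w : Vec dw}
    (hw : ‖w‖ ≤ p.Rw) (O : Traj S A T) : ‖M.stochPolGrad p.γ v w O‖ ≤ p.gradBound := by
  have hγ := h.adm.γ_pos.le
  have h1 : 0 ≤ 1 - p.γ := by linarith [h.adm.γ_lt]
  have hH := h.adm.gradBound_nonneg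
  rw [stochPolGrad, norm_smul, Real.norm_of_nonneg h1]
  calc _ ≤ (1 - p.γ) * ∑ t : Fin T, p.γ ^ (t : ℕ) * p.gradBound := by
        gcongr
        refine (norm_sum_le _ _).trans (Finset.sum_le_sum fun t _ => ?_)
        rw [norm_smul, Real.norm_of_nonneg (by positivity)]
        gcongr
        exact h.norm_hfun_le v hw _
    _ = (1 - p.γ ^ T) * p.gradBound := by rw [← Finset.sum_mul, ← mul_assoc, one_sub_mul_sum_pow]
    _ ≤ _ := mul_le_of_le_one_left hH (by linarith [pow_nonneg hγ T])

theorem gradFrom_eq (h : M.Standing μ p) (T : ℕ) (v : Vec dv) {w : Vec dw}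
    (hw : ‖w‖ ≤ p.Rw) (s : S) : M.gradFrom p.γ T v w s
      = (1 - p.γ) • ∑ t : Fin T, p.γ ^ (t : ℕ) •
          ∫ o, M.hfun p.γ v w o ∂((M.obsKernel v ∘ₖ (M.stateKernel v ^ (t : ℕ))) s) := by
  have hm := h.policy.measurable_hfun p.γ v w
  have hi : ∀ t : Fin T, Integrable (fun O : Traj S A T => M.hfun p.γ v w (O t))
      (M.rollout v T s) := fun t => integrable_of_bound _ (hm.comp (measurable_pi_apply t))
    (fun O => h.norm_hfun_le v hw _)
  simp only [gradFrom, stochPolGrad]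
  have hi' : ∀ t : Fin T, Integrable (fun O : Traj S A T => p.γ ^ (t : ℕ) • M.hfun p.γ v w (O t))
      (M.rollout v T s) := fun t => (hi t).smul (p.γ ^ (t : ℕ))
  rw [integral_smul, integral_finsetSum _ fun t _ => hi' t]
  simp only [integral_smul, fun t : Fin T => M.integral_rollout_apply v T t s hm]

theorem integral_obs_pow_eq (h : M.Standing μ p) (v : Vec dv) {w : Vec dw}
    (hw : ‖w‖ ≤ p.Rw) (t : ℕ) (s : S) :
    ∫ o, M.hfun p.γ v w o ∂((M.obsKernel v ∘ₖ (M.stateKernel v ^ t)) s)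
      = ∫ x, M.hFrom p.γ v w x ∂((M.stateKernel v ^ t) s) := by
  rw [Kernel.comp_apply, integral_bind _ _
    (integrable_of_bound _ (h.policy.measurable_hfun p.γ v w) (h.norm_hfun_le v hw))]
  rfl

theorem measurable_hFrom (h : M.Standing μ p) (v : Vec dv) (w : Vec dw) :
    Measurable (M.hFrom p.γ v w) :=
  ((h.policy.measurable_hfun p.γ v w).stronglyMeasurable.integral_kernel).measurable

theorem measurable_gradFrom (h : M.Standing μ p) (T : ℕ) (v : Vec dv) (w : Vec dw) :
    Measurable (M.gradFrom p.γ T v w) :=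
  ((h.policy.measurable_stochPolGrad p.γ T v w).stronglyMeasurable.integral_kernel).measurable

theorem norm_hFrom_le (h : M.Standing μ p) (v : Vec dv) {w : Vec dw} (hw : ‖w‖ ≤ p.Rw) (s : S) :
    ‖M.hFrom p.γ v w s‖ ≤ p.gradBound :=
  norm_integral_le_of_bound _ (h.norm_hfun_le v hw)

theorem norm_meanGrad_le (h : M.Standing μ p) (v : Vec dv) {w : Vec dw} (hw : ‖w‖ ≤ p.Rw) :
    ‖M.meanGrad μ p.γ v w‖ ≤ p.gradBound := by
  have := h.ergodic.prob v
  exact norm_integral_le_of_bound _ (h.norm_hFrom_le v hw)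

theorem norm_gradFrom_le (h : M.Standing μ p) (T : ℕ) (v : Vec dv) {w : Vec dw}
    (hw : ‖w‖ ≤ p.Rw) (s : S) : ‖M.gradFrom p.γ T v w s‖ ≤ p.gradBound :=
  norm_integral_le_of_bound _ (h.norm_stochPolGrad_le v hw)

theorem integral_integral_obs_pow (h : M.Standing μ p) (v : Vec dv) {w : Vec dw}
    (hw : ‖w‖ ≤ p.Rw) (t : ℕ) :
    ∫ s, ∫ o, M.hfun p.γ v w o ∂((M.obsKernel v ∘ₖ (M.stateKernel v ^ t)) s) ∂(μ v)
      = M.meanGrad μ p.γ v w := by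
  simp only [h.integral_obs_pow_eq v hw t]
  exact h.integral_pow_invariant v t (h.measurable_hFrom v w) (h.norm_hFrom_le v hw)

theorem measurable_integral_obs_pow (h : M.Standing μ p) (v : Vec dv) (w : Vec dw) (t : ℕ) :
    Measurable (fun s =>
      ∫ o, M.hfun p.γ v w o ∂((M.obsKernel v ∘ₖ (M.stateKernel v ^ t)) s)) :=
  ((h.policy.measurable_hfun p.γ v w).stronglyMeasurable.integral_kernel).measurable

/-- Started from `μ_v`, every observation has the same law, so the discounted sum collapses to its
total weight `1 - γ^T` times the one-step mean. -/
theorem integral_gradFrom (h : M.Standing μ p) (T : ℕ) (v : Vec dv) {w : Vec dw}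
    (hw : ‖w‖ ≤ p.Rw) :
    ∫ s, M.gradFrom p.γ T v w s ∂(μ v) = (1 - p.γ ^ T) • M.meanGrad μ p.γ v w := by
  have := h.ergodic.prob v
  simp only [h.gradFrom_eq T v hw]
  rw [integral_smul, integral_finsetSum]
  · simp only [integral_smul, h.integral_integral_obs_pow v hw]
    rw [← Finset.sum_smul, smul_smul, one_sub_mul_sum_pow]
  · intro t _
    exact (integrable_of_bound (μ v) (h.measurable_integral_obs_pow v w t)
      (fun s => norm_integral_le_of_bound _ (h.norm_hfun_le v hw))).smul (p.γ ^ (t : ℕ))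

/-- Under stationarity all terms of the infinite sum share one mean and the weights `(1 - γ)γ^t` add
up to one. Thus `∇J` is the value at `w*_v` of the same `meanGrad` that governs the finite rollout.
-/
theorem polGrad_eq (h : M.Standing μ p) (T : ℕ) [NeZero T] (v : Vec dv)
    (hw : ‖M.optCritic μ p.γ T v‖ ≤ p.Rw) :
    M.polGrad μ p.γ T v = M.meanGrad μ p.γ v (M.optCritic μ p.γ T v) := by
  have := h.ergodic.prob v
  have hγ := h.adm.γ_pos.le
  have hγ1 := h.adm.γ_lt
  set w := M.optCritic μ p.γ T v with hwdef
  have hb : ∀ t s, ‖∫ o, M.hfun p.γ v w o ∂((M.obsKernel v ∘ₖ (M.stateKernel v ^ t)) s)‖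
      ≤ p.gradBound := fun t s => norm_integral_le_of_bound _ (h.norm_hfun_le v hw)
  have hi : ∀ t, Integrable (fun s =>
      p.γ ^ t • ∫ o, M.hfun p.γ v w o ∂((M.obsKernel v ∘ₖ (M.stateKernel v ^ t)) s)) (μ v) :=
    fun t => (integrable_of_bound (μ v) (h.measurable_integral_obs_pow v w t) (hb t)).smul (p.γ ^ t)
  have hs : Summable (fun t : ℕ => ∫ s, ‖p.γ ^ t •
      ∫ o, M.hfun p.γ v w o ∂((M.obsKernel v ∘ₖ (M.stateKernel v ^ t)) s)‖ ∂(μ v)) := by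
    refine Summable.of_nonneg_of_le (fun t => integral_nonneg fun s => norm_nonneg _) (fun t => ?_)
      ((summable_geometric_of_lt_one hγ hγ1).mul_right p.gradBound)
    refine (le_abs_self _).trans (abs_integral_le_of_bound _ fun s => ?_)
    rw [abs_of_nonneg (norm_nonneg _), norm_smul, Real.norm_of_nonneg (by positivity)]
    gcongr
    exact hb t s
  rw [polGrad]
  simp only [polGradFrom]
  rw [integral_smul, ← integral_tsum_of_summable_integral_norm hi hs]
  simp only [integral_smul, h.integral_integral_obs_pow v hw]
  rw [(summable_geometric_of_lt_one hγ hγ1).tsum_smul_const, tsum_geometric_of_lt_one hγ hγ1,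
    smul_smul, mul_inv_cancel₀ (by linarith), one_smul]

theorem norm_meanGrad_sub_le (h : M.Standing μ p) (v v' : Vec dv) {w : Vec dw}
    (hw : ‖w‖ ≤ p.Rw) :
    ‖M.meanGrad μ p.γ v w - M.meanGrad μ p.γ v' w‖ ≤ p.meanGradLip * ‖v - v'‖ := by
  have hH := h.adm.gradBound_nonneg
  have h1 : ∀ s, ‖M.hFrom p.γ v w s - M.hFrom p.γ v' w s‖
      ≤ (p.tdBound * p.Lπ' + p.ell * p.gradBound) * ‖v - v'‖ := fun s =>
    ((h.obs s).norm_integral_sub_le h.adm.ell_nonneg hH (h.policy.measurable_hfun p.γ v w)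
      (h.policy.measurable_hfun p.γ v' w) (h.norm_hfun_le v hw)
      (h.norm_hfun_sub_le v v' hw) v v').trans_eq (by ring)
  refine (h.stationary.norm_integral_sub_le h.adm.statLip_nonneg hH (h.measurable_hFrom v w)
    (h.measurable_hFrom v' w) (h.norm_hFrom_le v hw) h1 v v').trans_eq ?_
  unfold Params.meanGradLip; ring

theorem norm_meanGrad_sub_le' (h : M.Standing μ p) (v : Vec dv) {w w' : Vec dw}
    (hw : ‖w‖ ≤ p.Rw) (hw' : ‖w'‖ ≤ p.Rw) :
    ‖M.meanGrad μ p.γ v w - M.meanGrad μ p.γ v w'‖ ≤ (1 + p.γ) * p.Rπ * ‖w - w'‖ := by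
  have := h.ergodic.prob v
  have hi : ∀ {w : Vec dw}, ‖w‖ ≤ p.Rw → Integrable (M.hFrom p.γ v w) (μ v) := fun {w} hw =>
    integrable_of_bound _ (h.measurable_hFrom v w) (h.norm_hFrom_le v hw)
  have hi' : ∀ {w : Vec dw} (s : S), ‖w‖ ≤ p.Rw → Integrable (M.hfun p.γ v w) (M.obsKernel v s) :=
    fun {w} s hw => integrable_of_bound _ (h.policy.measurable_hfun p.γ v w) (h.norm_hfun_le v hw)
  rw [meanGrad, meanGrad, ← integral_sub (hi hw) (hi hw')]
  refine norm_integral_le_of_bound _ fun s => ?_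
  rw [hFrom, hFrom, ← integral_sub (hi' s hw) (hi' s hw')]
  exact norm_integral_le_of_bound _ fun o => h.norm_hfun_sub_le' v w w' o

/-- The law of the observation at time `t` has Lipschitz constant of order `t + 1`. Dominating this
by `(t + 1)²` lets the series `geo` serve once more, so the constant is free of `T`. -/
theorem norm_gradFrom_sub_le (h : M.Standing μ p) (T : ℕ) (v v' : Vec dv) {w : Vec dw}
    (hw : ‖w‖ ≤ p.Rw) (s : S) :
    ‖M.gradFrom p.γ T v w s - M.gradFrom p.γ T v' w s‖ ≤ p.gradFromLip * ‖v - v'‖ := by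
  have hγ := h.adm.γ_pos.le
  have h1 : 0 ≤ 1 - p.γ := by linarith [h.adm.γ_lt]
  have hH := h.adm.gradBound_nonneg
  have hl := h.adm.ell_nonneg
  have htd := h.adm.tdBound_nonneg
  have hL' := h.adm.Lπ'_nonneg
  rw [h.gradFrom_eq T v hw, h.gradFrom_eq T v' hw, ← smul_sub, ← Finset.sum_sub_distrib,
    norm_smul, Real.norm_of_nonneg h1]
  set K := p.tdBound * p.Lπ' + p.ell * p.gradBound with hK
  have hK0 : 0 ≤ K := by positivity
  calc _ ≤ 1 * ∑ t : Fin T, p.γ ^ (t : ℕ) * (((t : ℕ) : ℝ) + 1) ^ 2 * (K * ‖v - v'‖) := by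
        gcongr
        · linarith
        refine (norm_sum_le _ _).trans (Finset.sum_le_sum fun t _ => ?_)
        rw [← smul_sub, norm_smul, Real.norm_of_nonneg (by positivity), mul_assoc]
        gcongr
        refine ((h.obs_pow (t : ℕ) s).norm_integral_sub_le (by positivity) hH
          (h.policy.measurable_hfun p.γ v w) (h.policy.measurable_hfun p.γ v' w)
          (h.norm_hfun_le v hw) (h.norm_hfun_sub_le v v' hw) v v').trans ?_
        have ht : (0 : ℝ) ≤ ((t : ℕ) : ℝ) := Nat.cast_nonneg _
        have a1 : (1 : ℝ) ≤ (((t : ℕ) : ℝ) + 1) ^ 2 := by nlinarith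
        have a2 : ((t : ℕ) : ℝ) + 1 ≤ (((t : ℕ) : ℝ) + 1) ^ 2 := by nlinarith
        calc _ = (1 * (p.tdBound * p.Lπ') + (((t : ℕ) : ℝ) + 1) * (p.ell * p.gradBound))
              * ‖v - v'‖ := by ring
          _ ≤ ((((t : ℕ) : ℝ) + 1) ^ 2 * (p.tdBound * p.Lπ')
              + (((t : ℕ) : ℝ) + 1) ^ 2 * (p.ell * p.gradBound)) * ‖v - v'‖ := by gcongr
          _ = _ := by rw [hK]; ring
    _ ≤ p.geo * (K * ‖v - v'‖) := by
        rw [one_mul, ← Finset.sum_mul]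
        exact mul_le_mul_of_nonneg_right (h.adm.sum_le_geo T) (by positivity)
    _ = _ := by unfold Params.gradFromLip; ring

theorem norm_stochPolGrad_sub_le (h : M.Standing μ p) {T : ℕ} (v : Vec dv) (w w' : Vec dw)
    (O : Traj S A T) : ‖M.stochPolGrad p.γ v w O - M.stochPolGrad p.γ v w' O‖
      ≤ (1 + p.γ) * p.Rπ * ‖w - w'‖ := by
  have hγ := h.adm.γ_pos.le
  have h1 : 0 ≤ 1 - p.γ := by linarith [h.adm.γ_lt]
  have hR := h.adm.Rπ_nonneg
  rw [stochPolGrad, stochPolGrad, ← smul_sub, ← Finset.sum_sub_distrib, norm_smul,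
    Real.norm_of_nonneg h1]
  calc _ ≤ (1 - p.γ) * ∑ t : Fin T, p.γ ^ (t : ℕ) * ((1 + p.γ) * p.Rπ * ‖w - w'‖) := by
        gcongr
        refine (norm_sum_le _ _).trans (Finset.sum_le_sum fun t _ => ?_)
        rw [← smul_sub, norm_smul, Real.norm_of_nonneg (by positivity)]
        gcongr
        exact h.norm_hfun_sub_le' v w w' _
    _ = (1 - p.γ ^ T) * ((1 + p.γ) * p.Rπ * ‖w - w'‖) := by
        rw [← Finset.sum_mul, ← mul_assoc, one_sub_mul_sum_pow]
    _ ≤ _ := mul_le_of_le_one_left (by positivity) (by linarith [pow_nonneg hγ T])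

theorem norm_gradFrom_sub_le' (h : M.Standing μ p) (T : ℕ) (v : Vec dv) {w w' : Vec dw}
    (hw : ‖w‖ ≤ p.Rw) (hw' : ‖w'‖ ≤ p.Rw) (s : S) :
    ‖M.gradFrom p.γ T v w s - M.gradFrom p.γ T v w' s‖ ≤ (1 + p.γ) * p.Rπ * ‖w - w'‖ := by
  have hi : ∀ {w : Vec dw}, ‖w‖ ≤ p.Rw →
      Integrable (fun O : Traj S A T => M.stochPolGrad p.γ v w O) (M.rollout v T s) :=
    fun {w} hw => integrable_of_bound _
      (h.policy.measurable_stochPolGrad p.γ T v w)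
      (h.norm_stochPolGrad_le v hw)
  rw [gradFrom, gradFrom, ← integral_sub (hi hw) (hi hw')]
  exact norm_integral_le_of_bound _ fun O => h.norm_stochPolGrad_sub_le v w w' O

end Standing

end Model

/-! ### The projection onto a ball -/

/-- This form has no case distinction and makes continuity of the projection immediate. -/
theorem projBall_eq {d : ℕ} {R : ℝ} (hR : 0 < R) (x : Vec d) :
    projBall R x = (R / max R ‖x‖) • x := by
  unfold projBall
  split_ifs with h
  · rw [max_eq_left h, div_self hR.ne', one_smul]
  · rw [max_eq_right (not_le.1 h).le]

theorem continuous_projBall {d : ℕ} {R : ℝ} (hR : 0 < R) :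
    Continuous (projBall R : Vec d → Vec d) := by
  have : (projBall R : Vec d → Vec d) = fun x => (R / max R ‖x‖) • x := funext (projBall_eq hR)
  rw [this]
  exact (continuous_const.div (continuous_const.max continuous_norm)
    (fun x => (lt_max_of_lt_left hR).ne')).smul continuous_id

theorem norm_projBall_le {d : ℕ} {R : ℝ} (hR : 0 ≤ R) (x : Vec d) : ‖projBall R x‖ ≤ R := by
  unfold projBall
  split_ifs with h
  · exact h
  · have hx : 0 < ‖x‖ := hR.trans_lt (not_le.1 h)
    rw [norm_smul, Real.norm_of_nonneg (by positivity), div_mul_cancel₀ _ hx.ne']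

theorem projBall_of_norm_le {d : ℕ} {R : ℝ} {x : Vec d} (hx : ‖x‖ ≤ R) : projBall R x = x :=
  if_pos hx

theorem norm_projBall_sub_le {d : ℕ} {R : ℝ} (x : Vec d) {y : Vec d} (hy : ‖y‖ ≤ R) :
    ‖projBall R x - y‖ ≤ ‖x - y‖ := by
  have hR : 0 ≤ R := (norm_nonneg y).trans hy
  unfold projBall
  split_ifs with h
  · exact le_rfl
  · have hx : R < ‖x‖ := not_le.1 h
    have hx0 : 0 < ‖x‖ := hR.trans_lt hx
    set c := R / ‖x‖ with hc
    have hc1 : c ≤ 1 := (div_le_one hx0).2 hx.le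
    have hcR : c * ‖x‖ = R := div_mul_cancel₀ _ hx0.ne'
    refine le_of_sq_le_sq ?_ (norm_nonneg _)
    rw [norm_sub_sq_real, norm_sub_sq_real, norm_smul, real_inner_smul_left,
      Real.norm_of_nonneg (by positivity)]
    have h1 : inner ℝ x y ≤ ‖x‖ * (c * ‖x‖) :=
      (real_inner_le_norm x y).trans (by rw [hcR]; gcongr)
    -- The claim is `2(1 - c)⟨x, y⟩ ≤ (1 - c²)‖x‖²`. Inserting `h1` leaves a slack of `(1 -
    -- c)²‖x‖²`.
    nlinarith [mul_nonneg (sub_nonneg.2 hc1) (sub_nonneg.2 h1),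
      mul_nonneg (mul_nonneg (sub_nonneg.2 hc1) (sub_nonneg.2 hc1)) (sq_nonneg ‖x‖)]

/-! ### Runs of the algorithm -/

/-- The step sizes, the initial values and the sampled trajectories of a run. -/
structure Run (S A Ω : Type*) (dw T : ℕ) where
  (α β η : ℝ)
  w₀ : Vec dw
  s₀ : Ω → S
  O : ℕ → Ω → Traj S A T

namespace Run

variable {S A Ω : Type*} [MeasurableSpace S] [MeasurableSpace A] {dv dw T : ℕ} [NeZero T]

/-- The actor iterate. -/
noncomputable def v (R : Run S A Ω dw T) (M : Model S A dv dw) (p : Params) (k : ℕ) (ω : Ω) :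
    Vec dv :=
  M.actor p.γ p.Rw R.α R.β R.η 0 R.w₀ (fun j => R.O j ω) k

/-- The critic iterate. -/
noncomputable def w (R : Run S A Ω dw T) (M : Model S A dv dw) (p : Params) (k : ℕ) (ω : Ω) :
    Vec dw :=
  M.critic p.γ p.Rw R.α R.β R.η 0 R.w₀ (fun j => R.O j ω) k

/-- The momentum `n_{k-1}`. -/
noncomputable def n (R : Run S A Ω dw T) (M : Model S A dv dw) (p : Params) (k : ℕ) (ω : Ω) :
    Vec dw :=
  (M.iter p.γ p.Rw R.α R.β R.η 0 R.w₀ (fun j => R.O j ω) k).2.2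

/-- The state in which frame `k` starts. -/
def s {S A Ω : Type*} {dw T : ℕ} [NeZero T] (R : Run S A Ω dw T) (k : ℕ) (ω : Ω) : S :=
  Model.frameStart (R.s₀ ω) (fun j => R.O j ω) k

/-- The stochastic semi-gradient of frame `k`. -/
noncomputable def g (R : Run S A Ω dw T) (M : Model S A dv dw) (p : Params) (k : ℕ) (ω : Ω) :
    Vec dw :=
  M.semiGrad p.γ (R.w M p k ω) (R.O k ω)

/-- The stochastic policy gradient of frame `k`. -/
noncomputable def h (R : Run S A Ω dw T) (M : Model S A dv dw) (p : Params) (k : ℕ) (ω : Ω) :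
    Vec dv :=
  M.stochPolGrad p.γ (R.v M p k ω) (R.w M p k ω) (R.O k ω)

variable (R : Run S A Ω dw T) (M : Model S A dv dw) (p : Params)

theorem n_zero (ω : Ω) : R.n M p 0 ω = 0 := rfl

theorem v_succ (k : ℕ) (ω : Ω) : R.v M p (k + 1) ω = R.v M p k ω + R.α • R.h M p k ω := rfl

theorem n_succ (k : ℕ) (ω : Ω) :
    R.n M p (k + 1) ω = (1 - R.η) • R.n M p k ω + R.η • R.g M p k ω := rfl

theorem w_succ (k : ℕ) (ω : Ω) :
    R.w M p (k + 1) ω = projBall p.Rw (R.w M p k ω - R.β • R.n M p (k + 1) ω) := rfl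

theorem s_succ {S A Ω : Type*} {dw T : ℕ} [NeZero T] (R : Run S A Ω dw T) (k : ℕ) (ω : Ω) :
    R.s (k + 1) ω = Model.lastState (R.O k ω) := rfl

/-- Standing assumptions on a run. -/
structure Valid {mΩ : MeasurableSpace Ω} (R : Run S A Ω dw T) (M : Model S A dv dw)
    (μ : Vec dv → Measure S) (p : Params) (P : Measure Ω) (ℱ : Filtration ℕ mΩ) : Prop where
  prob : IsProbabilityMeasure P
  std : M.Standing μ p
  opt_le : ∀ v, ‖M.optCritic μ p.γ T v‖ ≤ p.Rw
  α_pos : 0 < R.α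
  β_pos : 0 < R.β
  η_pos : 0 < R.η
  η_le : R.η ≤ 1
  mix_le : p.c₀ * p.ρ ^ T ≤ R.β
  w₀_le : ‖R.w₀‖ ≤ p.Rw
  samples : Model.Samples P ℱ M p.γ p.Rw R.α R.β R.η 0 R.w₀ R.s₀ R.O
  start : tvNorm (P.map R.s₀) (μ 0) ≤ p.c₀ * p.ρ ^ T

/-- The bound on the semi-gradient. -/
noncomputable def _root_.HBA2C.Params.semiBound (p : Params) (T : ℕ) : ℝ := Rg p.γ p.Rr p.Rw T

theorem _root_.HBA2C.Params.Admissible.geom_nonneg {p : Params} (h : p.Admissible) (T : ℕ) :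
    0 ≤ (1 - p.γ ^ T) / (1 - p.γ) :=
  div_nonneg (sub_nonneg.2 (h.pow_le_one T)) (by linarith [h.γ_lt])

theorem _root_.HBA2C.Params.Admissible.semiBound_nonneg {p : Params} (h : p.Admissible) (T : ℕ) :
    0 ≤ p.semiBound T := by
  have := h.geom_nonneg T; have := h.γ_pos; have := h.Rw_pos; have := h.Rr_nonneg
  unfold Params.semiBound Rg; positivity

namespace Valid

variable {mΩ : MeasurableSpace Ω} {R : Run S A Ω dw T} {M : Model S A dv dw}
  {μ : Vec dv → Measure S} {p : Params} {P : Measure Ω} {ℱ : Filtration ℕ mΩ}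

theorem norm_w_le (hR : R.Valid M μ p P ℱ) (k : ℕ) (ω : Ω) : ‖R.w M p k ω‖ ≤ p.Rw := by
  cases k with
  | zero => exact hR.w₀_le
  | succ k => rw [w_succ]; exact norm_projBall_le hR.std.adm.Rw_pos.le _

theorem norm_g_le (hR : R.Valid M μ p P ℱ) (k : ℕ) (ω : Ω) :
    ‖R.g M p k ω‖ ≤ p.semiBound T := by
  have := hR.std.adm.γ_pos
  refine (hR.std.norm_semiGrad_le _ _).trans ?_
  unfold Params.semiBound Rg
  gcongr
  exact hR.norm_w_le k ω

theorem norm_n_le (hR : R.Valid M μ p P ℱ) (k : ℕ) (ω : Ω) :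
    ‖R.n M p k ω‖ ≤ p.semiBound T := by
  have h1 : 0 ≤ 1 - R.η := sub_nonneg.2 hR.η_le
  induction k with
  | zero => rw [n_zero, norm_zero]; exact hR.std.adm.semiBound_nonneg T
  | succ k ih =>
    rw [n_succ]
    calc _ ≤ _ := norm_add_le _ _
      _ = (1 - R.η) * ‖R.n M p k ω‖ + R.η * ‖R.g M p k ω‖ := by
          rw [norm_smul, norm_smul, Real.norm_of_nonneg h1, Real.norm_of_nonneg hR.η_pos.le]
      _ ≤ (1 - R.η) * p.semiBound T + R.η * p.semiBound T := by
          have := hR.η_pos.le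
          gcongr
          exact hR.norm_g_le k ω
      _ = _ := by ring

theorem norm_v_sub_le (hR : R.Valid M μ p P ℱ) (k : ℕ) (ω : Ω) :
    ‖R.v M p (k + 1) ω - R.v M p k ω‖ ≤ R.α * p.gradBound := by
  have := hR.α_pos.le
  rw [v_succ, add_sub_cancel_left, norm_smul, Real.norm_of_nonneg this]
  gcongr
  exact hR.std.norm_stochPolGrad_le _ (hR.norm_w_le k ω) _

theorem norm_w_sub_le (hR : R.Valid M μ p P ℱ) (k : ℕ) (ω : Ω) :
    ‖R.w M p (k + 1) ω - R.w M p k ω‖ ≤ R.β * p.semiBound T := by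
  have := hR.β_pos.le
  rw [w_succ]
  refine (norm_projBall_sub_le _ (hR.norm_w_le k ω)).trans ?_
  rw [sub_sub_cancel_left, norm_neg, norm_smul, Real.norm_of_nonneg this]
  gcongr
  exact hR.norm_n_le _ ω

end Valid

end Run

/-! ### Measurability of the iterates -/

theorem Model.measurable_iter {S A Ω : Type*} [MeasurableSpace S] [MeasurableSpace A]
    [MeasurableSpace Ω] {dv dw T : ℕ} [NeZero T] {M : Model S A dv dw} {Rπ Lπ' Lπ : ℝ}
    (hM : M.PolicyRegular Rπ Lπ' Lπ) (γ : ℝ) {Rw : ℝ} (hRw : 0 < Rw) (α β η : ℝ) (v₀ : Vec dv)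
    (w₀ : Vec dw) {O : ℕ → Ω → Traj S A T} (k : ℕ) (hO : ∀ j < k, Measurable (O j)) :
    Measurable (fun ω => M.iter γ Rw α β η v₀ w₀ (fun j => O j ω) k) := by
  induction k with
  | zero => exact measurable_const
  | succ k ih =>
    have h0 := ih fun j hj => hO j (hj.trans (Nat.lt_succ_self k))
    have hOk := hO k (Nat.lt_succ_self k)
    set I := fun ω => M.iter γ Rw α β η v₀ w₀ (fun j => O j ω) k with hI
    have hv : Measurable (fun ω => (I ω).1) := measurable_fst.comp h0
    have hw : Measurable (fun ω => (I ω).2.1) := measurable_fst.comp (measurable_snd.comp h0)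
    have hn : Measurable (fun ω => (I ω).2.2) := measurable_snd.comp (measurable_snd.comp h0)
    have hg := (M.measurable_semiGrad_joint γ).comp (hw.prodMk hOk)
    change Measurable (fun ω => M.semiGrad γ (I ω).2.1 (O k ω)) at hg
    have hh := (hM.measurable_stochPolGrad_joint γ T).comp ((hv.prodMk hw).prodMk hOk)
    change Measurable (fun ω => M.stochPolGrad γ (I ω).1 (I ω).2.1 (O k ω)) at hh
    have hn' : Measurable (fun ω => (1 - η) • (I ω).2.2 + η • M.semiGrad γ (I ω).2.1 (O k ω)) :=
      (hn.const_smul (1 - η)).add (hg.const_smul η)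
    have hw' : Measurable (fun ω => projBall Rw ((I ω).2.1
        - β • ((1 - η) • (I ω).2.2 + η • M.semiGrad γ (I ω).2.1 (O k ω)))) :=
      (continuous_projBall hRw).measurable.comp (hw.sub (hn'.const_smul β))
    exact (hv.add (hh.const_smul α)).prodMk (hw'.prodMk hn')

namespace Run.Valid

variable {S A Ω : Type*} [MeasurableSpace S] [MeasurableSpace A] {dv dw T : ℕ} [NeZero T]
  {mΩ : MeasurableSpace Ω} {R : Run S A Ω dw T} {M : Model S A dv dw}
  {μ : Vec dv → Measure S} {p : Params} {P : Measure Ω} {ℱ : Filtration ℕ mΩ}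

theorem measurable_iter (hR : R.Valid M μ p P ℱ) (k : ℕ) :
    Measurable[ℱ k] (fun ω => M.iter p.γ p.Rw R.α R.β R.η 0 R.w₀ (fun j => R.O j ω) k) :=
  @Model.measurable_iter S A Ω _ _ (ℱ k) dv dw T _ M _ _ _ hR.std.policy p.γ p.Rw
    hR.std.adm.Rw_pos R.α R.β R.η 0 R.w₀ R.O k
    (fun j hj => (hR.samples.measurable_traj j).mono (ℱ.mono hj) le_rfl)

theorem measurable_frame (hR : R.Valid M μ p P ℱ) (k : ℕ) : Measurable[ℱ k] (R.s k) := by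
  cases k with
  | zero => exact hR.samples.measurable_start
  | succ k => exact Model.measurable_lastState.comp (hR.samples.measurable_traj k)

/-- The state `(v_k, w_k, s_{k,0})` of the run. -/
theorem measurable_state_filtration (hR : R.Valid M μ p P ℱ) (k : ℕ) :
    Measurable[ℱ k] (fun ω => (R.v M p k ω, R.w M p k ω, R.s k ω)) := by
  have h := hR.measurable_iter k
  have hv : Measurable[ℱ k] (R.v M p k) := measurable_fst.comp h
  have hw : Measurable[ℱ k] (R.w M p k) := measurable_fst.comp (measurable_snd.comp h)
  have hs := hR.measurable_frame k
  exact hv.prodMk (hw.prodMk hs)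

theorem measurable_state (hR : R.Valid M μ p P ℱ) (k : ℕ) :
    Measurable (fun ω => (R.v M p k ω, R.w M p k ω, R.s k ω)) :=
  (hR.measurable_state_filtration k).mono (ℱ.le k) le_rfl

theorem measurable_v (hR : R.Valid M μ p P ℱ) (k : ℕ) : Measurable (R.v M p k) := by
  have := measurable_fst.comp (hR.measurable_state k)
  exact this

theorem measurable_w (hR : R.Valid M μ p P ℱ) (k : ℕ) : Measurable (R.w M p k) := by
  have := measurable_fst.comp (measurable_snd.comp (hR.measurable_state k))
  exact this

theorem measurable_s (hR : R.Valid M μ p P ℱ) (k : ℕ) : Measurable (R.s k) :=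
  measurable_snd.comp (measurable_snd.comp (hR.measurable_state k))

theorem measurable_n (hR : R.Valid M μ p P ℱ) (k : ℕ) : Measurable (R.n M p k) :=
  measurable_snd.comp (measurable_snd.comp ((hR.measurable_iter k).mono (ℱ.le k) le_rfl))

theorem measurable_O (hR : R.Valid M μ p P ℱ) (k : ℕ) : Measurable (R.O k) :=
  (hR.samples.measurable_traj k).mono (ℱ.le _) le_rfl

theorem measurable_g (hR : R.Valid M μ p P ℱ) (k : ℕ) : Measurable (R.g M p k) := by
  have := (M.measurable_semiGrad_joint p.γ).comp ((hR.measurable_w k).prodMk (hR.measurable_O k))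
  exact this

end Run.Valid

/-! ### The law of a frame given the past -/

namespace Model.Standing

variable {S A : Type*} [MeasurableSpace S] [MeasurableSpace A] {dv dw : ℕ}
  {M : Model S A dv dw} {μ : Vec dv → Measure S} {p : Params}

/-- Rollouts under the random parameter `v_k` require a kernel jointly in `(v, s)`. Integrals of
indicators are Lipschitz in `v` and measurable in `s`, hence jointly measurable. -/
theorem measurable_rollout (h : M.Standing μ p) (T : ℕ) :
    Measurable (fun q : Vec dv × Vec dw × S => M.rollout q.1 T q.2.2) := by
  refine Measure.measurable_of_measurable_coe _ fun B hB => ?_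
  have hf : Measurable (B.indicator (fun _ => (1 : ℝ))) := measurable_const.indicator hB
  have hb : ∀ O, |B.indicator (fun _ => (1 : ℝ)) O| ≤ 1 := fun O => by
    by_cases hO : O ∈ B <;> simp [hO]
  have h1 : Measurable (fun q : Vec dv × S => ∫ O, B.indicator (fun _ => (1 : ℝ)) O
      ∂(M.rollout q.1 T q.2)) := by
    refine measurable_uncurry_of_continuous_of_measurable (u := fun (v : Vec dv) (s : S) =>
      ∫ O, B.indicator (fun _ => (1 : ℝ)) O ∂(M.rollout v T s)) (fun s => ?_) (fun v => ?_)
    · exact ((h.rollout T s).integral_const hf hb).lipschitzWith.continuous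
    · exact (hf.stronglyMeasurable.integral_kernel).measurable
  have h2 : ∀ q : Vec dv × Vec dw × S, M.rollout q.1 T q.2.2 B
      = ENNReal.ofReal (∫ O, B.indicator (fun _ => (1 : ℝ)) O ∂(M.rollout q.1 T q.2.2)) := by
    intro q
    rw [integral_indicator_const _ hB]
    simp
  simp only [h2]
  exact (h1.comp (measurable_fst.prodMk (measurable_snd.comp measurable_snd))).ennreal_ofReal

end Model.Standing

namespace Run.Valid

variable {S A Ω : Type*} [MeasurableSpace S] [MeasurableSpace A] {dv dw T : ℕ} [NeZero T]
  {mΩ : MeasurableSpace Ω} {R : Run S A Ω dw T} {M : Model S A dv dw}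
  {μ : Vec dv → Measure S} {p : Params} {P : Measure Ω} {ℱ : Filtration ℕ mΩ}

/-- The rollout kernel as a kernel in the state of the run. -/
noncomputable def frameKernel (hR : R.Valid M μ p P ℱ) : Kernel (Vec dv × Vec dw × S) (Traj S A T) where
  toFun q := M.rollout q.1 T q.2.2
  measurable' := hR.std.measurable_rollout T

instance (hR : R.Valid M μ p P ℱ) : IsMarkovKernel hR.frameKernel :=
  ⟨fun q => inferInstanceAs (IsProbabilityMeasure (M.rollout q.1 T q.2.2))⟩

/-- The sampling hypothesis, stated as a conditional probability of each event, is converted into a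
disintegration of the joint law. It suffices to compare rectangles `C ×ˢ B`, where the event `D`
that the state lies in `C` belongs to `ℱ k`. -/
theorem map_state_traj (hR : R.Valid M μ p P ℱ) (k : ℕ) :
    P.map (fun ω => ((R.v M p k ω, R.w M p k ω, R.s k ω), R.O k ω))
      = (P.map (fun ω => (R.v M p k ω, R.w M p k ω, R.s k ω))) ⊗ₘ hR.frameKernel := by
  have := hR.prob
  have hY := hR.measurable_state k
  have hYℱ := hR.measurable_state_filtration k
  have hO := hR.measurable_O k
  have : IsProbabilityMeasure (P.map (fun ω => (R.v M p k ω, R.w M p k ω, R.s k ω))) :=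
    Measure.isProbabilityMeasure_map hY.aemeasurable
  have : IsProbabilityMeasure (P.map (fun ω => ((R.v M p k ω, R.w M p k ω, R.s k ω), R.O k ω))) :=
    Measure.isProbabilityMeasure_map (hY.prodMk hO).aemeasurable
  refine Measure.ext_prod fun {C B} hC hB => ?_
  rw [Measure.map_apply (hY.prodMk hO) (hC.prod hB), Measure.compProd_apply_prod hC hB,
    setLIntegral_map hC (hR.frameKernel.measurable_coe hB) hY]
  set D := (fun ω => (R.v M p k ω, R.w M p k ω, R.s k ω)) ⁻¹' C with hD
  have hDm : MeasurableSet[ℱ k] D := hYℱ hC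
  have hDm' : MeasurableSet D := ℱ.le k _ hDm
  have hOB : MeasurableSet (R.O k ⁻¹' B) := hO hB
  have h1 := setIntegral_condExp (μ := P) (ℱ.le k)
    (f := (R.O k ⁻¹' B).indicator (fun _ => (1 : ℝ)))
    ((integrable_const 1).indicator hOB) hDm
  rw [setIntegral_congr_ae hDm' ((hR.samples.law k B hB).mono fun x hx _ => hx),
    integral_indicator_const _ hOB] at h1
  have hset : (fun ω => ((R.v M p k ω, R.w M p k ω, R.s k ω), R.O k ω)) ⁻¹' (C ×ˢ B)
      = R.O k ⁻¹' B ∩ D := by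
    ext ω; simp [hD, and_comm]
  have hk : Measurable (fun ω => (hR.frameKernel (R.v M p k ω, R.w M p k ω, R.s k ω)).real B) :=
    ((hR.frameKernel.measurable_coe hB).comp hY).ennreal_toReal
  have h2 : ∫⁻ ω in D, hR.frameKernel (R.v M p k ω, R.w M p k ω, R.s k ω) B ∂P
      = ENNReal.ofReal (∫ ω in D,
          (hR.frameKernel (R.v M p k ω, R.w M p k ω, R.s k ω)).real B ∂P) := by
    rw [ofReal_integral_eq_lintegral_ofReal]
    · refine lintegral_congr fun ω => ?_
      rw [ofReal_measureReal]
    · refine (integrable_of_bound P hk (B := 1) fun ω => ?_).integrableOn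
      rw [Real.norm_of_nonneg measureReal_nonneg]
      exact measureReal_le_one
    · exact ae_of_all _ fun ω => measureReal_nonneg
  rw [h2, hset]
  have h3 : ∫ ω in D, (hR.frameKernel (R.v M p k ω, R.w M p k ω, R.s k ω)).real B ∂P
      = P.real (R.O k ⁻¹' B ∩ D) := by
    refine Eq.trans ?_ (h1.trans ?_)
    · rfl
    · rw [measureReal_restrict_apply hOB, smul_eq_mul, mul_one]
  rw [h3, ofReal_measureReal]

theorem measurable_integral_frame (hR : R.Valid M μ p P ℱ) (k : ℕ)
    {F : (Vec dv × Vec dw × S) × Traj S A T → ℝ} (hF : Measurable F) :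
    Measurable (fun ω => ∫ O, F ((R.v M p k ω, R.w M p k ω, R.s k ω), O)
      ∂(M.rollout (R.v M p k ω) T (R.s k ω))) := by
  have := (hF.stronglyMeasurable.integral_kernel_prod_right (κ := hR.frameKernel)
      (f := fun y O => F (y, O))).measurable.comp (hR.measurable_state k)
  exact this

/-- Inside expectations the sampled trajectory may be averaged over the rollout law, with `(v_k,
w_k, s_{k,0})` held fixed. -/
theorem integral_frame (hR : R.Valid M μ p P ℱ) (k : ℕ)
    {F : (Vec dv × Vec dw × S) × Traj S A T → ℝ} (hF : Measurable F) {B : ℝ}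
    (hB : ∀ ω, |F ((R.v M p k ω, R.w M p k ω, R.s k ω), R.O k ω)| ≤ B) :
    ∫ ω, F ((R.v M p k ω, R.w M p k ω, R.s k ω), R.O k ω) ∂P
      = ∫ ω, ∫ O, F ((R.v M p k ω, R.w M p k ω, R.s k ω), O)
          ∂(M.rollout (R.v M p k ω) T (R.s k ω)) ∂P := by
  have := hR.prob
  have hY := hR.measurable_state k
  have hO := hR.measurable_O k
  have : IsProbabilityMeasure (P.map (fun ω => (R.v M p k ω, R.w M p k ω, R.s k ω))) :=
    Measure.isProbabilityMeasure_map hY.aemeasurable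
  have hi : Integrable F (P.map (fun ω => ((R.v M p k ω, R.w M p k ω, R.s k ω), R.O k ω))) := by
    rw [integrable_map_measure hF.aestronglyMeasurable (hY.prodMk hO).aemeasurable]
    exact integrable_of_bound P (hF.comp (hY.prodMk hO)) hB
  have h1 := integral_map (μ := P) (hY.prodMk hO).aemeasurable hF.aestronglyMeasurable
  rw [← h1]
  rw [hR.map_state_traj k] at hi ⊢
  rw [Measure.integral_compProd hi, integral_map hY.aemeasurable]
  · rfl
  · exact (hF.stronglyMeasurable.integral_kernel_prod_right (κ := hR.frameKernel)
      (f := fun y O => F (y, O))).aestronglyMeasurable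

end Run.Valid

theorem abs_inner_sub_inner_le {E : Type*} [NormedAddCommGroup E] [InnerProductSpace ℝ E]
    (a a' x x' : E) :
    |inner ℝ a x - inner ℝ a' x'| ≤ ‖a - a'‖ * ‖x‖ + ‖a'‖ * ‖x - x'‖ := by
  have e : inner ℝ a x - inner ℝ a' x' = inner ℝ (a - a') x + inner ℝ a' (x - x') := by
    rw [inner_sub_left, inner_sub_right]; ring
  rw [e]
  exact (abs_add_le _ _).trans (add_le_add (abs_real_inner_le_norm _ _)
    (abs_real_inner_le_norm _ _))

namespace Run.Valid

variable {S A Ω : Type*} [MeasurableSpace S] [MeasurableSpace A] {dv dw T : ℕ} [NeZero T]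
  {mΩ : MeasurableSpace Ω} {R : Run S A Ω dw T} {M : Model S A dv dw}
  {μ : Vec dv → Measure S} {p : Params} {P : Measure Ω} {ℱ : Filtration ℕ mΩ}

/-! ### Decorrelation of the frame start from the iterates -/

/-- The bias functions are controlled only for `‖w‖ ≤ Rw`. Composing with the projection extends
them to all `w` without changing their values along a run, and continuity in `(v, w)` then yields
joint measurability. -/
theorem measurable_ball_extension {Ψ : Vec dv → Vec dw → S → ℝ} {Rw Lv Lw : ℝ} (hRw : 0 < Rw)
    (hm : ∀ v w, ‖w‖ ≤ Rw → Measurable (Ψ v w))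
    (hlip : ∀ v v' w w' s, ‖w‖ ≤ Rw → ‖w'‖ ≤ Rw →
      |Ψ v w s - Ψ v' w' s| ≤ Lv * ‖v - v'‖ + Lw * ‖w - w'‖) :
    Measurable (fun q : (Vec dv × Vec dw) × S => Ψ q.1.1 (projBall Rw q.1.2) q.2) := by
  refine measurable_uncurry_of_continuous_of_measurable
    (u := fun (y : Vec dv × Vec dw) (s : S) => Ψ y.1 (projBall Rw y.2) s) (fun s => ?_)
    (fun y => hm _ _ (norm_projBall_le hRw.le _))
  refine continuous_iff_continuousAt.2 fun y => tendsto_iff_norm_sub_tendsto_zero.2 ?_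
  have hc := continuous_projBall (d := dw) hRw
  have hcont : Continuous (fun z : Vec dv × Vec dw =>
      Lv * ‖z.1 - y.1‖ + Lw * ‖projBall Rw z.2 - projBall Rw y.2‖) := by fun_prop
  have hlim := hcont.tendsto y
  simp only [sub_self, norm_zero, mul_zero, add_zero] at hlim
  exact squeeze_zero (fun _ => norm_nonneg _)
    (fun z => hlip _ _ _ _ s (norm_projBall_le hRw.le _) (norm_projBall_le hRw.le _)) hlim

theorem measurable_comp_state (hR : R.Valid M μ p P ℱ) {Ψ : Vec dv → Vec dw → S → ℝ} {Lv Lw : ℝ}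
    (hm : ∀ v w, ‖w‖ ≤ p.Rw → Measurable (Ψ v w))
    (hlip : ∀ v v' w w' s, ‖w‖ ≤ p.Rw → ‖w'‖ ≤ p.Rw →
      |Ψ v w s - Ψ v' w' s| ≤ Lv * ‖v - v'‖ + Lw * ‖w - w'‖) (j k : ℕ) :
    Measurable (fun ω => Ψ (R.v M p j ω) (R.w M p j ω) (R.s k ω)) := by
  have h1 := (measurable_ball_extension hR.std.adm.Rw_pos hm hlip).comp
    (((hR.measurable_v j).prodMk (hR.measurable_w j)).prodMk (hR.measurable_s k))
  simpa only [Function.comp_def, projBall_of_norm_le (hR.norm_w_le j _)] using h1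

/-- The start of frame `k + 1` is correlated with `v_{k+1}, w_{k+1}` through the previous
trajectory. Replacing these by `v_k, w_k` costs the Lipschitz constants times the step lengths.
Given the past, the start is then the chain of `π_{v_k}` after `T` steps, so the mean of `Ψ` is at
most `B c₀ρ^T ≤ B β` away from its stationary mean, which is zero. -/
theorem abs_integral_state_le (hR : R.Valid M μ p P ℱ) {Ψ : Vec dv → Vec dw → S → ℝ}
    {B Lv Lw : ℝ} (hB0 : 0 ≤ B) (hLv : 0 ≤ Lv) (hLw : 0 ≤ Lw)
    (hm : ∀ v w, ‖w‖ ≤ p.Rw → Measurable (Ψ v w))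
    (hmean : ∀ v w, ‖w‖ ≤ p.Rw → ∫ s, Ψ v w s ∂(μ v) = 0)
    (hb : ∀ v w s, ‖w‖ ≤ p.Rw → |Ψ v w s| ≤ B)
    (hlip : ∀ v v' w w' s, ‖w‖ ≤ p.Rw → ‖w'‖ ≤ p.Rw →
      |Ψ v w s - Ψ v' w' s| ≤ Lv * ‖v - v'‖ + Lw * ‖w - w'‖) (k : ℕ) :
    |∫ ω, Ψ (R.v M p k ω) (R.w M p k ω) (R.s k ω) ∂P|
      ≤ B * R.β + Lv * (R.α * p.gradBound) + Lw * (R.β * p.semiBound T) := by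
  have := hR.prob
  have hα := hR.α_pos.le
  have hβ := hR.β_pos.le
  have hg := hR.std.adm.gradBound_nonneg
  have hs := hR.std.adm.semiBound_nonneg T
  cases k with
  -- Before the first frame the iterates are deterministic, and the assumption on the law of the
  -- initial state replaces the mixing of a previous frame.
  | zero =>
    have hs₀ : Measurable R.s₀ := hR.measurable_s 0
    have : IsProbabilityMeasure (P.map R.s₀) := Measure.isProbabilityMeasure_map hs₀.aemeasurable
    have := hR.std.ergodic.prob 0
    have h1 : ∫ ω, Ψ (R.v M p 0 ω) (R.w M p 0 ω) (R.s 0 ω) ∂P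
        = ∫ x, Ψ 0 R.w₀ x ∂(P.map R.s₀) :=
      (integral_map hs₀.aemeasurable (hm 0 R.w₀ hR.w₀_le).aestronglyMeasurable).symm
    have h2 := abs_integral_sub_le_tvNorm (P.map R.s₀) (μ 0) (hm 0 R.w₀ hR.w₀_le)
      (fun x => hb 0 R.w₀ x hR.w₀_le)
    rw [hmean 0 R.w₀ hR.w₀_le, sub_zero, ← h1] at h2
    have h3 : B * tvNorm (P.map R.s₀) (μ 0) ≤ B * R.β :=
      mul_le_mul_of_nonneg_left (hR.start.trans hR.mix_le) hB0
    have h4 : 0 ≤ Lv * (R.α * p.gradBound) + Lw * (R.β * p.semiBound T) := by positivity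
    linarith
  | succ k =>
    have hmk := hR.measurable_comp_state hm hlip
    have hbk : ∀ i j ω, |Ψ (R.v M p i ω) (R.w M p i ω) (R.s j ω)| ≤ B := fun i j ω =>
      hb _ _ _ (hR.norm_w_le i ω)
    have hi : ∀ i j, Integrable (fun ω => Ψ (R.v M p i ω) (R.w M p i ω) (R.s j ω)) P := fun i j =>
      integrable_of_bound P (hmk i j) (hbk i j)
    have h1 : |∫ ω, (Ψ (R.v M p (k + 1) ω) (R.w M p (k + 1) ω) (R.s (k + 1) ω)
        - Ψ (R.v M p k ω) (R.w M p k ω) (R.s (k + 1) ω)) ∂P|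
        ≤ Lv * (R.α * p.gradBound) + Lw * (R.β * p.semiBound T) := by
      refine abs_integral_le_of_bound _ fun ω => (hlip _ _ _ _ _ (hR.norm_w_le _ ω)
        (hR.norm_w_le _ ω)).trans ?_
      gcongr
      · exact hR.norm_v_sub_le k ω
      · exact hR.norm_w_sub_le k ω
    rw [integral_sub (hi _ _) (hi _ _)] at h1
    have h2 : |∫ ω, Ψ (R.v M p k ω) (R.w M p k ω) (R.s (k + 1) ω) ∂P| ≤ B * R.β := by
      have hFm : Measurable (fun q : (Vec dv × Vec dw × S) × Traj S A T =>
          Ψ q.1.1 (projBall p.Rw q.1.2.1) (Model.lastState q.2)) := by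
        have := (measurable_ball_extension hR.std.adm.Rw_pos hm hlip).comp
          (show Measurable (fun q : (Vec dv × Vec dw × S) × Traj S A T =>
            ((q.1.1, q.1.2.1), Model.lastState q.2)) by fun_prop)
        exact this
      have e := hR.integral_frame k hFm (B := B)
        (fun ω => hb _ _ _ (norm_projBall_le hR.std.adm.Rw_pos.le _))
      simp only [projBall_of_norm_le (hR.norm_w_le k _), ← s_succ] at e
      rw [e]
      refine abs_integral_le_of_bound _ fun ω => ?_
      have hw := hR.norm_w_le k ω
      rw [M.integral_rollout_lastState _ T _ (hm _ _ hw) (fun x => hb _ _ x hw)]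
      have h3 := hR.std.abs_integral_pow_sub_le (R.v M p k ω) T (R.s k ω) (hm (R.v M p k ω) _ hw)
        (fun x => hb _ _ x hw)
      rw [hmean _ _ hw, sub_zero] at h3
      exact h3.trans (mul_le_mul_of_nonneg_left hR.mix_le hB0)
    have h4 := abs_sub_abs_le_abs_sub
      (∫ ω, Ψ (R.v M p (k + 1) ω) (R.w M p (k + 1) ω) (R.s (k + 1) ω) ∂P)
      (∫ ω, Ψ (R.v M p k ω) (R.w M p k ω) (R.s (k + 1) ω) ∂P)
    linarith

end Run.Valid

/-! ### Regularity of the mean semi-gradient -/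

namespace Model

variable {S A : Type*} [MeasurableSpace S] [MeasurableSpace A] {dv dw : ℕ}
  {M : Model S A dv dw} {μ : Vec dv → Measure S} {p : Params}

/-- The mean semi-gradient from the state `s`. -/
noncomputable def semiFrom (M : Model S A dv dw) (γ : ℝ) (T : ℕ) [NeZero T] (v : Vec dv)
    (w : Vec dw) (s : S) : Vec dw :=
  ∫ O, M.semiGrad γ w O ∂(M.rollout v T s)

namespace Standing

variable {T : ℕ} [NeZero T]

theorem norm_semiGrad_le_semiBound (h : M.Standing μ p) {w : Vec dw} (hw : ‖w‖ ≤ p.Rw)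
    (O : Traj S A T) : ‖M.semiGrad p.γ w O‖ ≤ p.semiBound T := by
  have := h.adm.γ_pos
  refine (h.norm_semiGrad_le _ _).trans ?_
  unfold Params.semiBound Rg
  gcongr

theorem norm_semiGrad_sub_le (h : M.Standing μ p) (w w' : Vec dw) (O : Traj S A T) :
    ‖M.semiGrad p.γ w O - M.semiGrad p.γ w' O‖ ≤ 2 * ‖w - w'‖ := by
  rw [semiGrad, semiGrad, sub_sub_sub_cancel_right, ← sub_smul, ← inner_sub_right]
  refine (M.norm_feat_smul_le _ _).trans
    ((M.abs_inner_feat_sub_le h.adm.γ_pos.le T _ _ _).trans ?_)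
  gcongr
  linarith [h.adm.pow_le_one T]

theorem measurable_semiFrom (M : Model S A dv dw) (γ : ℝ) (v : Vec dv) (w : Vec dw) :
    Measurable (M.semiFrom γ T v w) :=
  ((M.measurable_semiGrad_right γ w).stronglyMeasurable.integral_kernel).measurable

theorem norm_semiFrom_le (h : M.Standing μ p) (v : Vec dv) {w : Vec dw} (hw : ‖w‖ ≤ p.Rw)
    (s : S) : ‖M.semiFrom p.γ T v w s‖ ≤ p.semiBound T :=
  norm_integral_le_of_bound _ (h.norm_semiGrad_le_semiBound hw)

theorem norm_fullSemiGrad_le (h : M.Standing μ p) (v : Vec dv) {w : Vec dw} (hw : ‖w‖ ≤ p.Rw) :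
    ‖M.fullSemiGrad μ p.γ T v w‖ ≤ p.semiBound T := by
  have := h.ergodic.prob v
  exact norm_integral_le_of_bound _ (h.norm_semiGrad_le_semiBound hw)

theorem norm_semiFrom_sub_le (h : M.Standing μ p) (v v' : Vec dv) {w : Vec dw}
    (hw : ‖w‖ ≤ p.Rw) (s : S) : ‖M.semiFrom p.γ T v w s - M.semiFrom p.γ T v' w s‖
      ≤ T * p.ell * p.semiBound T * ‖v - v'‖ := by
  have := h.adm.ell_nonneg
  exact (h.rollout T s).norm_lip (by positivity) (M.measurable_semiGrad_right p.γ w)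
    (h.adm.semiBound_nonneg T) (h.norm_semiGrad_le_semiBound hw) v v'

theorem norm_fullSemiGrad_sub_le (h : M.Standing μ p) (v v' : Vec dv) {w : Vec dw}
    (hw : ‖w‖ ≤ p.Rw) : ‖M.fullSemiGrad μ p.γ T v w - M.fullSemiGrad μ p.γ T v' w‖
      ≤ (p.statLip + T * p.ell) * p.semiBound T * ‖v - v'‖ := by
  rw [h.fullSemiGrad_eq_integral, h.fullSemiGrad_eq_integral]
  exact (h.stationary.norm_integral_sub_le h.adm.statLip_nonneg (h.adm.semiBound_nonneg T)
    (measurable_semiFrom M p.γ v w) (measurable_semiFrom M p.γ v' w)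
    (h.norm_semiFrom_le v hw) (h.norm_semiFrom_sub_le v v' hw) v v').trans_eq (by ring)

theorem integrable_semiGrad (h : M.Standing μ p) (w : Vec dw) (ν : Measure (Traj S A T))
    [IsProbabilityMeasure ν] : Integrable (fun O => M.semiGrad p.γ w O) ν :=
  integrable_of_bound ν (M.measurable_semiGrad_right p.γ w) (h.norm_semiGrad_le w)

theorem norm_semiFrom_sub_le' (h : M.Standing μ p) (v : Vec dv) (w w' : Vec dw) (s : S) :
    ‖M.semiFrom p.γ T v w s - M.semiFrom p.γ T v w' s‖ ≤ 2 * ‖w - w'‖ := by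
  rw [semiFrom, semiFrom, ← integral_sub (h.integrable_semiGrad w _) (h.integrable_semiGrad w' _)]
  exact norm_integral_le_of_bound _ (h.norm_semiGrad_sub_le w w')

theorem norm_fullSemiGrad_sub_le' (h : M.Standing μ p) (v : Vec dv) (w w' : Vec dw) :
    ‖M.fullSemiGrad μ p.γ T v w - M.fullSemiGrad μ p.γ T v w'‖ ≤ 2 * ‖w - w'‖ := by
  have := h.ergodic.prob v
  rw [fullSemiGrad, fullSemiGrad,
    ← integral_sub (h.integrable_semiGrad w _) (h.integrable_semiGrad w' _)]
  exact norm_integral_le_of_bound _ fun O => h.norm_semiGrad_sub_le w w' O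

/-- The bias of the semi-gradient from `s`, tested against the critic error. -/
noncomputable def _root_.HBA2C.Model.semiBias (M : Model S A dv dw) (μ : Vec dv → Measure S)
    (γ : ℝ) (T : ℕ) [NeZero T] (v : Vec dv) (w : Vec dw) (s : S) : ℝ :=
  inner ℝ (w - M.optCritic μ γ T v) (M.fullSemiGrad μ γ T v w - M.semiFrom γ T v w s)

theorem norm_sub_optCritic_le (hopt : ∀ v, ‖M.optCritic μ p.γ T v‖ ≤ p.Rw)
    (v : Vec dv) {w : Vec dw} (hw : ‖w‖ ≤ p.Rw) : ‖w - M.optCritic μ p.γ T v‖ ≤ 2 * p.Rw :=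
  (norm_sub_le _ _).trans (by linarith [hopt v])

theorem norm_sub_optCritic_sub_le (h : M.Standing μ p) (v v' : Vec dv) (w w' : Vec dw) :
    ‖(w - M.optCritic μ p.γ T v) - (w' - M.optCritic μ p.γ T v')‖
      ≤ ‖w - w'‖ + p.critLip * ‖v - v'‖ := by
  calc _ = ‖(w - w') - (M.optCritic μ p.γ T v - M.optCritic μ p.γ T v')‖ := by congr 1; abel
    _ ≤ _ := norm_sub_le _ _
    _ ≤ _ := add_le_add le_rfl ((h.isC11_optCritic T).lip v v')

theorem measurable_semiBias (M : Model S A dv dw) (μ : Vec dv → Measure S) (γ : ℝ) (v : Vec dv)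
    (w : Vec dw) : Measurable (M.semiBias μ γ T v w) := by
  have := measurable_semiFrom (T := T) M γ v w
  unfold semiBias
  fun_prop

/-- The full semi-gradient is the stationary average of `semiFrom`, so the bias is centred, as the
decorrelation bound requires. -/
theorem integral_semiBias (h : M.Standing μ p) (v : Vec dv) {w : Vec dw} (hw : ‖w‖ ≤ p.Rw) :
    ∫ s, M.semiBias μ p.γ T v w s ∂(μ v) = 0 := by
  have := h.ergodic.prob v
  have hi : Integrable (M.semiFrom p.γ T v w) (μ v) :=
    integrable_of_bound _ (measurable_semiFrom M p.γ v w) (h.norm_semiFrom_le v hw)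
  simp only [semiBias]
  have hj : Integrable (fun s => M.fullSemiGrad μ p.γ T v w - M.semiFrom p.γ T v w s) (μ v) :=
    (integrable_const _).sub hi
  rw [integral_inner hj, integral_sub (integrable_const _) hi,
    h.fullSemiGrad_eq_integral]
  simp [semiFrom]

theorem abs_semiBias_le (h : M.Standing μ p) (hopt : ∀ v, ‖M.optCritic μ p.γ T v‖ ≤ p.Rw)
    (v : Vec dv) {w : Vec dw} (s : S) (hw : ‖w‖ ≤ p.Rw) :
    |M.semiBias μ p.γ T v w s| ≤ 4 * p.Rw * p.semiBound T := by
  have hR := h.adm.Rw_pos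
  refine (abs_real_inner_le_norm _ _).trans ?_
  calc _ ≤ (2 * p.Rw) * (p.semiBound T + p.semiBound T) :=
        mul_le_mul (norm_sub_optCritic_le hopt v hw) ((norm_sub_le _ _).trans
          (add_le_add (h.norm_fullSemiGrad_le v hw) (h.norm_semiFrom_le v hw s)))
          (norm_nonneg _) (by positivity)
    _ = _ := by ring

/-- The product rule for the critic error against the bias. The coefficient of `‖v - v'‖` is the
part of `c₃` that does not come from momentum; its factor `T` reflects that the law of a whole
undiscounted rollout varies with constant `T ell`. -/
theorem abs_semiBias_sub_le (h : M.Standing μ p) (hopt : ∀ v, ‖M.optCritic μ p.γ T v‖ ≤ p.Rw)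
    (v v' : Vec dv) (w w' : Vec dw) (s : S) (hw : ‖w‖ ≤ p.Rw) (hw' : ‖w'‖ ≤ p.Rw) :
    |M.semiBias μ p.γ T v w s - M.semiBias μ p.γ T v' w' s|
      ≤ (2 * p.critLip + 2 * (p.mix + 2 * T) * p.ell * p.Rw) * p.semiBound T * ‖v - v'‖
        + (2 * p.semiBound T + 8 * p.Rw) * ‖w - w'‖ := by
  have hR := h.adm.Rw_pos
  have hl := h.adm.ell_nonneg
  have hG := h.adm.semiBound_nonneg T
  have hc := h.adm.critLip_nonneg
  refine (abs_inner_sub_inner_le _ _ _ _).trans ?_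
  have h1 : ‖M.fullSemiGrad μ p.γ T v w - M.semiFrom p.γ T v w s‖ ≤ 2 * p.semiBound T :=
    (norm_sub_le _ _).trans
      ((add_le_add (h.norm_fullSemiGrad_le v hw) (h.norm_semiFrom_le v hw s)).trans_eq (by ring))
  have h2 : ‖(M.fullSemiGrad μ p.γ T v w - M.semiFrom p.γ T v w s)
      - (M.fullSemiGrad μ p.γ T v' w' - M.semiFrom p.γ T v' w' s)‖
      ≤ (p.mix + 2 * T) * p.ell * p.semiBound T * ‖v - v'‖ + 4 * ‖w - w'‖ := by
    calc _ = ‖((M.fullSemiGrad μ p.γ T v w - M.fullSemiGrad μ p.γ T v' w)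
            + (M.fullSemiGrad μ p.γ T v' w - M.fullSemiGrad μ p.γ T v' w'))
          - ((M.semiFrom p.γ T v w s - M.semiFrom p.γ T v' w s)
            + (M.semiFrom p.γ T v' w s - M.semiFrom p.γ T v' w' s))‖ := by congr 1; abel
      _ ≤ _ := norm_sub_le _ _
      _ ≤ _ := add_le_add (norm_add_le _ _) (norm_add_le _ _)
      _ ≤ ((p.statLip + T * p.ell) * p.semiBound T * ‖v - v'‖ + 2 * ‖w - w'‖)
          + (T * p.ell * p.semiBound T * ‖v - v'‖ + 2 * ‖w - w'‖) :=
          add_le_add (add_le_add (h.norm_fullSemiGrad_sub_le v v' hw)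
            (h.norm_fullSemiGrad_sub_le' v' w w')) (add_le_add (h.norm_semiFrom_sub_le v v' hw s)
            (h.norm_semiFrom_sub_le' v' w w' s))
      _ = _ := by unfold Params.statLip; ring
  calc _ ≤ (‖w - w'‖ + p.critLip * ‖v - v'‖) * (2 * p.semiBound T)
        + (2 * p.Rw) * ((p.mix + 2 * T) * p.ell * p.semiBound T * ‖v - v'‖ + 4 * ‖w - w'‖) :=
      add_le_add (mul_le_mul (h.norm_sub_optCritic_sub_le v v' w w') h1 (norm_nonneg _)
        (by positivity)) (mul_le_mul (norm_sub_optCritic_le hopt v' hw') h2 (norm_nonneg _)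
        (by positivity))
    _ = _ := by ring

end Standing

end Model

/-- Lipschitz constant of the bias in the actor parameter. -/
noncomputable def Params.biasLip (p : Params) : ℝ :=
  p.critLip * (p.critLip * (2 * p.gradBound))
    + 2 * p.Rw * (p.critSecond * (2 * p.gradBound)
      + p.critLip * (p.gradFromLip + p.meanGradLip))

namespace Model

variable {S A : Type*} [MeasurableSpace S] [MeasurableSpace A] {dv dw : ℕ}
  {M : Model S A dv dw} {μ : Vec dv → Measure S} {p : Params}

/-! ### Regularity of the bias of the policy gradient -/

/-- The bias of the stochastic policy gradient from `s`. -/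
noncomputable def gradDev (M : Model S A dv dw) (μ : Vec dv → Measure S)
    (γ : ℝ) (T : ℕ) (v : Vec dv) (w : Vec dw) (s : S) : Vec dv :=
  M.gradFrom γ T v w s - (1 - γ ^ T) • M.meanGrad μ γ v w

/-- The bias of the policy gradient from `s`, transported by the derivative of the optimal critic
and tested against the critic error. -/
noncomputable def gradBias (M : Model S A dv dw) (μ : Vec dv → Measure S)
    (γ : ℝ) (T : ℕ) [NeZero T] (v : Vec dv) (w : Vec dw) (s : S) : ℝ :=
  inner ℝ (w - M.optCritic μ γ T v) (fderiv ℝ (M.optCritic μ γ T) v (M.gradDev μ γ T v w s))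

namespace Standing

variable {T : ℕ}

theorem norm_gradDev_le (h : M.Standing μ p) (v : Vec dv) {w : Vec dw} (hw : ‖w‖ ≤ p.Rw) (s : S) :
    ‖M.gradDev μ p.γ T v w s‖ ≤ 2 * p.gradBound := by
  have h0 : 0 ≤ 1 - p.γ ^ T := sub_nonneg.2 (h.adm.pow_le_one T)
  have h1 : 1 - p.γ ^ T ≤ 1 := by linarith [pow_nonneg h.adm.γ_pos.le T]
  refine (norm_sub_le _ _).trans ?_
  rw [norm_smul, Real.norm_of_nonneg h0]
  have := mul_le_of_le_one_left (norm_nonneg (M.meanGrad μ p.γ v w)) h1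
  linarith [h.norm_gradFrom_le T v hw s, h.norm_meanGrad_le v hw]


theorem norm_gradDev_sub_le (h : M.Standing μ p) (v v' : Vec dv) {w w' : Vec dw}
    (hw : ‖w‖ ≤ p.Rw) (hw' : ‖w'‖ ≤ p.Rw) (s : S) :
    ‖M.gradDev μ p.γ T v w s - M.gradDev μ p.γ T v' w' s‖
      ≤ (p.gradFromLip + p.meanGradLip) * ‖v - v'‖ + 2 * ((1 + p.γ) * p.Rπ) * ‖w - w'‖ := by
  have h0 : 0 ≤ 1 - p.γ ^ T := sub_nonneg.2 (h.adm.pow_le_one T)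
  have h1 : 1 - p.γ ^ T ≤ 1 := by linarith [pow_nonneg h.adm.γ_pos.le T]
  have h2 : ‖(1 - p.γ ^ T) • (M.meanGrad μ p.γ v w - M.meanGrad μ p.γ v' w')‖
      ≤ p.meanGradLip * ‖v - v'‖ + (1 + p.γ) * p.Rπ * ‖w - w'‖ := by
    rw [norm_smul, Real.norm_of_nonneg h0]
    refine (mul_le_of_le_one_left (norm_nonneg _) h1).trans ?_
    calc _ = ‖(M.meanGrad μ p.γ v w - M.meanGrad μ p.γ v' w)
          + (M.meanGrad μ p.γ v' w - M.meanGrad μ p.γ v' w')‖ := by congr 1; abel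
      _ ≤ _ := norm_add_le _ _
      _ ≤ _ := add_le_add (h.norm_meanGrad_sub_le v v' hw) (h.norm_meanGrad_sub_le' v' hw hw')
  calc _ = ‖((M.gradFrom p.γ T v w s - M.gradFrom p.γ T v' w s)
          + (M.gradFrom p.γ T v' w s - M.gradFrom p.γ T v' w' s))
        - (1 - p.γ ^ T) • (M.meanGrad μ p.γ v w - M.meanGrad μ p.γ v' w')‖ := by
        rw [gradDev, gradDev, smul_sub]; congr 1; abel
    _ ≤ _ := norm_sub_le _ _
    _ ≤ _ := add_le_add (norm_add_le _ _) le_rfl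
    _ ≤ (p.gradFromLip * ‖v - v'‖ + (1 + p.γ) * p.Rπ * ‖w - w'‖)
        + (p.meanGradLip * ‖v - v'‖ + (1 + p.γ) * p.Rπ * ‖w - w'‖) :=
        add_le_add (add_le_add (h.norm_gradFrom_sub_le T v v' hw s)
          (h.norm_gradFrom_sub_le' T v' hw hw' s)) h2
    _ = _ := by ring

theorem measurable_gradDev (h : M.Standing μ p) (v : Vec dv) (w : Vec dw) :
    Measurable (M.gradDev μ p.γ T v w) :=
  (h.measurable_gradFrom T v w).sub_const _

theorem integral_gradDev (h : M.Standing μ p) (v : Vec dv) {w : Vec dw} (hw : ‖w‖ ≤ p.Rw) :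
    ∫ s, M.gradDev μ p.γ T v w s ∂(μ v) = 0 := by
  have := h.ergodic.prob v
  have hi : Integrable (M.gradFrom p.γ T v w) (μ v) :=
    integrable_of_bound _ (h.measurable_gradFrom T v w) (h.norm_gradFrom_le T v hw)
  simp only [gradDev]
  rw [integral_sub hi (integrable_const _), h.integral_gradFrom T v hw]
  simp

variable [NeZero T]

theorem measurable_gradBias (h : M.Standing μ p) (v : Vec dv) (w : Vec dw) :
    Measurable (M.gradBias μ p.γ T v w) := by
  have := h.measurable_gradDev (T := T) v w
  unfold gradBias
  fun_prop

theorem integral_gradBias (h : M.Standing μ p) (v : Vec dv) {w : Vec dw} (hw : ‖w‖ ≤ p.Rw) :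
    ∫ s, M.gradBias μ p.γ T v w s ∂(μ v) = 0 := by
  have := h.ergodic.prob v
  have hi : Integrable (M.gradDev μ p.γ T v w) (μ v) :=
    integrable_of_bound _ (h.measurable_gradDev v w) (h.norm_gradDev_le v hw)
  simp only [gradBias]
  rw [integral_inner (ContinuousLinearMap.integrable_comp _ hi),
    ContinuousLinearMap.integral_comp_comm _ hi, h.integral_gradDev v hw, map_zero,
    inner_zero_right]

theorem norm_fderiv_optCritic_le (h : M.Standing μ p) (v : Vec dv) :
    ‖fderiv ℝ (M.optCritic μ p.γ T) v‖ ≤ p.critLip :=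
  (h.isC11_optCritic T).norm_fderiv_le h.adm.critLip_nonneg v

theorem norm_fderiv_gradDev_le (h : M.Standing μ p) (v : Vec dv) {w : Vec dw} (s : S)
    (hw : ‖w‖ ≤ p.Rw) :
    ‖fderiv ℝ (M.optCritic μ p.γ T) v (M.gradDev μ p.γ T v w s)‖
      ≤ p.critLip * (2 * p.gradBound) :=
  (ContinuousLinearMap.le_opNorm _ _).trans (mul_le_mul (h.norm_fderiv_optCritic_le v)
    (h.norm_gradDev_le v hw s) (norm_nonneg _) h.adm.critLip_nonneg)

theorem abs_gradBias_le (h : M.Standing μ p) (hopt : ∀ v, ‖M.optCritic μ p.γ T v‖ ≤ p.Rw)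
    (v : Vec dv) {w : Vec dw} (s : S) (hw : ‖w‖ ≤ p.Rw) :
    |M.gradBias μ p.γ T v w s| ≤ 4 * p.Rw * p.critLip * p.gradBound := by
  have hR := h.adm.Rw_pos
  refine (abs_real_inner_le_norm _ _).trans ?_
  calc _ ≤ (2 * p.Rw) * (p.critLip * (2 * p.gradBound)) :=
        mul_le_mul (norm_sub_optCritic_le hopt v hw) (h.norm_fderiv_gradDev_le v s hw)
          (norm_nonneg _) (by positivity)
    _ = _ := by ring

/-- The product rule with three factors: the critic error, the derivative of `w*` (Lipschitz because
second differences are bounded) and the deviation of the gradient. -/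
theorem abs_gradBias_sub_le (h : M.Standing μ p) (hopt : ∀ v, ‖M.optCritic μ p.γ T v‖ ≤ p.Rw)
    (v v' : Vec dv) (w w' : Vec dw) (s : S) (hw : ‖w‖ ≤ p.Rw) (hw' : ‖w'‖ ≤ p.Rw) :
    |M.gradBias μ p.γ T v w s - M.gradBias μ p.γ T v' w' s|
      ≤ p.biasLip * ‖v - v'‖ + 6 * p.critLip * p.gradBound * ‖w - w'‖ := by
  have hR := h.adm.Rw_pos
  have hγ := h.adm.γ_pos
  have hH := h.adm.gradBound_nonneg
  have hc := h.adm.critLip_nonneg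
  have hc2 := h.adm.critSecond_nonneg
  have hRπ := h.adm.Rπ_nonneg
  have hd := (h.isC11_optCritic T).differentiable hc2
  set D := fderiv ℝ (M.optCritic μ p.γ T)
  set y := M.gradDev μ p.γ T v w s
  set y' := M.gradDev μ p.γ T v' w' s
  refine (abs_inner_sub_inner_le _ _ _ _).trans ?_
  have h2 : ‖D v y - D v' y'‖ ≤ p.critSecond * ‖v - v'‖ * (2 * p.gradBound)
      + p.critLip * ((p.gradFromLip + p.meanGradLip) * ‖v - v'‖
        + 2 * ((1 + p.γ) * p.Rπ) * ‖w - w'‖) := by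
    calc _ = ‖(D v - D v') y + D v' (y - y')‖ := by
          rw [sub_apply, map_sub]; congr 1; abel
      _ ≤ _ := norm_add_le _ _
      _ ≤ ‖D v - D v'‖ * ‖y‖ + ‖D v'‖ * ‖y - y'‖ :=
          add_le_add (ContinuousLinearMap.le_opNorm _ _) (ContinuousLinearMap.le_opNorm _ _)
      _ ≤ _ := add_le_add
          (mul_le_mul ((h.isC11_optCritic T).norm_fderiv_sub_le hc2 (hd v) (hd v'))
            (h.norm_gradDev_le v hw s) (norm_nonneg _) (by positivity))
          (mul_le_mul (h.norm_fderiv_optCritic_le v') (h.norm_gradDev_sub_le v v' hw hw' s)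
            (norm_nonneg _) hc)
  -- Absorbs the Lipschitz constant of the gradient in `w` into `R_h`, so that the coefficient of
  -- `‖w - w'‖` is a multiple of `R_h`.
  have hRh : (1 + p.γ) * p.Rπ * p.Rw ≤ p.gradBound := by
    unfold Params.gradBound Rh
    nlinarith [mul_nonneg hRπ h.adm.Rr_nonneg]
  calc _ ≤ (‖w - w'‖ + p.critLip * ‖v - v'‖) * (p.critLip * (2 * p.gradBound))
        + (2 * p.Rw) * (p.critSecond * ‖v - v'‖ * (2 * p.gradBound)
          + p.critLip * ((p.gradFromLip + p.meanGradLip) * ‖v - v'‖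
            + 2 * ((1 + p.γ) * p.Rπ) * ‖w - w'‖)) :=
        add_le_add (mul_le_mul (h.norm_sub_optCritic_sub_le v v' w w')
          (h.norm_fderiv_gradDev_le v s hw) (norm_nonneg _) (by positivity))
          (mul_le_mul (norm_sub_optCritic_le hopt v' hw') h2 (norm_nonneg _) (by positivity))
    _ = p.biasLip * ‖v - v'‖ + (2 * p.critLip * p.gradBound
          + 4 * p.critLip * ((1 + p.γ) * p.Rπ * p.Rw)) * ‖w - w'‖ := by
        unfold Params.biasLip; ring
    _ ≤ p.biasLip * ‖v - v'‖ + (2 * p.critLip * p.gradBound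
          + 4 * p.critLip * p.gradBound) * ‖w - w'‖ := by gcongr
    _ = _ := by ring

theorem _root_.HBA2C.Params.Admissible.biasLip_nonneg (h : p.Admissible) : 0 ≤ p.biasLip := by
  have := h.critLip_nonneg; have := h.critSecond_nonneg; have := h.gradBound_nonneg
  have := h.Rw_pos; have := h.one_le_geo; have := h.tdBound_nonneg; have := h.Lπ'_nonneg
  have := h.ell_nonneg; have := h.statLip_nonneg
  unfold Params.biasLip Params.gradFromLip Params.meanGradLip; positivity

end Standing

end Model

/-- Provides measurability of `‖∇J(v_k)‖²` along a run. -/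
theorem Model.Standing.continuous_polGrad {S A : Type*} [MeasurableSpace S] [MeasurableSpace A]
    {dv dw T : ℕ} [NeZero T] {M : Model S A dv dw} {μ : Vec dv → Measure S} {p : Params}
    (h : M.Standing μ p) (hopt : ∀ v, ‖M.optCritic μ p.γ T v‖ ≤ p.Rw) :
    Continuous (M.polGrad μ p.γ T) := by
  have hγ := h.adm.γ_pos
  have hRπ := h.adm.Rπ_nonneg
  refine (LipschitzWith.of_dist_le_mul
    (K := (p.meanGradLip + (1 + p.γ) * p.Rπ * p.critLip).toNNReal) fun v v' => ?_).continuous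
  rw [dist_eq_norm, dist_eq_norm, h.polGrad_eq T v (hopt v), h.polGrad_eq T v' (hopt v')]
  set w := M.optCritic μ p.γ T
  calc ‖M.meanGrad μ p.γ v (w v) - M.meanGrad μ p.γ v' (w v')‖
      = ‖(M.meanGrad μ p.γ v (w v) - M.meanGrad μ p.γ v' (w v))
          + (M.meanGrad μ p.γ v' (w v) - M.meanGrad μ p.γ v' (w v'))‖ := by congr 1; abel
    _ ≤ _ := norm_add_le _ _
    _ ≤ p.meanGradLip * ‖v - v'‖ + (1 + p.γ) * p.Rπ * (p.critLip * ‖v - v'‖) :=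
        add_le_add (h.norm_meanGrad_sub_le v v' (hopt v))
          ((h.norm_meanGrad_sub_le' v' (hopt v) (hopt v')).trans
            (by gcongr; exact (h.isC11_optCritic T).lip v v'))
    _ = (p.meanGradLip + (1 + p.γ) * p.Rπ * p.critLip) * ‖v - v'‖ := by ring
    _ ≤ _ := by gcongr; exact Real.le_coe_toNNReal _

/-! ### One-step estimates along a run -/

namespace Run

variable {S A Ω : Type*} [MeasurableSpace S] [MeasurableSpace A] {dv dw T : ℕ} [NeZero T]

/-- The critic error `Δ_k = w_k - w*_{v_k}`. -/
noncomputable def err (R : Run S A Ω dw T) (M : Model S A dv dw) (μ : Vec dv → Measure S)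
    (p : Params) (k : ℕ) (ω : Ω) : Vec dw :=
  R.w M p k ω - M.optCritic μ p.γ T (R.v M p k ω)

namespace Valid

variable {mΩ : MeasurableSpace Ω} {R : Run S A Ω dw T} {M : Model S A dv dw}
  {μ : Vec dv → Measure S} {p : Params} {P : Measure Ω} {ℱ : Filtration ℕ mΩ}

theorem norm_err_le (hR : R.Valid M μ p P ℱ) (k : ℕ) (ω : Ω) : ‖R.err M μ p k ω‖ ≤ 2 * p.Rw :=
  Model.Standing.norm_sub_optCritic_le hR.opt_le _ (hR.norm_w_le k ω)

theorem measurable_err (hR : R.Valid M μ p P ℱ) (k : ℕ) : Measurable (R.err M μ p k) :=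
  (hR.measurable_w k).sub
    ((hR.std.isC11_optCritic T).lipschitzWith.continuous.measurable.comp (hR.measurable_v k))

theorem integrable_err_sq (hR : R.Valid M μ p P ℱ) (k : ℕ) :
    Integrable (fun ω => ‖R.err M μ p k ω‖ ^ 2) P := by
  have := hR.prob
  refine integrable_of_bound P ((hR.measurable_err k).norm.pow_const 2) (B := (2 * p.Rw) ^ 2)
    fun ω => ?_
  rw [norm_pow, norm_norm]
  exact pow_le_pow_left₀ (norm_nonneg _) (hR.norm_err_le k ω) 2

theorem integrable_inner (hR : R.Valid M μ p P ℱ) (k : ℕ) {f : Ω → Vec dw} (hf : Measurable f)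
    {B : ℝ} (hB : ∀ ω, ‖f ω‖ ≤ B) : Integrable (fun ω => inner ℝ (R.err M μ p k ω) (f ω)) P := by
  have := hR.prob
  have h1 := hR.measurable_err k
  refine integrable_of_bound P (by fun_prop) (B := 2 * p.Rw * B) fun ω => ?_
  exact (abs_real_inner_le_norm _ _).trans (mul_le_mul (hR.norm_err_le k ω) (hB ω)
    (norm_nonneg _) (by linarith [hR.std.adm.Rw_pos]))

theorem norm_opt_sub_le (hR : R.Valid M μ p P ℱ) (k : ℕ) (ω : Ω) :
    ‖M.optCritic μ p.γ T (R.v M p k ω) - M.optCritic μ p.γ T (R.v M p (k + 1) ω)‖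
      ≤ p.critLip * (R.α * p.gradBound) := by
  have := hR.std.adm.critLip_nonneg
  refine ((hR.std.isC11_optCritic T).lip _ _).trans ?_
  rw [norm_sub_rev]
  gcongr
  exact hR.norm_v_sub_le k ω

/-- As `w*_{v_k}` lies in the ball, projecting does not increase the distance to it. Expanding that
square and then moving the target to `w*_{v_{k+1}}` leaves the cross term `⟨w_{k+1} - w_k, w*_{v_k}
- w*_{v_{k+1}}⟩`, which is split into halves of squares; these complete the coefficients of `β²` and
`α²`. -/
theorem err_step (hR : R.Valid M μ p P ℱ) (k : ℕ) (ω : Ω) :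
    1 / 2 * ‖R.err M μ p (k + 1) ω‖ ^ 2
      ≤ 1 / 2 * ‖R.err M μ p k ω‖ ^ 2 - R.β * inner ℝ (R.err M μ p k ω) (R.n M p (k + 1) ω)
        + inner ℝ (R.err M μ p k ω) (M.optCritic μ p.γ T (R.v M p k ω)
            - M.optCritic μ p.γ T (R.v M p (k + 1) ω))
        + p.semiBound T ^ 2 * R.β ^ 2 + p.critLip ^ 2 * p.gradBound ^ 2 * R.α ^ 2 := by
  have hβ := hR.β_pos.le
  set w' := R.w M p (k + 1) ω
  set w := R.w M p k ω
  set o := M.optCritic μ p.γ T (R.v M p k ω)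
  set o' := M.optCritic μ p.γ T (R.v M p (k + 1) ω)
  set n := R.n M p (k + 1) ω
  change 1 / 2 * ‖w' - o'‖ ^ 2 ≤ 1 / 2 * ‖w - o‖ ^ 2 - R.β * inner ℝ (w - o) n
    + inner ℝ (w - o) (o - o') + _ + _
  have h1 : ‖w' - o‖ ^ 2 ≤ ‖w - o‖ ^ 2 - 2 * (R.β * inner ℝ (w - o) n) + R.β ^ 2 * ‖n‖ ^ 2 := by
    have h : ‖w' - o‖ ≤ ‖(w - o) - R.β • n‖ := by
      have hw : w' = projBall p.Rw (w - R.β • n) := R.w_succ M p k ω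
      rw [hw, sub_right_comm]
      exact norm_projBall_sub_le (w - R.β • n) (hR.opt_le _)
    refine (pow_le_pow_left₀ (norm_nonneg _) h 2).trans_eq ?_
    rw [norm_sub_sq_real, real_inner_smul_right, norm_smul, mul_pow, Real.norm_eq_abs, sq_abs]
  have h2 : ‖w' - o'‖ ^ 2 = ‖w' - o‖ ^ 2 + 2 * inner ℝ (w' - o) (o - o') + ‖o - o'‖ ^ 2 := by
    rw [← norm_add_sq_real]; congr 2; abel
  have h3 : inner ℝ (w' - o) (o - o') = inner ℝ (w - o) (o - o') + inner ℝ (w' - w) (o - o') := by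
    rw [← inner_add_left]; congr 1; abel
  have h4 : inner ℝ (w' - w) (o - o') ≤ ‖w' - w‖ * ‖o - o'‖ := real_inner_le_norm _ _
  have h5 := hR.norm_w_sub_le k ω
  have h6 := hR.norm_opt_sub_le k ω
  have h7 : ‖w' - w‖ ^ 2 ≤ (R.β * p.semiBound T) ^ 2 := pow_le_pow_left₀ (norm_nonneg _) h5 2
  have h8 : ‖o - o'‖ ^ 2 ≤ (p.critLip * (R.α * p.gradBound)) ^ 2 :=
    pow_le_pow_left₀ (norm_nonneg _) h6 2
  have h9 : ‖n‖ ^ 2 ≤ p.semiBound T ^ 2 :=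
    pow_le_pow_left₀ (norm_nonneg _) (hR.norm_n_le (k + 1) ω) 2
  nlinarith [sq_nonneg (‖w' - w‖ - ‖o - o'‖), mul_le_mul_of_nonneg_left h9 (sq_nonneg R.β)]

/-- The mean of `⟨Δ_k, n_k⟩`. -/
noncomputable def _root_.HBA2C.Run.momentum (R : Run S A Ω dw T) (M : Model S A dv dw)
    (μ : Vec dv → Measure S) (p : Params) (P : Measure Ω) (k : ℕ) : ℝ :=
  ∫ ω, inner ℝ (R.err M μ p k ω) (R.n M p (k + 1) ω) ∂P

/-- The mean of `⟨Δ_k, g_k⟩`. -/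
noncomputable def _root_.HBA2C.Run.descent (R : Run S A Ω dw T) (M : Model S A dv dw)
    (μ : Vec dv → Measure S) (p : Params) (P : Measure Ω) (k : ℕ) : ℝ :=
  ∫ ω, inner ℝ (R.err M μ p k ω) (R.g M p k ω) ∂P

/-- The mean of `⟨Δ_k, w*_{v_k} - w*_{v_{k+1}}⟩`. -/
noncomputable def _root_.HBA2C.Run.drift (R : Run S A Ω dw T) (M : Model S A dv dw)
    (μ : Vec dv → Measure S) (p : Params) (P : Measure Ω) (k : ℕ) : ℝ :=
  ∫ ω, inner ℝ (R.err M μ p k ω) (M.optCritic μ p.γ T (R.v M p k ω)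
    - M.optCritic μ p.γ T (R.v M p (k + 1) ω)) ∂P

/-- The mean squared critic error. -/
noncomputable def _root_.HBA2C.Run.mse (R : Run S A Ω dw T) (M : Model S A dv dw)
    (μ : Vec dv → Measure S) (p : Params) (P : Measure Ω) (k : ℕ) : ℝ :=
  ∫ ω, ‖R.err M μ p k ω‖ ^ 2 ∂P

/-- The mean squared norm of the policy gradient. -/
noncomputable def _root_.HBA2C.Run.gradSq (R : Run S A Ω dw T) (M : Model S A dv dw)
    (μ : Vec dv → Measure S) (p : Params) (P : Measure Ω) (k : ℕ) : ℝ :=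
  ∫ ω, ‖M.polGrad μ p.γ T (R.v M p k ω)‖ ^ 2 ∂P

theorem measurable_opt (hR : R.Valid M μ p P ℱ) (k : ℕ) :
    Measurable (fun ω => M.optCritic μ p.γ T (R.v M p k ω)) :=
  (hR.std.isC11_optCritic T).lipschitzWith.continuous.measurable.comp (hR.measurable_v k)

theorem integrable_inner_opt_sub (hR : R.Valid M μ p P ℱ) (k : ℕ) :
    Integrable (fun ω => inner ℝ (R.err M μ p k ω) (M.optCritic μ p.γ T (R.v M p k ω)
      - M.optCritic μ p.γ T (R.v M p (k + 1) ω))) P :=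
  hR.integrable_inner k ((hR.measurable_opt k).sub (hR.measurable_opt (k + 1)))
    (hR.norm_opt_sub_le k)

theorem mse_step (hR : R.Valid M μ p P ℱ) (k : ℕ) :
    1 / 2 * R.mse M μ p P (k + 1) ≤ 1 / 2 * R.mse M μ p P k - R.β * R.momentum M μ p P k
      + R.drift M μ p P k + p.semiBound T ^ 2 * R.β ^ 2
      + p.critLip ^ 2 * p.gradBound ^ 2 * R.α ^ 2 := by
  have := hR.prob
  have i1 := hR.integrable_err_sq k
  have i2 := hR.integrable_inner k (hR.measurable_n (k + 1)) (hR.norm_n_le (k + 1))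
  have i3 := hR.integrable_inner_opt_sub k
  have j1 : Integrable (fun ω => 1 / 2 * ‖R.err M μ p k ω‖ ^ 2
      - R.β * inner ℝ (R.err M μ p k ω) (R.n M p (k + 1) ω)) P :=
    (i1.const_mul _).sub (i2.const_mul _)
  have j2 : Integrable (fun ω => 1 / 2 * ‖R.err M μ p k ω‖ ^ 2
      - R.β * inner ℝ (R.err M μ p k ω) (R.n M p (k + 1) ω)
      + inner ℝ (R.err M μ p k ω) (M.optCritic μ p.γ T (R.v M p k ω)
            - M.optCritic μ p.γ T (R.v M p (k + 1) ω))) P := j1.add i3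
  have j3 : Integrable (fun ω => 1 / 2 * ‖R.err M μ p k ω‖ ^ 2
      - R.β * inner ℝ (R.err M μ p k ω) (R.n M p (k + 1) ω)
      + inner ℝ (R.err M μ p k ω) (M.optCritic μ p.γ T (R.v M p k ω)
            - M.optCritic μ p.γ T (R.v M p (k + 1) ω)) + p.semiBound T ^ 2 * R.β ^ 2) P :=
    j2.add (integrable_const _)
  have h := integral_mono ((hR.integrable_err_sq (k + 1)).const_mul (1 / 2))
    (j3.add (integrable_const (p.critLip ^ 2 * p.gradBound ^ 2 * R.α ^ 2))) (hR.err_step k)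
  simp only [Pi.add_apply] at h
  rw [integral_add j3 (integrable_const _), integral_add j2 (integrable_const _),
    integral_add j1 i3, integral_sub (i1.const_mul _) (i2.const_mul _), integral_const_mul,
    integral_const_mul, integral_const_mul] at h
  simpa [mse, momentum, drift] using h

/-- Since `n_{-1} = 0`, the first momentum vector is `η g_0`. The index is shifted: `R.n M p (k +
1)` is `n_k`. -/
theorem momentum_zero (R : Run S A Ω dw T) (M : Model S A dv dw)
    (μ : Vec dv → Measure S) (p : Params) (P : Measure Ω) :
    R.momentum M μ p P 0 = R.η * R.descent M μ p P 0 := by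
  rw [momentum, descent, ← integral_const_mul]
  simp only [n_succ, n_zero, smul_zero, zero_add, real_inner_smul_right]

theorem norm_err_sub_le (hR : R.Valid M μ p P ℱ) (k : ℕ) (ω : Ω) :
    ‖R.err M μ p (k + 1) ω - R.err M μ p k ω‖
      ≤ R.β * p.semiBound T + p.critLip * (R.α * p.gradBound) := by
  have := hR.std.adm.critLip_nonneg
  refine (hR.std.norm_sub_optCritic_sub_le _ _ _ _).trans ?_
  gcongr
  · exact hR.norm_w_sub_le k ω
  · exact hR.norm_v_sub_le k ω

/-- The momentum update is split, and in the part carried over from the previous frame `Δ_{k+1}` is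
replaced by `Δ_k`; the price is `‖Δ_{k+1} - Δ_k‖ ‖n_k‖`. -/
theorem momentum_succ (hR : R.Valid M μ p P ℱ) (k : ℕ) :
    (1 - R.η) * R.momentum M μ p P k + R.η * R.descent M μ p P (k + 1)
      - (1 - R.η) * ((R.β * p.semiBound T + p.critLip * (R.α * p.gradBound)) * p.semiBound T)
      ≤ R.momentum M μ p P (k + 1) := by
  have := hR.prob
  have hη : 0 ≤ 1 - R.η := sub_nonneg.2 hR.η_le
  have i1 := hR.integrable_inner k (hR.measurable_n (k + 1)) (hR.norm_n_le (k + 1))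
  have i2 := hR.integrable_inner (k + 1) (hR.measurable_n (k + 1)) (hR.norm_n_le (k + 1))
  have i3 := hR.integrable_inner (k + 1) (hR.measurable_g (k + 1)) (hR.norm_g_le (k + 1))
  have e : R.momentum M μ p P (k + 1) = (1 - R.η) *
      ∫ ω, inner ℝ (R.err M μ p (k + 1) ω) (R.n M p (k + 1) ω) ∂P
      + R.η * R.descent M μ p P (k + 1) := by
    rw [momentum, descent, ← integral_const_mul, ← integral_const_mul,
      ← integral_add (i2.const_mul _) (i3.const_mul _)]
    simp only [n_succ R M p (k + 1), inner_add_right, real_inner_smul_right]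
  have h1 : |∫ ω, (inner ℝ (R.err M μ p (k + 1) ω) (R.n M p (k + 1) ω)
      - inner ℝ (R.err M μ p k ω) (R.n M p (k + 1) ω)) ∂P|
      ≤ (R.β * p.semiBound T + p.critLip * (R.α * p.gradBound)) * p.semiBound T := by
    refine abs_integral_le_of_bound _ fun ω => ?_
    rw [← inner_sub_left]
    exact (abs_real_inner_le_norm _ _).trans (mul_le_mul (hR.norm_err_sub_le k ω)
      (hR.norm_n_le (k + 1) ω) (norm_nonneg _)
      ((norm_nonneg _).trans (hR.norm_err_sub_le k ω)))
  rw [integral_sub i2 i1] at h1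
  have h2 := mul_le_mul_of_nonneg_left (abs_le.1 h1).1 hη
  rw [e]
  unfold momentum
  linarith

theorem momentum_le (hR : R.Valid M μ p P ℱ) (k : ℕ) :
    R.momentum M μ p P k ≤ 2 * p.Rw * p.semiBound T := by
  have := hR.prob
  refine (le_abs_self _).trans (abs_integral_le_of_bound _ fun ω => ?_)
  exact (abs_real_inner_le_norm _ _).trans (mul_le_mul (hR.norm_err_le k ω)
    (hR.norm_n_le (k + 1) ω) (norm_nonneg _) (by linarith [hR.std.adm.Rw_pos]))

/-- Averaging over the rollout replaces `g` by its mean from the frame start, which is the full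
semi-gradient up to the bias. The former contributes at least `σ‖Δ‖²` by coercivity, the latter is
bounded by decorrelation. -/
theorem descent_ge (hR : R.Valid M μ p P ℱ) (k : ℕ) :
    sig p.γ p.lam T * R.mse M μ p P k
      - (4 * p.Rw * p.semiBound T * R.β
        + (2 * p.critLip + 2 * (p.mix + 2 * T) * p.ell * p.Rw) * p.semiBound T
          * (R.α * p.gradBound)
        + (2 * p.semiBound T + 8 * p.Rw) * (R.β * p.semiBound T))
      ≤ R.descent M μ p P k := by
  have := hR.prob
  have hstd := hR.std
  have hG := hstd.adm.semiBound_nonneg T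
  have hRw := hstd.adm.Rw_pos
  have hl := hstd.adm.ell_nonneg
  have hc := hstd.adm.critLip_nonneg
  have hmix := hstd.adm.mix_pos
  have hbias := hR.abs_integral_state_le (Ψ := M.semiBias μ p.γ T) (by positivity)
    (by positivity) (by positivity)
    (fun v w _ => Model.Standing.measurable_semiBias M μ p.γ v w)
    (fun v w hw => hstd.integral_semiBias v hw)
    (fun v w s hw => hstd.abs_semiBias_le hR.opt_le v s hw)
    (fun v v' w w' s hw hw' => hstd.abs_semiBias_sub_le hR.opt_le v v' w w' s hw hw') k
  have hbm := hR.measurable_comp_state (Ψ := M.semiBias μ p.γ T)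
    (fun v w _ => Model.Standing.measurable_semiBias M μ p.γ v w)
    (fun v v' w w' s hw hw' => hstd.abs_semiBias_sub_le hR.opt_le v v' w w' s hw hw') k k
  have hbi : Integrable (fun ω => M.semiBias μ p.γ T (R.v M p k ω) (R.w M p k ω) (R.s k ω)) P :=
    integrable_of_bound P hbm (fun ω => hstd.abs_semiBias_le hR.opt_le _ _ (hR.norm_w_le k ω))
  have hFm : Measurable (fun q : (Vec dv × Vec dw × S) × Traj S A T =>
      (inner ℝ (q.1.2.1 - M.optCritic μ p.γ T q.1.1) (M.semiGrad p.γ q.1.2.1 q.2) : ℝ)) := by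
    have h1 : Measurable (M.optCritic μ p.γ T) :=
      (hstd.isC11_optCritic T).lipschitzWith.continuous.measurable
    have h2 := (M.measurable_semiGrad_joint p.γ).comp
      (show Measurable (fun q : (Vec dv × Vec dw × S) × Traj S A T => (q.1.2.1, q.2)) by fun_prop)
    simp only [Function.comp_def] at h2
    fun_prop
  have hFb : ∀ ω (O : Traj S A T), |(inner ℝ (R.w M p k ω - M.optCritic μ p.γ T (R.v M p k ω))
      (M.semiGrad p.γ (R.w M p k ω) O) : ℝ)| ≤ 2 * p.Rw * p.semiBound T := fun ω O =>
    (abs_real_inner_le_norm _ _).trans (mul_le_mul (hR.norm_err_le k ω)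
      (hstd.norm_semiGrad_le_semiBound (hR.norm_w_le k ω) O) (norm_nonneg _) (by positivity))
  have e := hR.integral_frame k hFm (fun ω => hFb ω (R.O k ω))
  have hm := hR.measurable_integral_frame k hFm
  have hi := integrable_of_bound P hm (fun ω => abs_integral_le_of_bound _ (hFb ω))
  have hpt : ∀ ω, sig p.γ p.lam T * ‖R.err M μ p k ω‖ ^ 2
      - M.semiBias μ p.γ T (R.v M p k ω) (R.w M p k ω) (R.s k ω)
      ≤ ∫ O, inner ℝ (R.w M p k ω - M.optCritic μ p.γ T (R.v M p k ω))
        (M.semiGrad p.γ (R.w M p k ω) O) ∂(M.rollout (R.v M p k ω) T (R.s k ω)) := fun ω => by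
    rw [integral_inner (hstd.integrable_semiGrad _ _)]
    have h1 := hstd.coercive T (R.v M p k ω) (R.err M μ p k ω)
    -- Subtracting the equation `Φ_v w*_v = b_v` makes the full semi-gradient linear in the critic
    -- error.
    have h2 : M.fullSemiGrad μ p.γ T (R.v M p k ω) (R.w M p k ω)
        = M.critMat μ hstd.ergodic.prob p.γ T (R.v M p k ω) (R.err M μ p k ω) := by
      rw [hstd.fullSemiGrad_eq, err, map_sub, hstd.critMat_optCritic]
    rw [← h2] at h1
    simp only [Model.semiBias, inner_sub_right, Model.semiFrom] at h1 ⊢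
    unfold err at h1 ⊢
    linarith
  have hmono := integral_mono (((hR.integrable_err_sq k).const_mul (sig p.γ p.lam T)).sub hbi)
    hi hpt
  simp only [Pi.sub_apply] at hmono
  rw [integral_sub ((hR.integrable_err_sq k).const_mul _) hbi, integral_const_mul, ← e] at hmono
  have h3 := (abs_le.1 hbias).2
  unfold descent mse
  change _ ≤ ∫ ω, inner ℝ (R.w M p k ω - M.optCritic μ p.γ T (R.v M p k ω))
        (M.semiGrad p.γ (R.w M p k ω) (R.O k ω)) ∂P
  linarith

/-- The inner product of the critic error with the image of the stochastic policy gradient under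
the derivative of the optimal critic. -/
noncomputable def _root_.HBA2C.Model.driftForm (M : Model S A dv dw) (μ : Vec dv → Measure S)
    (γ : ℝ) (q : (Vec dv × Vec dw × S) × Traj S A T) : ℝ :=
  inner ℝ (q.1.2.1 - M.optCritic μ γ T q.1.1)
    (fderiv ℝ (M.optCritic μ γ T) q.1.1 (M.stochPolGrad γ q.1.1 q.1.2.1 q.2))

theorem _root_.HBA2C.Model.Standing.norm_fderiv_apply_le (hstd : M.Standing μ p) (v y : Vec dv) :
    ‖fderiv ℝ (M.optCritic μ p.γ T) v y‖ ≤ p.critLip * ‖y‖ :=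
  (ContinuousLinearMap.le_opNorm _ _).trans
    (mul_le_mul_of_nonneg_right (hstd.norm_fderiv_optCritic_le v) (norm_nonneg y))

/-- The derivative of `w*` is Lipschitz in `v`, so its application to a vector is jointly
continuous; the remaining ingredients are jointly measurable. -/
theorem _root_.HBA2C.Model.Standing.measurable_driftForm (hstd : M.Standing μ p) :
    Measurable (M.driftForm (T := T) μ p.γ) := by
  have hc2 := hstd.adm.critSecond_nonneg
  have hdiff := (hstd.isC11_optCritic T).differentiable hc2
  have hDcont : Continuous (fderiv ℝ (M.optCritic μ p.γ T)) := by
    refine (LipschitzWith.of_dist_le_mul (K := p.critSecond.toNNReal) fun v v' => ?_).continuous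
    rw [dist_eq_norm, dist_eq_norm, Real.coe_toNNReal _ hc2]
    exact (hstd.isC11_optCritic T).norm_fderiv_sub_le hc2 (hdiff v) (hdiff v')
  have hDm : Measurable (fun q : Vec dv × Vec dv => fderiv ℝ (M.optCritic μ p.γ T) q.1 q.2) :=
    Continuous.measurable ((hDcont.comp continuous_fst).clm_apply continuous_snd)
  have h1 : Measurable (M.optCritic μ p.γ T) :=
    (hstd.isC11_optCritic T).lipschitzWith.continuous.measurable
  have h2 := (hstd.policy.measurable_stochPolGrad_joint p.γ T).comp
    (show Measurable (fun q : (Vec dv × Vec dw × S) × Traj S A T =>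
      ((q.1.1, q.1.2.1), q.2)) by fun_prop)
  have h3 := hDm.comp ((show Measurable (fun q : (Vec dv × Vec dw × S) × Traj S A T => q.1.1)
    by fun_prop).prodMk h2)
  have h4 : Measurable (fun q : (Vec dv × Vec dw × S) × Traj S A T =>
    q.1.2.1 - M.optCritic μ p.γ T q.1.1) := by fun_prop
  exact h4.inner h3

theorem abs_driftForm_le (hR : R.Valid M μ p P ℱ) (k : ℕ) (ω : Ω) (O : Traj S A T) :
    |M.driftForm μ p.γ ((R.v M p k ω, R.w M p k ω, R.s k ω), O)|
      ≤ 2 * p.Rw * (p.critLip * p.gradBound) :=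
  (abs_real_inner_le_norm _ _).trans (mul_le_mul (hR.norm_err_le k ω)
    ((hR.std.norm_fderiv_apply_le _ _).trans (mul_le_mul_of_nonneg_left
      (hR.std.norm_stochPolGrad_le _ (hR.norm_w_le k ω) O) hR.std.adm.critLip_nonneg))
    (norm_nonneg _) (by linarith [hR.std.adm.Rw_pos]))

/-- The mean of `H` from `s` is `(1 - γ^T) meanGrad` plus a deviation collected in `gradBias`.
Replacing `w` by `w*_v` in `meanGrad` gives `∇J(v)` at the cost `(1 + γ) Rπ ‖Δ‖`. What remains is `L
‖Δ‖ ‖∇J‖`, with `L` the bound on the derivative of `w*`. -/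
theorem _root_.HBA2C.Model.Standing.integral_driftForm_ge (hstd : M.Standing μ p)
    (hopt : ∀ v, ‖M.optCritic μ p.γ T v‖ ≤ p.Rw) (v : Vec dv) {w : Vec dw} (hw : ‖w‖ ≤ p.Rw)
    (s : S) :
    -(1 / 4 * ‖M.polGrad μ p.γ T v‖ ^ 2)
      - (p.critLip ^ 2 + (1 + p.γ) * p.Rπ * p.critLip) * ‖w - M.optCritic μ p.γ T v‖ ^ 2
      + M.gradBias μ p.γ T v w s
      ≤ ∫ O, M.driftForm μ p.γ ((v, w, s), O) ∂(M.rollout v T s) := by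
  have hγ := hstd.adm.γ_pos
  have hc := hstd.adm.critLip_nonneg
  have hRπ := hstd.adm.Rπ_nonneg
  have hHi : Integrable (fun O : Traj S A T => M.stochPolGrad p.γ v w O) (M.rollout v T s) :=
    integrable_of_bound _ (hstd.policy.measurable_stochPolGrad p.γ T _ _)
      (hstd.norm_stochPolGrad_le _ hw)
  have e : ∫ O, M.driftForm μ p.γ ((v, w, s), O) ∂(M.rollout v T s)
      = inner ℝ (w - M.optCritic μ p.γ T v)
        (fderiv ℝ (M.optCritic μ p.γ T) v (M.gradFrom p.γ T v w s)) := by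
    simp only [Model.driftForm]
    rw [integral_inner (ContinuousLinearMap.integrable_comp _ hHi),
      ContinuousLinearMap.integral_comp_comm _ hHi]
    rfl
  rw [e]
  have hJ : ‖M.meanGrad μ p.γ v w‖
      ≤ ‖M.polGrad μ p.γ T v‖ + (1 + p.γ) * p.Rπ * ‖w - M.optCritic μ p.γ T v‖ := by
    rw [hstd.polGrad_eq T v (hopt v)]
    have := hstd.norm_meanGrad_sub_le' v hw (hopt v)
    have h2 := norm_le_norm_add_norm_sub' (M.meanGrad μ p.γ v w)
      (M.meanGrad μ p.γ v (M.optCritic μ p.γ T v))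
    linarith
  have hDn := hstd.norm_fderiv_apply_le (T := T) v (M.meanGrad μ p.γ v w)
  have h1 : M.gradBias μ p.γ T v w s
      = inner ℝ (w - M.optCritic μ p.γ T v)
          (fderiv ℝ (M.optCritic μ p.γ T) v (M.gradFrom p.γ T v w s))
        - (1 - p.γ ^ T) * inner ℝ (w - M.optCritic μ p.γ T v)
          (fderiv ℝ (M.optCritic μ p.γ T) v (M.meanGrad μ p.γ v w)) := by
    rw [Model.gradBias, Model.gradDev, map_sub, map_smul, inner_sub_right,
      real_inner_smul_right]
  rw [h1]
  generalize fderiv ℝ (M.optCritic μ p.γ T) v (M.gradFrom p.γ T v w s) = y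
  generalize fderiv ℝ (M.optCritic μ p.γ T) v (M.meanGrad μ p.γ v w) = z at hDn ⊢
  generalize ‖M.polGrad μ p.γ T v‖ = x at hJ ⊢
  generalize w - M.optCritic μ p.γ T v = u at hJ ⊢
  have h2 : |(inner ℝ u z : ℝ)| ≤ ‖u‖ * (p.critLip * (x + (1 + p.γ) * p.Rπ * ‖u‖)) :=
    (abs_real_inner_le_norm _ _).trans (by
      gcongr
      exact hDn.trans (by gcongr))
  have h3 : -((1 - p.γ ^ T) * inner ℝ u z)
      ≤ ‖u‖ * (p.critLip * (x + (1 + p.γ) * p.Rπ * ‖u‖)) := by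
    have a0 : 0 ≤ 1 - p.γ ^ T := sub_nonneg.2 (hstd.adm.pow_le_one T)
    have a1 : 1 - p.γ ^ T ≤ 1 := by linarith [pow_nonneg hγ.le T]
    refine (neg_le_abs _).trans ?_
    rw [abs_mul, abs_of_nonneg a0]
    exact (mul_le_of_le_one_left (abs_nonneg _) a1).trans h2
  -- Young's inequality `L‖Δ‖ x ≤ x²/4 + L²‖Δ‖²`, the origin of the coefficient `α/4` of `‖∇J‖²`.
  nlinarith [sq_nonneg (p.critLip * ‖u‖ - x / 2)]

/-- The stochastic first-order part of the drift of the optimal critic. -/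
noncomputable def _root_.HBA2C.Run.drift₁ (R : Run S A Ω dw T) (M : Model S A dv dw)
    (μ : Vec dv → Measure S) (p : Params) (k : ℕ) (ω : Ω) : ℝ :=
  M.driftForm μ p.γ ((R.v M p k ω, R.w M p k ω, R.s k ω), R.O k ω)

theorem integrable_drift₁ (hR : R.Valid M μ p P ℱ) (k : ℕ) :
    Integrable (R.drift₁ M μ p k) P := by
  have := hR.prob
  exact integrable_of_bound P
    (hR.std.measurable_driftForm.comp ((hR.measurable_state k).prodMk (hR.measurable_O k)))
    (fun ω => hR.abs_driftForm_le k ω (R.O k ω))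

/-- A Lipschitz bound on `w*` alone would leave an error of order `α`. Expanding to first order
exposes `H`, whose mean can be compared with `∇J`, and leaves only a remainder of order `α²`. -/
theorem inner_opt_sub_le (hR : R.Valid M μ p P ℱ) (k : ℕ) (ω : Ω) :
    inner ℝ (R.err M μ p k ω) (M.optCritic μ p.γ T (R.v M p k ω)
        - M.optCritic μ p.γ T (R.v M p (k + 1) ω))
      ≤ -(R.α * R.drift₁ M μ p k ω)
        + 2 * p.Rw * p.critSecond * p.gradBound ^ 2 * R.α ^ 2 := by
  have hRw := hR.std.adm.Rw_pos
  have hc2 := hR.std.adm.critSecond_nonneg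
  have h1 := (hR.std.isC11_optCritic T).norm_sub_fderiv_le hc2 (R.v M p k ω) (R.v M p (k + 1) ω)
  have h2 := hR.norm_v_sub_le k ω
  have h3 : R.v M p (k + 1) ω - R.v M p k ω = R.α • R.h M p k ω := by
    rw [v_succ, add_sub_cancel_left]
  have h7 : R.drift₁ M μ p k ω = inner ℝ (R.err M μ p k ω)
      (fderiv ℝ (M.optCritic μ p.γ T) (R.v M p k ω) (R.h M p k ω)) := rfl
  have h8 : fderiv ℝ (M.optCritic μ p.γ T) (R.v M p k ω) (R.v M p (k + 1) ω - R.v M p k ω)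
      = R.α • fderiv ℝ (M.optCritic μ p.γ T) (R.v M p k ω) (R.h M p k ω) := by
    rw [h3, map_smul]
  rw [h7]
  rw [h8] at h1
  have h9 := hR.norm_err_le k ω
  generalize fderiv ℝ (M.optCritic μ p.γ T) (R.v M p k ω) (R.h M p k ω) = z at h1 ⊢
  generalize M.optCritic μ p.γ T (R.v M p k ω) = o at h1 ⊢
  generalize M.optCritic μ p.γ T (R.v M p (k + 1) ω) = o' at h1 ⊢
  generalize R.err M μ p k ω = u at h9 ⊢
  have h4 : o - o' = -(R.α • z) - (o' - o - R.α • z) := by abel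
  rw [h4, inner_sub_right, inner_neg_right, real_inner_smul_right]
  have h5 : -(inner ℝ u (o' - o - R.α • z) : ℝ)
      ≤ 2 * p.Rw * (p.critSecond * (R.α * p.gradBound) ^ 2) := by
    refine (neg_le_abs _).trans ((abs_real_inner_le_norm _ _).trans ?_)
    refine mul_le_mul h9 (h1.trans ?_) (norm_nonneg _) (by positivity)
    gcongr
  linarith

/-- Averages the pointwise bound `integral_driftForm_ge` over the run; the centred bias is handled
by decorrelation. -/
theorem integral_drift₁_ge (hR : R.Valid M μ p P ℱ) (k : ℕ) :
    -(1 / 4 * R.gradSq M μ p P k)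
      - (p.critLip ^ 2 + (1 + p.γ) * p.Rπ * p.critLip) * R.mse M μ p P k
      - (4 * p.Rw * p.critLip * p.gradBound * R.β + p.biasLip * (R.α * p.gradBound)
        + 6 * p.critLip * p.gradBound * (R.β * p.semiBound T))
      ≤ ∫ ω, R.drift₁ M μ p k ω ∂P := by
  have := hR.prob
  have hstd := hR.std
  have hRw := hstd.adm.Rw_pos
  have hH := hstd.adm.gradBound_nonneg
  have hc := hstd.adm.critLip_nonneg
  have hbias := hR.abs_integral_state_le (Ψ := M.gradBias μ p.γ T) (by positivity)
    hstd.adm.biasLip_nonneg (by positivity)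
    (fun v w _ => hstd.measurable_gradBias v w)
    (fun v w hw => hstd.integral_gradBias v hw)
    (fun v w s hw => hstd.abs_gradBias_le hR.opt_le v s hw)
    (fun v v' w w' s hw hw' => hstd.abs_gradBias_sub_le hR.opt_le v v' w w' s hw hw') k
  have hbm := hR.measurable_comp_state (Ψ := M.gradBias μ p.γ T)
    (fun v w _ => hstd.measurable_gradBias v w)
    (fun v v' w w' s hw hw' => hstd.abs_gradBias_sub_le hR.opt_le v v' w w' s hw hw') k k
  have hbi : Integrable (fun ω => M.gradBias μ p.γ T (R.v M p k ω) (R.w M p k ω) (R.s k ω)) P :=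
    integrable_of_bound P hbm (fun ω => hstd.abs_gradBias_le hR.opt_le _ _ (hR.norm_w_le k ω))
  have hJm : Measurable (fun ω => M.polGrad μ p.γ T (R.v M p k ω)) :=
    (hstd.continuous_polGrad hR.opt_le).measurable.comp (hR.measurable_v k)
  have hJi : Integrable (fun ω => ‖M.polGrad μ p.γ T (R.v M p k ω)‖ ^ 2) P := by
    refine integrable_of_bound P (hJm.norm.pow_const 2) (B := p.gradBound ^ 2) fun ω => ?_
    rw [norm_pow, norm_norm, hstd.polGrad_eq T _ (hR.opt_le _)]
    exact pow_le_pow_left₀ (norm_nonneg _) (hstd.norm_meanGrad_le _ (hR.opt_le _)) 2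
  have hei := hR.integrable_err_sq k
  have e : ∫ ω, R.drift₁ M μ p k ω ∂P = ∫ ω, (∫ O, M.driftForm μ p.γ
      ((R.v M p k ω, R.w M p k ω, R.s k ω), O) ∂(M.rollout (R.v M p k ω) T (R.s k ω))) ∂P :=
    hR.integral_frame k hstd.measurable_driftForm (fun ω => hR.abs_driftForm_le k ω (R.O k ω))
  have hi := integrable_of_bound P (hR.measurable_integral_frame k hstd.measurable_driftForm)
    (fun ω => abs_integral_le_of_bound _ (hR.abs_driftForm_le k ω))
  have hpt := fun ω => hstd.integral_driftForm_ge hR.opt_le (R.v M p k ω) (hR.norm_w_le k ω)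
    (R.s k ω)
  have j0 : Integrable (fun ω => -(1 / 4 * ‖M.polGrad μ p.γ T (R.v M p k ω)‖ ^ 2)) P :=
    (hJi.const_mul _).neg
  have j1 : Integrable (fun ω => -(1 / 4 * ‖M.polGrad μ p.γ T (R.v M p k ω)‖ ^ 2)
      - (p.critLip ^ 2 + (1 + p.γ) * p.Rπ * p.critLip) * ‖R.err M μ p k ω‖ ^ 2) P :=
    j0.sub (hei.const_mul _)
  have hmono := integral_mono (j1.add hbi) hi hpt
  simp only [Pi.add_apply] at hmono
  rw [integral_add j1 hbi, integral_sub j0 (hei.const_mul _), integral_neg,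
    integral_const_mul, integral_const_mul, ← e] at hmono
  have h9 := (abs_le.1 hbias).1
  unfold gradSq mse
  linarith

theorem drift_le (hR : R.Valid M μ p P ℱ) (k : ℕ) :
    R.drift M μ p P k ≤ R.α * (1 / 4 * R.gradSq M μ p P k
        + (p.critLip ^ 2 + (1 + p.γ) * p.Rπ * p.critLip) * R.mse M μ p P k)
      + R.α * (4 * p.Rw * p.critLip * p.gradBound * R.β + p.biasLip * (R.α * p.gradBound)
        + 6 * p.critLip * p.gradBound * (R.β * p.semiBound T))
      + 2 * p.Rw * p.critSecond * p.gradBound ^ 2 * R.α ^ 2 := by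
  have := hR.prob
  have j : Integrable (fun ω => -(R.α * R.drift₁ M μ p k ω)) P :=
    ((hR.integrable_drift₁ k).const_mul R.α).neg
  have h := integral_mono (hR.integrable_inner_opt_sub k) (j.add
    (integrable_const (2 * p.Rw * p.critSecond * p.gradBound ^ 2 * R.α ^ 2)))
    (hR.inner_opt_sub_le k)
  simp only [Pi.add_apply] at h
  rw [integral_add j (integrable_const _), integral_neg, integral_const_mul,
    MeasureTheory.integral_const, probReal_univ, one_smul] at h
  have h' := mul_le_mul_of_nonneg_left (hR.integral_drift₁_ge k) hR.α_pos.le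
  unfold drift
  linarith

end Valid

end Run

/-- Summing a perturbed momentum recursion. -/
theorem sum_le_of_momentum {x a : ℕ → ℝ} {η c : ℝ} (h0 : x 0 = η * a 0)
    (hs : ∀ k, (1 - η) * x k + η * a (k + 1) - (1 - η) * c ≤ x (k + 1)) (K : ℕ) :
    η * ∑ k ∈ Finset.range (K + 1), a k
      ≤ η * ∑ k ∈ Finset.range (K + 1), x k + (1 - η) * x K + K * ((1 - η) * c) := by
  induction K with
  | zero => simp; linarith
  -- The boundary term `(1 - η) x K` telescopes: the recursion removes it at `K` and restores it at
  -- `K + 1`.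
  | succ K ih =>
    rw [Finset.sum_range_succ _ (K + 1), Finset.sum_range_succ _ (K + 1)]
    push_cast
    linarith [hs K]

/-! ### The final constants `L_*` and `G_*` -/

namespace Params

/-- A bound for the semi-gradient, uniform in the length of the trajectory. -/
noncomputable def semiBoundSup (p : Params) : ℝ := 2 * p.Rw + p.Rr / (1 - p.γ)

/-- The constant bounding the derivative of the optimal critic. -/
noncomputable def derivConst (p : Params) : ℝ :=
  1 + p.critLip * (3 + 3 * p.semiBoundSup / p.Rw)

/-- The constant serving as Lipschitz constant of the optimal critic in the final bound. -/
noncomputable def lipConst (p : Params) : ℝ :=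
  1 + p.critLip + p.critLip ^ 2 + 2 * p.Rw * p.critSecond + p.biasLip / p.gradBound

variable {p : Params}

theorem Admissible.semiBound_le (h : p.Admissible) (T : ℕ) :
    p.semiBound T ≤ p.semiBoundSup := by
  have h1 := h.pow_le_one T
  have h2 : 0 ≤ p.γ ^ T := pow_nonneg h.γ_pos.le T
  have h3 := h.Rw_pos
  have h4 := h.Rr_nonneg
  have h5 : 0 < 1 - p.γ := by linarith [h.γ_lt]
  unfold semiBound semiBoundSup Rg
  rw [div_mul_eq_mul_div]
  gcongr
  · linarith
  · nlinarith

theorem Admissible.semiBoundSup_nonneg (h : p.Admissible) : 0 ≤ p.semiBoundSup :=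
  (h.semiBound_nonneg 0).trans (h.semiBound_le 0)

theorem Admissible.derivConst_pos (h : p.Admissible) : 0 < p.derivConst := by
  have h1 := h.critLip_nonneg
  have h2 := h.semiBoundSup_nonneg
  have h3 := h.Rw_pos
  unfold derivConst; positivity

theorem Admissible.critLip_le_derivConst (h : p.Admissible) : p.critLip ≤ p.derivConst := by
  have h1 := h.critLip_nonneg
  have h2 := h.semiBoundSup_nonneg
  have h3 := h.Rw_pos
  have h4 : 0 ≤ p.critLip * (3 * p.semiBoundSup / p.Rw) := by positivity
  unfold derivConst
  linarith

/-- Explains the shape of `derivConst`: the terms of order `αβ` produced by the gradient bias must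
fit into `2 R_w G_*`, with `R_g` bounded uniformly in `T`. -/
theorem Admissible.le_derivConst (h : p.Admissible) (T : ℕ) :
    4 * p.Rw * p.critLip + 6 * p.critLip * p.semiBound T ≤ 2 * p.Rw * p.derivConst := by
  have h1 := h.critLip_nonneg
  have h3 := h.Rw_pos
  have h4 : 2 * p.Rw * p.derivConst
      = 2 * p.Rw + 6 * p.Rw * p.critLip + 6 * p.critLip * p.semiBoundSup := by
    unfold derivConst; field_simp; ring
  have h5 := mul_le_mul_of_nonneg_left (h.semiBound_le T) h1
  have h6 := mul_nonneg h3.le h1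
  linarith

theorem Admissible.one_le_lipConst (h : p.Admissible) : 1 ≤ p.lipConst := by
  have h1 := h.critLip_nonneg
  have h2 := h.critSecond_nonneg
  have h3 := h.Rw_pos
  have h4 := div_nonneg h.biasLip_nonneg h.gradBound_nonneg
  unfold lipConst
  have : 0 ≤ p.critLip + p.critLip ^ 2 + 2 * p.Rw * p.critSecond := by positivity
  linarith

theorem Admissible.critLip_le_lipConst (h : p.Admissible) : p.critLip ≤ p.lipConst := by
  have h2 := h.critSecond_nonneg
  have h3 := h.Rw_pos
  have h4 := div_nonneg h.biasLip_nonneg h.gradBound_nonneg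
  unfold lipConst
  have : 0 ≤ p.critLip ^ 2 + 2 * p.Rw * p.critSecond := by positivity
  linarith

/-- All terms of order `α²` must fit into `L_*² R_h²`. Since `L_* ≥ 1`, its square dominates `L_*`
itself, which was defined to contain each required summand. -/
theorem Admissible.le_lipConst_sq (h : p.Admissible) :
    p.critLip ^ 2 * p.gradBound ^ 2 + p.biasLip * p.gradBound
        + 2 * p.Rw * p.critSecond * p.gradBound ^ 2
      ≤ p.lipConst ^ 2 * p.gradBound ^ 2 := by
  -- If `R_h = 0`, the quotient inside `lipConst` is the default value `0`; the claim still holds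
  -- because every term carries a factor `R_h`.
  rcases h.gradBound_nonneg.eq_or_lt with h0 | h0
  · simp [← h0]
  · have h1 : p.biasLip * p.gradBound = p.biasLip / p.gradBound * p.gradBound ^ 2 := by
      field_simp
    rw [h1, ← add_mul, ← add_mul]
    refine mul_le_mul_of_nonneg_right ?_ (sq_nonneg _)
    have h2 : p.lipConst ≤ p.lipConst ^ 2 := le_self_pow₀ h.one_le_lipConst two_ne_zero
    have h3 := h.critLip_nonneg
    unfold lipConst at h2 ⊢
    linarith

end Params

/-! ### Summation over the frames -/

namespace Run.Valid

variable {S A Ω : Type*} [MeasurableSpace S] [MeasurableSpace A] {dv dw T : ℕ} [NeZero T]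
  {mΩ : MeasurableSpace Ω} {R : Run S A Ω dw T} {M : Model S A dv dw}
  {μ : Vec dv → Measure S} {p : Params} {P : Measure Ω} {ℱ : Filtration ℕ mΩ}

theorem mse_nonneg (k : ℕ) : 0 ≤ R.mse M μ p P k := integral_nonneg fun _ => sq_nonneg _

theorem sum_momentum_le (hR : R.Valid M μ p P ℱ) (K : ℕ) :
    R.β * ∑ k ∈ Finset.range K, R.momentum M μ p P k
      ≤ 1 / 2 * (R.mse M μ p P 0 - R.mse M μ p P K)
        + ∑ k ∈ Finset.range K, R.drift M μ p P k
        + K * (p.semiBound T ^ 2 * R.β ^ 2 + p.critLip ^ 2 * p.gradBound ^ 2 * R.α ^ 2) := by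
  induction K with
  | zero => simp
  | succ K ih =>
    rw [Finset.sum_range_succ, Finset.sum_range_succ]
    push_cast
    linarith [hR.mse_step K]

theorem sum_drift_le (hR : R.Valid M μ p P ℱ) (K : ℕ) :
    ∑ k ∈ Finset.range K, R.drift M μ p P k
      ≤ R.α / 4 * ∑ k ∈ Finset.range K, R.gradSq M μ p P k
        + R.α * (p.critLip ^ 2 + (1 + p.γ) * p.Rπ * p.critLip)
          * ∑ k ∈ Finset.range K, R.mse M μ p P k
        + K * (R.α * (4 * p.Rw * p.critLip * p.gradBound * R.β + p.biasLip * (R.α * p.gradBound)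
            + 6 * p.critLip * p.gradBound * (R.β * p.semiBound T))
          + 2 * p.Rw * p.critSecond * p.gradBound ^ 2 * R.α ^ 2) := by
  induction K with
  | zero => simp
  | succ K ih =>
    rw [Finset.sum_range_succ, Finset.sum_range_succ, Finset.sum_range_succ]
    push_cast
    linarith [hR.drift_le K]

theorem sum_descent_ge (hR : R.Valid M μ p P ℱ) (K : ℕ) :
    sig p.γ p.lam T * ∑ k ∈ Finset.range K, R.mse M μ p P k
      - K * (4 * p.Rw * p.semiBound T * R.β
        + (2 * p.critLip + 2 * (p.mix + 2 * T) * p.ell * p.Rw) * p.semiBound T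
          * (R.α * p.gradBound)
        + (2 * p.semiBound T + 8 * p.Rw) * (R.β * p.semiBound T))
      ≤ ∑ k ∈ Finset.range K, R.descent M μ p P k := by
  induction K with
  | zero => simp
  | succ K ih =>
    rw [Finset.sum_range_succ, Finset.sum_range_succ]
    push_cast
    linarith [hR.descent_ge K]

/-- The summed recursion is divided by `η`. Bounding the leftover last momentum term by `2 R_w R_g`
yields the final summand of the theorem, the one with `(1 - η)β / (ηK)`. -/
theorem sum_descent_le (hR : R.Valid M μ p P ℱ) {K : ℕ} (hK : 1 ≤ K) :
    ∑ k ∈ Finset.range K, R.descent M μ p P k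
      ≤ ∑ k ∈ Finset.range K, R.momentum M μ p P k
        + (1 - R.η) / R.η * (2 * p.Rw * p.semiBound T)
        + K * ((1 - R.η) / R.η
          * ((R.β * p.semiBound T + p.critLip * (R.α * p.gradBound)) * p.semiBound T)) := by
  obtain ⟨K, rfl⟩ := Nat.exists_eq_add_of_le' hK
  have hη := hR.η_pos
  have hη1 : 0 ≤ 1 - R.η := sub_nonneg.2 hR.η_le
  have hG := hR.std.adm.semiBound_nonneg T
  have hc := hR.std.adm.critLip_nonneg
  have hH := hR.std.adm.gradBound_nonneg
  have hα := hR.α_pos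
  have hβ := hR.β_pos
  have h1 := sum_le_of_momentum (momentum_zero R M μ p P) hR.momentum_succ K
  have h2 := mul_le_mul_of_nonneg_left (hR.momentum_le K) hη1
  set c := (R.β * p.semiBound T + p.critLip * (R.α * p.gradBound)) * p.semiBound T
  have hc0 : 0 ≤ (1 - R.η) * c := by positivity
  refine le_of_mul_le_mul_left ?_ hη
  have e : R.η * (∑ k ∈ Finset.range (K + 1), R.momentum M μ p P k
        + (1 - R.η) / R.η * (2 * p.Rw * p.semiBound T)
        + ((K + 1 : ℕ) : ℝ) * ((1 - R.η) / R.η * c))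
      = R.η * ∑ k ∈ Finset.range (K + 1), R.momentum M μ p P k
        + (1 - R.η) * (2 * p.Rw * p.semiBound T) + (K + 1) * ((1 - R.η) * c) := by
    push_cast; field_simp
  rw [e]
  linarith

/-- The sums are chained: descent is bounded below by `σ ∑ E‖Δ‖²` and above by momentum, `β` times
momentum by the telescoping squared errors and the drift, and the drift by `‖∇J‖²` and `‖Δ‖²`. The
rest is bookkeeping of constants. -/
theorem mean_mse_le (hR : R.Valid M μ p P ℱ) {K : ℕ} (hK : 1 ≤ K) :
    1 / (K : ℝ) * (sig p.γ p.lam T * R.β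
        - ((1 + p.γ) * p.Rπ * p.derivConst + 2 * p.derivConst ^ 2) * R.α) *
        ∑ k ∈ Finset.range K, R.mse M μ p P k
      ≤ R.α / (4 * K) * ∑ k ∈ Finset.range K, R.gradSq M μ p P k
        + 1 / (2 * K) * (R.mse M μ p P 0 - R.mse M μ p P K)
        + p.lipConst ^ 2 * Rh p.γ p.Rr p.Rw p.Rπ ^ 2 * R.α ^ 2
        + (c4 p.γ p.Rr p.Rw R.η T / R.η + Rg p.γ p.Rr p.Rw T ^ 2) * R.β ^ 2
        + (c3 p.γ p.Rr p.Rw p.Lπ p.volA p.mix p.lipConst R.η T / R.η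
            + 2 * p.Rw * p.derivConst) * Rh p.γ p.Rr p.Rw p.Rπ * R.α * R.β
        + 2 * (1 - R.η) * R.β / (R.η * K) * p.Rw * Rg p.γ p.Rr p.Rw T := by
  have hK0 : (0 : ℝ) < K := by exact_mod_cast hK
  have hη := hR.η_pos
  have hη1 : 0 ≤ 1 - R.η := sub_nonneg.2 hR.η_le
  have adm := hR.std.adm
  have hG := adm.semiBound_nonneg T
  have hc := adm.critLip_nonneg
  have hH := adm.gradBound_nonneg
  have hRπ := adm.Rπ_nonneg
  have hRw := adm.Rw_pos
  have hγ := adm.γ_pos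
  have hα := hR.α_pos
  have hβ := hR.β_pos
  have hl := adm.ell_nonneg
  have hE : 0 ≤ ∑ k ∈ Finset.range K, R.mse M μ p P k :=
    Finset.sum_nonneg fun k _ => mse_nonneg k
  have s1 := hR.sum_momentum_le K
  have s2 := hR.sum_drift_le K
  have s3 := mul_le_mul_of_nonneg_left (hR.sum_descent_ge K) hβ.le
  have s4 := mul_le_mul_of_nonneg_left (hR.sum_descent_le hK) hβ.le
  set t := (1 - R.η) / R.η with ht
  have ht0 : 0 ≤ t := div_nonneg hη1 hη.le
  -- With `t = (1 - η)/η`, the summands of `c₃/η` and `c₄/η` that contain `t` come from the delay of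
  -- the momentum, the others from the bias of the semi-gradient.
  have e4 : c4 p.γ p.Rr p.Rw R.η T / R.η
      = (2 * (p.semiBound T + 9 * p.Rw) + t * p.semiBound T) * p.semiBound T := by
    rw [ht, c4, Params.semiBound]; field_simp
  have e3 : c3 p.γ p.Rr p.Rw p.Lπ p.volA p.mix p.lipConst R.η T / R.η
      = ((t + 2) * p.lipConst + 2 * (p.mix + 2 * T) * p.ell * p.Rw) * p.semiBound T := by
    rw [ht, c3, Params.semiBound, Params.ell]; field_simp; ring
  have e5 : 2 * (1 - R.η) * R.β / (R.η * K) * p.Rw * Rg p.γ p.Rr p.Rw T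
      = (R.β * (t * (2 * p.Rw * p.semiBound T))) / K := by
    rw [ht, Params.semiBound]; field_simp
  rw [e4, e3, e5]
  change _ ≤ _ + p.lipConst ^ 2 * p.gradBound ^ 2 * R.α ^ 2 + (_ + p.semiBound T ^ 2) * R.β ^ 2
    + _ * p.gradBound * R.α * R.β + _
  have b0 : (p.critLip ^ 2 + (1 + p.γ) * p.Rπ * p.critLip)
      * ∑ k ∈ Finset.range K, R.mse M μ p P k
      ≤ ((1 + p.γ) * p.Rπ * p.derivConst + 2 * p.derivConst ^ 2)
        * ∑ k ∈ Finset.range K, R.mse M μ p P k := by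
    refine mul_le_mul_of_nonneg_right ?_ hE
    have h1 := adm.critLip_le_derivConst
    have h2 : p.critLip ^ 2 ≤ p.derivConst ^ 2 := pow_le_pow_left₀ hc h1 2
    have h3 : (1 + p.γ) * p.Rπ * p.critLip ≤ (1 + p.γ) * p.Rπ * p.derivConst := by gcongr
    linarith [sq_nonneg p.derivConst]
  have b1 := mul_le_mul_of_nonneg_right adm.le_lipConst_sq (sq_nonneg R.α)
  have b2 : (t + 2) * p.critLip * p.semiBound T ≤ (t + 2) * p.lipConst * p.semiBound T := by
    have := adm.critLip_le_lipConst
    gcongr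
  have b3 := mul_le_mul_of_nonneg_right (add_le_add b2 (adm.le_derivConst T))
    (show 0 ≤ p.gradBound * R.α * R.β by positivity)
  -- The bias contributes `12 R_w R_g β²`, namely `4` from its size and `8` from its Lipschitz
  -- constant in `w`, while `c₄/η` provides `18`; this supplies the slack.
  have b4 : 0 ≤ p.Rw * p.semiBound T * R.β ^ 2 := by positivity
  generalize ∑ k ∈ Finset.range K, R.mse M μ p P k = E at *
  generalize ∑ k ∈ Finset.range K, R.gradSq M μ p P k = G at *
  generalize ∑ k ∈ Finset.range K, R.momentum M μ p P k = X at *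
  generalize ∑ k ∈ Finset.range K, R.descent M μ p P k = D at *
  generalize ∑ k ∈ Finset.range K, R.drift M μ p P k = F at *
  have b0' := mul_le_mul_of_nonneg_left b0 hα.le
  refine le_of_mul_le_mul_left ?_ hK0
  have hl : (K : ℝ) * (1 / K * (sig p.γ p.lam T * R.β
      - ((1 + p.γ) * p.Rπ * p.derivConst + 2 * p.derivConst ^ 2) * R.α) * E)
      = (sig p.γ p.lam T * R.β
      - ((1 + p.γ) * p.Rπ * p.derivConst + 2 * p.derivConst ^ 2) * R.α) * E := by field_simp
  have hr1 : (K : ℝ) * (R.α / (4 * K) * G) = R.α / 4 * G := by field_simp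
  have hr2 : (K : ℝ) * (1 / (2 * K) * (R.mse M μ p P 0 - R.mse M μ p P K))
      = 1 / 2 * (R.mse M μ p P 0 - R.mse M μ p P K) := by field_simp
  have hr3 : (K : ℝ) * (R.β * (t * (2 * p.Rw * p.semiBound T)) / K)
      = R.β * (t * (2 * p.Rw * p.semiBound T)) := by field_simp
  rw [hl, mul_add, mul_add, mul_add, mul_add, mul_add, hr1, hr2, hr3]
  have b1' := mul_le_mul_of_nonneg_left b1 hK0.le
  have b3' := mul_le_mul_of_nonneg_left b3 hK0.le
  have b4' := mul_nonneg hK0.le b4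
  nlinarith only [s1, s2, s3, s4, b0', b1', b3', b4']

end Run.Valid

theorem Model.Standing.tvNorm_stationary_le {S A : Type*} [MeasurableSpace S] [MeasurableSpace A]
    {dv dw : ℕ} {M : Model S A dv dw} {μ : Vec dv → Measure S} {p : Params}
    (h : M.Standing μ p) (v v' : Vec dv) :
    tvNorm (μ v) (μ v') ≤ p.mix * p.volA * p.Lπ * ‖v - v'‖ := by
  have := h.ergodic.prob
  refine tvNorm_le _ _ fun f hf hB => (h.stationary.lip 1 f hf hB v v').trans_eq ?_
  rw [Params.statLip, Params.ell]
  ring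

/-- Clearing the denominator reverses the inequality, as `log ρ < 0`; monotonicity of `log` then
gives `ρ^T ≤ c⁻¹ β`. -/
theorem mul_pow_le_of_log_div_log_le {c β ρ : ℝ} {T : ℕ} (hc : 0 < c) (hβ : 0 < β) (hρ₀ : 0 < ρ)
    (hρ₁ : ρ < 1) (h : Real.log (c⁻¹ * β) / Real.log ρ ≤ T) : c * ρ ^ T ≤ β := by
  rw [div_le_iff_of_neg (Real.log_neg hρ₀ hρ₁), ← Real.log_pow,
    Real.log_le_log_iff (pow_pos hρ₀ T) (by positivity), inv_mul_eq_div, le_div_iff₀ hc] at h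
  linarith

end HBA2C

open HBA2C in
theorem theorem2 (γ lam Rr Rw Rπ Lπ Lπ' c₀ ρ volA : ℝ)
    (hγ₀ : 0 < γ) (hγ₁ : γ < 1) (hlam : 0 < lam) (hRr : 0 ≤ Rr) (hRw : 0 < Rw)
    (hRπ : 0 ≤ Rπ) (hLπ : 0 ≤ Lπ) (hLπ' : 0 ≤ Lπ') (hc₀ : 0 < c₀) (hρ₀ : 0 < ρ) (hρ₁ : ρ < 1) :
    ∃ c₂ Ls Gs : ℝ, 0 < c₂ ∧ 0 < Ls ∧ 0 < Gs ∧
      ∀ (S : Type u₁) (A : Type u₂) [MeasurableSpace S] [MeasurableSpace A] (dv dw : ℕ)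
        (M : Model S A dv dw) (μ : Vec dv → MeasureTheory.Measure S),
        M.refA.real Set.univ = volA →
        (∀ s a, |M.reward s a| ≤ Rr) →
        M.PolicyRegular Rπ Lπ' Lπ →
        M.GeomErgodic μ c₀ ρ →
        M.FeatureCov μ lam →
        (∀ v v', tvNorm (μ v) (μ v') ≤ c₂ * volA * Lπ * ‖v - v'‖) ∧
        ∀ (T : ℕ) [NeZero T],
          (∀ v w, M.fullSemiGrad μ γ T v w = 0 ↔ w = M.optCritic μ γ T v) ∧
          (∀ v v', ‖M.optCritic μ γ T v - M.optCritic μ γ T v'‖ ≤ Ls * ‖v - v'‖) ∧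
          (∀ v, DifferentiableAt ℝ (M.optCritic μ γ T) v ∧
            ‖fderiv ℝ (M.optCritic μ γ T) v‖ ≤ Gs) ∧
          ((∀ v, ‖M.optCritic μ γ T v‖ ≤ Rw) →
            ∀ (α β η : ℝ), 0 < α → 0 < β → 0 < η → η ≤ 1 →
            max (Real.log (c₀⁻¹ * β) / Real.log ρ) (Real.log β / (2 * Real.log γ)) ≤ (T : ℝ) →
            ∀ (w₀ : Vec dw), ‖w₀‖ ≤ Rw →
            ∀ (Ω : Type u₃) (mΩ : MeasurableSpace Ω) (P : MeasureTheory.Measure Ω)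
              [MeasureTheory.IsProbabilityMeasure P] (ℱ : MeasureTheory.Filtration ℕ mΩ)
              (s₀ : Ω → S) (O : ℕ → Ω → Traj S A T),
              Model.Samples P ℱ M γ Rw α β η 0 w₀ s₀ O →
              tvNorm (P.map s₀) (μ 0) ≤ c₀ * ρ ^ T →
              ∀ K : ℕ, 1 ≤ K →
                1 / (K : ℝ) *
                    (sig γ lam T * β - ((1 + γ) * Rπ * Gs + 2 * Gs ^ 2) * α) *
                    ∑ k ∈ Finset.range K, M.criticErr P μ γ Rw α β η 0 w₀ O k
                  ≤ α / (4 * K) * ∑ k ∈ Finset.range K, M.gradSq P μ γ Rw α β η 0 w₀ O k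
                    + 1 / (2 * K) * (M.criticErr P μ γ Rw α β η 0 w₀ O 0
                        - M.criticErr P μ γ Rw α β η 0 w₀ O K)
                    + Ls ^ 2 * Rh γ Rr Rw Rπ ^ 2 * α ^ 2
                    + (c4 γ Rr Rw η T / η + Rg γ Rr Rw T ^ 2) * β ^ 2
                    + (c3 γ Rr Rw Lπ volA c₂ Ls η T / η + 2 * Rw * Gs)
                        * Rh γ Rr Rw Rπ * α * β
                    + 2 * (1 - η) * β / (η * K) * Rw * Rg γ Rr Rw T) := by
  by_cases hvol : 0 ≤ volA
  swap
  -- The total mass of a measure is nonnegative, so for negative `volA` there is no model and any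
  -- constants will do.
  · refine ⟨1, 1, 1, one_pos, one_pos, one_pos, fun S A _ _ dv dw M μ h => ?_⟩
    exact absurd (h ▸ MeasureTheory.measureReal_nonneg) hvol
  let p : Params := ⟨γ, lam, Rr, Rw, Rπ, Lπ, Lπ', c₀, ρ, volA⟩
  have adm : p.Admissible :=
    ⟨hγ₀, hγ₁, hlam, hRr, hRw, hRπ, hLπ, hLπ', hc₀, hρ₀, hρ₁, hvol⟩
  -- The witnesses depend only on the numbers collected in `p`, and are fixed before the model and
  -- `T` are introduced.
  refine ⟨p.mix, p.lipConst, p.derivConst, adm.mix_pos,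
    one_pos.trans_le adm.one_le_lipConst, adm.derivConst_pos,
    fun S A _ _ dv dw M μ hv hr hpol herg hcov => ?_⟩
  have hstd : M.Standing μ p := ⟨adm, hv, hr, hpol, herg, hcov⟩
  refine ⟨fun v v' => hstd.tvNorm_stationary_le v v', fun T _ =>
    ⟨fun v w => hstd.fullSemiGrad_eq_zero_iff T v w, fun v v' => ?_, fun v => ⟨?_, ?_⟩, ?_⟩⟩
  · exact ((hstd.isC11_optCritic T).lip v v').trans
      (mul_le_mul_of_nonneg_right adm.critLip_le_lipConst (norm_nonneg _))
  · exact (hstd.isC11_optCritic T).differentiable adm.critSecond_nonneg v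
  · exact (hstd.norm_fderiv_optCritic_le v).trans adm.critLip_le_derivConst
  · intro hopt α β η hα hβ hη hη1 hT w₀ hw₀ Ω mΩ P hP ℱ s₀ O hO hs₀ K hK
    have hR : (⟨α, β, η, w₀, s₀, O⟩ : Run S A Ω dw T).Valid M μ p P ℱ :=
      ⟨hP, hstd, hopt, hα, hβ, hη, hη1,
        mul_pow_le_of_log_div_log_le hc₀ hβ hρ₀ hρ₁ ((le_max_left _ _).trans hT), hw₀, hO, hs₀⟩
    exact hR.mean_mse_le hK
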